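/- \textbf{Setting.} A \emph{spectral curve} $\mathcal S=(\Sigma,x,\omega_{0,1},\omega_{0,2})$ consists of a finite non-empty disjoint union $\Sigma$ of Riemann surfaces, a holomorphic map $x:\Sigma\to\mathbb P^1$ that is non-constant on each component, a meromorphic $1$-form $\omega_{0,1}$ that is not identically zero on any component, and a symmetric meromorphic bidifferential $\omega_{0,2}$ on $\Sigma^2$ whose only poles are a double pole on the diagonal with biresidue $1$. A \emph{standard coordinate} at $p$ is a local coordinate $\zeta$ centred at $p$, defined on a neighbourhood $U_p$ that it maps onto a disc, with $x=x(p)+\zeta^{r_p}$, or $x=\zeta^{-r_p}$ if $x(p)=\infty$. Let $\mathsf{Ram}=\{p: r_p\ge 2\}$, $\mathsf{Br}=x(\mathsf{Ram})$, $y=\omega_{0,1}/\mathrm dx$ and $\mathfrak f(z)=x^{-1}(x(z))$. For a finite subset $P$ of a fibre of $x$ (with disjoint $U_p$, $p\in P$) and $z$ near a point of $P$, let $\mathfrak f_P(z)=\mathfrak f(z)\cap\bigsqcup_{p\in P}U_p$ and $\mathfrak f_p=\mathfrak f_{\{p\}}$; a prime means that $z$ is removed. Write $\omega_{0,1}=\sum_l\tau_l\zeta^{l}\,\mathrm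 d\zeta/\zeta$ at $p$, and let $\bar s_p$ be the least $l$ with $\tau_l\ne0$ and $s_p$ the least $l$ with $\tau_l\neq 0$ and $r_p\nmid l$. The curve is \emph{locally admissible} if $\mathsf{Ram}$ is finite and, at each $p\in\mathsf{Ram}$, $s_p$ exists and is coprime to $r_p$; either $s_p\le-1$, or $1\le s_p\le r_p+1$ and $r_p\equiv\pm1 \bmod s_p$; and $\bar s_p\in\{s_p,s_p-1\}$. A \emph{system of correlators} is a family of symmetric $n$-differentials $\omega_{g,n}$ ($g\ge0$, $n\ge1$) on $\Sigma^n$, with $\omega_{0,1},\omega_{0,2}$ as given, such that for $2g-2+n>0$ the poles of $\omega_{g,n}$ are only at ramification points, with vanishing residues. Let $$\mathcal W'_{g,i;n}(z_{[i]};w_{[n]})=\sum\prod_{L\in\mathbf L}\omega_{g_L,|L|+|M_L|}(z_L,w_{M_L}),$$ summed over the set partitions $\mathbf L$ of $[i]$, the decompositions $\bigsqcup_L M_L=[n]$ (empty $M_L$ allowed) and the $g_L\ge0$ with $i+\sum_L(g_L-1)=g$, leaving out all terms with a factor $\omega_{0,1}$. A \emph{primitive} of $\omega_{0,2}$ over an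 open $U\subseteq\Sigma$ is an $\alpha(w_0;z)$ which is a meromorphic $1$-form in $w_0\in\Sigma$ and a meromorphic function of $z\in U$ with $\mathrm d_z\alpha(w_0;z)=\omega_{0,2}(w_0,z)$. For $Z\subseteq\mathfrak f(z)\setminus\{z\}$ put $$K^{\alpha}_{1+|Z|}(w_0;z,Z)=-\frac{\alpha(w_0;z)}{\prod_{z'\in Z}(y(z')-y(z))\,\mathrm dx(z)},\qquad I^{\alpha}_S(z)=\sum_{\emptyset\ne Z\subseteq (\mathfrak f(z)\cap S)\setminus\{z\}}K^{\alpha}_{1+|Z|}(w_0;z,Z)\,\mathcal W'_{g,1+|Z|;n}(z,Z;w_{[n]}),$$ where cotangent spaces at points of one fibre are identified through $x$. \emph{Local primitives} are primitives $\alpha^{(p)}$ over $U_p$. The correlators \emph{satisfy topological recursion} if for some choice of local primitives, for all $(g,n)\in\mathbb Z_{\ge0}^2$ with $2g-2+(1+n)>0$, $$\omega_{g,1+n}(w_0,w_{[n]})=\sum_{p\in\Sigma}\operatorname*{Res}_{z=p}I^{\alpha^{(p)}}_{U_p}(z).$$ Topological recursion \emph{can be globalised over} a finite subset $P$ of a fibre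 if, near $P$, the denominators of the kernels $K_{1+|Z|}$ with $Z\subseteq\mathfrak f'_P(z)$ do not vanish identically and, for every choice of local primitives and all such $(g,n)$, $$\sum_{p\in P}\operatorname*{Res}_{z=p}\sum_{\emptyset\neq Z\subseteq\mathfrak f'_p(z)}K^{\alpha^{(p)}}_{1+|Z|}(w_0;z,Z)\,\mathcal W'_{g,1+|Z|;n}(z,Z;w_{[n]})=\sum_{p\in P}\operatorname*{Res}_{z=p}\sum_{\emptyset\neq Z\subseteq\mathfrak f'_P(z)}K^{\alpha^{(p)}}_{1+|Z|}(w_0;z,Z)\,\mathcal W'_{g,1+|Z|;n}(z,Z;w_{[n]}).$$ It can be globalised over an open set $A\subseteq\Sigma$ if for every $p\in A$ the set $\mathfrak f(p)\cap A$ is finite and it can be globalised over $\mathfrak f(p)\cap A$. A \emph{disc collection adapted to} $\mathcal S$ is a finite sequence of open sets $\mathsf D_1,\dots,\mathsf D_{\mathsf k}\subseteq\mathbb P^1$ such that: the closures $\overline{\mathsf D}_i$ are pairwise disjoint embedded closed discs contained in $x(\Sigma)$, with interiors $\mathsf D_i$; each $\mathsf D_i$ contains a branch point, and each branch point lies in some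 $\mathsf D_i$; $x$ restricts to a finite-degree branched covering onto $\mathsf D_i$ on each connected component of $x^{-1}(\mathsf D_i)$; and $\int_\gamma\omega_{0,2}(w_0,\cdot)=0$ for every $\gamma\in H_1(x^{-1}(\mathsf D_i),\mathbb Z)$. Let $(\tilde{\mathsf D}_{i,j})_{j\in\mathsf c_i^+}$ be those components of $x^{-1}(\mathsf D_i)$ that contain a ramification point (equivalently, those of degree at least $2$ over $\mathsf D_i$), and $\tilde{\mathsf D}^+=\bigcup_{i}\bigcup_{j\in\mathsf c_i^+}\tilde{\mathsf D}_{i,j}$. \textbf{Proposition (Horizontal globalisation).} Let $(\omega_{g,n})$ be a system of correlators on a locally admissible spectral curve $\mathcal S$ that satisfies topological recursion. Let $(\mathsf D_i)_{i=1}^{\mathsf k}$ be a disc collection adapted to $\mathcal S$ such that topological recursion can be globalised over $\tilde{\mathsf D}_{i,j}$ for each $i\in[\mathsf k]$ and $j\in\mathsf c_i^+$. Then for each such $(i,j)$ there is a primitive $\alpha^{(i,j)}_{0,2}$ of $\omega_{0,2}$ over $\tilde{\mathsf D}_{i,j}$ such that, for all $(g,n)\in\mathbb Z_{\ge0}^2$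 with $2g-2+(1+n)>0$ and all points $w_0,w_1,\dots,w_n$ in the complement of $\tilde{\mathsf D}^+$, $$\omega_{g,1+n}(w_0,w_{[n]})=\frac1{2\mathrm i\pi}\sum_{i=1}^{\mathsf k}\sum_{j\in\mathsf c_i^+}\oint_{z\in\gamma_{i,j}}\ \sum_{\substack{Z\subseteq \mathfrak f'(z)\cap\tilde{\mathsf D}_{i,j}\\ |Z|\ge1}}K^{(i,j)}_{1+|Z|}(w_0;z,Z)\,\mathcal W'_{g,1+|Z|;n}(z,Z;w_{[n]}),$$ where $K^{(i,j)}$ is the recursion kernel for $\alpha^{(i,j)}_{0,2}$ and $\gamma_{i,j}$ is any contour in $\tilde{\mathsf D}_{i,j}\setminus\mathsf{Ram}$ that represents, in the homology of $\tilde{\mathsf D}_{i,j}\setminus\mathsf{Ram}$, the class of the positively oriented boundary $\partial\tilde{\mathsf D}_{i,j}$, that is, of the preimage in $\tilde{\mathsf D}_{i,j}$ of a positively oriented closed curve in $\mathsf D_i$ close to $\partial\mathsf D_i$. -/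

import Mathlib

open scoped Manifold Topology
open Filter Set Metric OnePoint

namespace TopRec

noncomputable section

/-! ## Meromorphic differentials on a Riemann surface

The Riemann sphere `ℙ¹` is `OnePoint ℂ`. A Riemann surface is a Hausdorff space charted on `ℂ` with
analytic coordinate changes. A `1`-form on such an `X` is given by its values: a function
`φ : X → ℂ`, where `φ p` is the coefficient of the form at `p` with respect to the differential at
`p` of the preferred chart `chartAt ℂ p` (that is, the value of the covector at `p` on the vector
`1 : TangentSpace 𝓘(ℂ) p`). In the same way an `n`-differential on `X ^ n` is given by
its coefficients `φ : (Fin n → X) → ℂ` in the preferred charts at the `n` points. -/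

/-- The affine coordinate of the Riemann sphere (with the value `0` at `∞`). -/
def affine (q : OnePoint ℂ) : ℂ := Option.getD q 0

/-- Holomorphy at `c` of a map to the Riemann sphere. -/
def HolomorphicAt (f : ℂ → OnePoint ℂ) (c : ℂ) : Prop :=
  ContinuousAt f c ∧
    (f c ≠ ∞ → AnalyticAt ℂ (fun t => affine (f t)) c) ∧
    (f c = ∞ → AnalyticAt ℂ (fun t => (affine (f t))⁻¹) c)

/-- The residue at `c` of a function with an isolated singularity at `c`. -/
def res (f : ℂ → ℂ) (c : ℂ) : ℂ :=
  limUnder (𝓝[>] (0 : ℝ)) fun ε => (2 * Real.pi * Complex.I)⁻¹ * ∮ t in C(c, ε), f t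

section Surface

variable {X : Type*} [TopologicalSpace X] [ChartedSpace ℂ X]

/-- The factor `d(chartAt) / d e` at the point with coordinate `t` in the chart `e`. -/
def jac (e : OpenPartialHomeomorph X ℂ) (t : ℂ) : ℂ :=
  deriv (fun s => chartAt ℂ (e.symm t) (e.symm s)) t

/-- The coefficient `f` of a `1`-form `φ = f(t) dt` in the coordinate `t` of a chart `e`. -/
def coeff (e : OpenPartialHomeomorph X ℂ) (φ : X → ℂ) (t : ℂ) : ℂ :=
  φ (e.symm t) * jac e t

def IsMeromorphicOneForm (φ : X → ℂ) : Prop :=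
  ∀ p : X, MeromorphicAt (coeff (chartAt ℂ p) φ) (chartAt ℂ p p)

/-- The residue at `p` of a `1`-form. -/
def residueAt (φ : X → ℂ) (p : X) : ℂ :=
  res (coeff (chartAt ℂ p) φ) (chartAt ℂ p p)

/-- The coefficient of a bidifferential in the coordinates of two charts. -/
def coeff₂ (e e' : OpenPartialHomeomorph X ℂ) (φ : X → X → ℂ) (t : ℂ × ℂ) : ℂ :=
  φ (e.symm t.1) (e'.symm t.2) * (jac e t.1 * jac e' t.2)

/-- A symmetric meromorphic bidifferential whose only poles are a double pole on the diagonal, with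
biresidue `1`. -/
structure IsFundamentalBidifferential (φ : X → X → ℂ) : Prop where
  symm : ∀ p q, φ p q = φ q p
  off_diagonal : ∀ p q, p ≠ q →
    AnalyticAt ℂ (coeff₂ (chartAt ℂ p) (chartAt ℂ q) φ) (chartAt ℂ p p, chartAt ℂ q q)
  diagonal : ∀ p, ∃ G : ℂ × ℂ → ℂ, AnalyticAt ℂ G (chartAt ℂ p p, chartAt ℂ p p) ∧
    ∀ᶠ t in 𝓝 (chartAt ℂ p p, chartAt ℂ p p), t.1 ≠ t.2 →
      coeff₂ (chartAt ℂ p) (chartAt ℂ p) φ t = 1 / (t.1 - t.2) ^ 2 + G t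

open Classical in
/-- `φ` is a meromorphic `n`-differential on `X ^ n` whose poles lie on the hypersurfaces
`z_i = p`, `p ∈ R`: locally its coefficient becomes holomorphic after multiplication by a
power of the coordinates vanishing on these hypersurfaces. -/
def IsMeromorphicWithPolesIn (R : Set X) {n : ℕ} (φ : (Fin n → X) → ℂ) : Prop :=
  ∀ p : Fin n → X, ∃ (N : ℕ) (G : (Fin n → ℂ) → ℂ),
    AnalyticAt ℂ G (fun i => chartAt ℂ (p i) (p i)) ∧
    ∀ᶠ t in 𝓝 (fun i => chartAt ℂ (p i) (p i)),
      (∀ i, (chartAt ℂ (p i)).symm (t i) ∉ R) →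
        φ (fun i => (chartAt ℂ (p i)).symm (t i)) * (∏ i, jac (chartAt ℂ (p i)) (t i)) *
          (∏ i, if p i ∈ R then (t i - chartAt ℂ (p i) (p i)) ^ N else 1) = G t

/-! ## Contours -/

variable (X) in
/-- A closed curve of class `C¹`, parametrised by `ℝ / ℤ`. -/
structure Loop where
  toFun : ℝ → X
  smooth : ContMDiff 𝓘(ℝ, ℝ) 𝓘(ℝ, ℂ) 1 toFun
  periodic : Function.Periodic toFun 1

/-- The integrand of the integral of the `1`-form `φ` along the loop `γ`. -/
def Loop.pullback (γ : Loop X) (φ : X → ℂ) (t : ℝ) : ℂ :=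
  φ (γ.toFun t) * deriv (fun s => chartAt ℂ (γ.toFun t) (γ.toFun s)) t

/-- The integral of a `1`-form along a loop. -/
def Loop.integral (γ : Loop X) (φ : X → ℂ) : ℂ := ∫ t in (0 : ℝ)..1, γ.pullback φ t

/-- A loop as a singular `1`-simplex. -/
def Loop.simplex (γ : Loop X) : C(unitInterval, X) :=
  ⟨fun t => γ.toFun t, γ.smooth.continuous.comp continuous_subtype_val⟩

end Surface

section Homology

variable {X : Type*} [TopologicalSpace X]

/-- The edge of the standard `2`-simplex from the vertex `i` to the vertex `j`. -/
def edgePt (i j : Fin 3) (t : unitInterval) : stdSimplex ℝ (Fin 3) :=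
  ⟨fun k => (1 - (t : ℝ)) * Pi.single (M := fun _ => ℝ) i 1 k
      + (t : ℝ) * Pi.single (M := fun _ => ℝ) j 1 k,
    (convex_stdSimplex ℝ (Fin 3)) (single_mem_stdSimplex ℝ i) (single_mem_stdSimplex ℝ j)
      (sub_nonneg.2 t.2.2) t.2.1 (sub_add_cancel _ _)⟩

theorem continuous_edgePt (i j : Fin 3) : Continuous (edgePt i j) := by
  unfold edgePt
  fun_prop

/-- An edge of a singular `2`-simplex. -/
def edge (σ : C(stdSimplex ℝ (Fin 3), X)) (i j : Fin 3) : C(unitInterval, X) :=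
  ⟨fun t => σ (edgePt i j t), σ.continuous.comp (continuous_edgePt i j)⟩

/-- The boundary of a singular `2`-simplex, as a singular `1`-chain with integer coefficients. -/
def boundary (σ : C(stdSimplex ℝ (Fin 3), X)) : C(unitInterval, X) →₀ ℤ :=
  Finsupp.single (edge σ 1 2) 1 - Finsupp.single (edge σ 0 2) 1 + Finsupp.single (edge σ 0 1) 1

/-- Two singular `1`-chains are homologous in `U` if they differ by the boundary of a singular
`2`-chain in `U`. -/
def Homologous (U : Set X) (c c' : C(unitInterval, X) →₀ ℤ) : Prop :=
  c - c' ∈ AddSubgroup.closure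
    {b | ∃ σ : C(stdSimplex ℝ (Fin 3), X), range σ ⊆ U ∧ b = boundary σ}

end Homology

/-! ## Spectral curves -/

/-- A spectral curve with underlying (possibly disconnected) Riemann surface `X`. -/
structure SpectralCurve (X : Type*) [TopologicalSpace X] [ChartedSpace ℂ X] where
  nonempty : Nonempty X
  finite_components : Finite (ConnectedComponents X)
  x : X → OnePoint ℂ
  x_holomorphic : ∀ p, HolomorphicAt (fun t => x ((chartAt ℂ p).symm t)) (chartAt ℂ p p)
  x_nonconstant : ∀ p, ∃ z ∈ connectedComponent p, x z ≠ x p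
  ω01 : X → ℂ
  ω01_meromorphic : IsMeromorphicOneForm ω01
  /-- `ω01` vanishes identically near no point, that is, on no component. -/
  ω01_ne_zero : ∀ p, meromorphicOrderAt (coeff (chartAt ℂ p) ω01) (chartAt ℂ p p) ≠ ⊤
  ω02 : X → X → ℂ
  ω02_fundamental : IsFundamentalBidifferential ω02

variable {X : Type*} [TopologicalSpace X] [ChartedSpace ℂ X]

/-- `ζ` is a standard coordinate at `p`, with ramification order `r`: it maps its domain onto a disc
centred at `0`, and there `x = x(p) + ζ ^ r`, or `x = ζ ^ (-r)` if `p` is a pole of `x`. -/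
structure IsStandardCoordinate (C : SpectralCurve X) (p : X) (r : ℕ)
    (ζ : OpenPartialHomeomorph X ℂ) : Prop where
  mem_atlas : ζ ∈ IsManifold.maximalAtlas 𝓘(ℂ) ⊤ X
  mem_source : p ∈ ζ.source
  map_center : ζ p = 0
  target : ∃ ρ > 0, ζ.target = ball 0 ρ
  order_pos : 0 < r
  normal_form :
    (∃ q : ℂ, ∀ z ∈ ζ.source, C.x z = ((q + ζ z ^ r : ℂ) : OnePoint ℂ)) ∨
    (C.x p = ∞ ∧ ∀ z ∈ ζ.source, z ≠ p → C.x z = (((ζ z ^ r)⁻¹ : ℂ) : OnePoint ℂ))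

namespace SpectralCurve

variable (C : SpectralCurve X)

/-- The ramification points of `x`. -/
def Ram : Set X := {p | ∃ r ζ, 2 ≤ r ∧ IsStandardCoordinate C p r ζ}

/-- The branch points of `x`. -/
def Br : Set (OnePoint ℂ) := C.x '' C.Ram

/-- The fibre `𝔣(z)` of `x` through `z`. -/
def fiber (z : X) : Set X := C.x ⁻¹' {C.x z}

/-- The `1`-form `dx`. -/
def dx (z : X) : ℂ :=
  deriv (fun t => affine (C.x ((chartAt ℂ z).symm t))) (chartAt ℂ z z)

/-- The meromorphic function `y = ω01 / dx`. -/
def y (z : X) : ℂ := C.ω01 z / C.dx z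

/-- The coefficient `τ_l` in the expansion `ω01 = ∑ τ_l ζ ^ l dζ / ζ` in the coordinate `ζ`. -/
def tau (ζ : OpenPartialHomeomorph X ℂ) (l : ℤ) : ℂ :=
  res (fun t => t ^ (-l) * coeff ζ C.ω01 t) 0

/-- Local admissibility at `p`, where `sbar` and `s` are the least exponent, and the least exponent
not divisible by `r`, in the expansion of `ω01` in a standard coordinate. -/
def LocallyAdmissibleAt (p : X) : Prop :=
  ∀ r ζ, 2 ≤ r → IsStandardCoordinate C p r ζ →
    ∃ s sbar : ℤ, IsLeast {l | C.tau ζ l ≠ 0} sbar ∧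
      IsLeast {l | C.tau ζ l ≠ 0 ∧ ¬ (r : ℤ) ∣ l} s ∧
      IsCoprime s (r : ℤ) ∧
      (s ≤ -1 ∨ (1 ≤ s ∧ s ≤ r + 1 ∧ ((r : ℤ) ≡ 1 [ZMOD s] ∨ (r : ℤ) ≡ -1 [ZMOD s]))) ∧
      (sbar = s ∨ sbar = s - 1)

def LocallyAdmissible : Prop := C.Ram.Finite ∧ ∀ p, C.LocallyAdmissibleAt p

end SpectralCurve

/-! ## Correlators and topological recursion -/

/-- The multiset of the entries of a tuple. -/
def pts {n : ℕ} (w : Fin n → X) : Multiset X := Finset.univ.val.map w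

/-- A system of correlators. A symmetric `n`-differential `ω_{g,n}` is regarded as a function on
multisets of `n` points: `ω_{g,n}(w_1, …, w_n)` is `corr g {w_1, …, w_n}`. -/
structure Correlators (C : SpectralCurve X) where
  corr : ℕ → Multiset X → ℂ
  corr_01 : ∀ z, corr 0 {z} = C.ω01 z
  corr_02 : ∀ z w, corr 0 {z, w} = C.ω02 z w
  poles : ∀ g n : ℕ, 0 < n → 2 < 2 * g + n →
    IsMeromorphicWithPolesIn C.Ram fun w : Fin n → X => corr g (pts w)
  residues : ∀ g n : ℕ, 2 < 2 * g + (1 + n) → ∀ w : Fin n → X, (∀ k, w k ∉ C.Ram) →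
    ∀ p ∈ C.Ram, residueAt (fun z => corr g (z ::ₘ pts w)) p = 0

open Classical in
/-- `𝒲'_{g,|A|;n}(A; w)`: the sum over the partitions `P` of `A`, the distributions `M` of the `w_k`
among the parts of `P`, and the genera `h` of the parts with `|A| + ∑ (h_L - 1) = g`, of the product
of the `ω_{h_L}(L, w_{M_L})`, where the terms with a factor `ω01` are left out. (The condition on the
genera implies that each of them is at most `g`.) -/
def Correlators.Wprime {C : SpectralCurve X} (ω : Correlators C) (g : ℕ) (A : Finset X) {n : ℕ}
    (w : Fin n → X) : ℂ :=
  ∑ P : Finpartition A, ∑ M : Fin n → P.parts, ∑ h : P.parts → Fin (g + 1),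
    if A.card + ∑ L, (h L : ℕ) = g + P.parts.card ∧
        ∀ L, ¬ ((h L : ℕ) = 0 ∧ L.1.card = 1 ∧ ∀ k, M k ≠ L)
    then ∏ L, ω.corr (h L) (L.1.val + (Finset.univ.filter fun k => M k = L).val.map w)
    else 0

/-- `α(w₀; z)` is a primitive of `ω02` over the open set `U`: a meromorphic `1`-form in `w₀ ∈ X` and a
meromorphic function of `z ∈ U` with `d_z α(w₀; z) = ω02(w₀, z)`. -/
structure IsPrimitive (C : SpectralCurve X) (U : Set X) (α : X → X → ℂ) : Prop where
  meromorphic_left : ∀ z ∈ U, IsMeromorphicOneForm fun w₀ => α w₀ z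
  meromorphic_right : ∀ w₀, ∀ z ∈ U,
    MeromorphicAt (fun t => α w₀ ((chartAt ℂ z).symm t)) (chartAt ℂ z z)
  deriv_right : ∀ w₀, ∀ z ∈ U, z ≠ w₀ →
    HasDerivAt (fun t => α w₀ ((chartAt ℂ z).symm t)) (C.ω02 w₀ z) (chartAt ℂ z z)

/-- `Υ_{|Z|}(Z; z)`, as coefficient of a differential of degree `|Z|` at `z`. -/
def Upsilon (C : SpectralCurve X) (Z : Finset X) (z : X) : ℂ :=
  ∏ z' ∈ Z, ((C.y z' - C.y z) * C.dx z)

/-- The recursion kernel `K(w₀; z, Z)` for the primitive `α`. -/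
def kernel (C : SpectralCurve X) (α : X → X → ℂ) (w₀ z : X) (Z : Finset X) : ℂ :=
  - α w₀ z / Upsilon C Z z

open Classical in
/-- The `1`-form in `z` whose residues and contour integrals are taken: the sum of
`K(w₀; z, Z) 𝒲'_{g,1+|Z|;n}(z, Z; w)` over the non-empty finite subsets `Z` of
`(𝔣(z) ∩ S) ∖ {z}`. The factor `∏ dx(z) / dx(z')` expresses the coefficient of `𝒲'` at the points
`z' ∈ Z` of the fibre of `z` by the coordinate at `z`: cotangent spaces at points of one fibre are
identified through `x`. -/
def integrand {C : SpectralCurve X} (ω : Correlators C) (α : X → X → ℂ) (S : Set X) (g : ℕ) {n : ℕ}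
    (w₀ : X) (w : Fin n → X) (z : X) : ℂ :=
  ∑ᶠ Z ∈ {Z : Finset X | Z.Nonempty ∧ (Z : Set X) ⊆ (C.fiber z ∩ S) \ {z}},
    kernel C α w₀ z Z * (ω.Wprime g (insert z Z) w * ∏ z' ∈ Z, (C.dx z / C.dx z'))

/-- `U` is the domain of a standard coordinate at `p`. For `z ∈ U` the set `𝔣(z) ∩ U` is the set
`𝔣_p(z)` of the points of the fibre that remain near `p`. -/
def IsStandardNhd (C : SpectralCurve X) (p : X) (U : Set X) : Prop :=
  ∃ r ζ, IsStandardCoordinate C p r ζ ∧ U = ζ.source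

/-- Topological recursion, for some choice of local primitives. Both sides are meromorphic in `w₀`,
and their equality as such is their equality outside a discrete closed set. -/
def SatisfiesTR {C : SpectralCurve X} (ω : Correlators C) : Prop :=
  ∃ (U : X → Set X) (α : X → X → X → ℂ),
    (∀ p, IsStandardNhd C p (U p) ∧ IsPrimitive C (U p) (α p)) ∧
    ∀ g n : ℕ, 2 < 2 * g + (1 + n) → ∀ w : Fin n → X, (∀ k, w k ∉ C.Ram) →
      ∀ᶠ w₀ in codiscrete X,
        ω.corr g (w₀ ::ₘ pts w) =
          ∑ᶠ p, residueAt (integrand ω (α p) (U p) g w₀ w) p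

/-- Topological recursion can be globalised over the finite subset `P` of a fibre of `x`: the
denominators of the kernels do not vanish identically near the points of `P`, and for any choice of
local primitives, the residues at the points `p ∈ P` for the local fibres `𝔣_p` and for `𝔣_P` have the
same sum. -/
def GlobalisableOver {C : SpectralCurve X} (ω : Correlators C) (P : Finset X) : Prop :=
  ∀ U : X → Set X, (∀ p ∈ P, IsStandardNhd C p (U p)) → (P : Set X).PairwiseDisjoint U →
    (∀ p ∈ P, ∀ᶠ z in 𝓝[≠] p, ∀ z' ∈ (C.fiber z ∩ ⋃ p' ∈ P, U p') \ {z}, C.y z' ≠ C.y z) ∧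
    ∀ α : X → X → X → ℂ, (∀ p ∈ P, IsPrimitive C (U p) (α p)) →
    ∀ g n : ℕ, 2 < 2 * g + (1 + n) → ∀ w : Fin n → X, (∀ k, w k ∉ C.Ram ∧ w k ∉ P) →
      ∀ᶠ w₀ in codiscrete X,
        ∑ p ∈ P, residueAt (integrand ω (α p) (U p) g w₀ w) p =
          ∑ p ∈ P, residueAt (integrand ω (α p) (⋃ p' ∈ P, U p') g w₀ w) p

/-- Topological recursion can be globalised over the open set `A`. -/
def GlobalisableOverOpen {C : SpectralCurve X} (ω : Correlators C) (A : Set X) : Prop :=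
  ∀ p ∈ A, ∃ P : Finset X, (P : Set X) = C.fiber p ∩ A ∧ GlobalisableOver ω P

/-! ## Disc collections -/

/-- The connected components of `x⁻¹(D)`. -/
def IsComponentOver (C : SpectralCurve X) (D : Set (OnePoint ℂ)) (Dt : Set X) : Prop :=
  ∃ p ∈ C.x ⁻¹' D, Dt = connectedComponentIn (C.x ⁻¹' D) p

/-- The closure of `D` is an embedded closed disc with interior `D`. -/
def IsDisc (D : Set (OnePoint ℂ)) : Prop :=
  ∃ φ : ℂ → OnePoint ℂ, ContinuousOn φ (closedBall 0 1) ∧ InjOn φ (closedBall 0 1) ∧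
    φ '' ball 0 1 = D ∧ φ '' closedBall 0 1 = closure D

/-- A disc collection adapted to `C`. In `branched_covering` we use that a map between Riemann
surfaces, holomorphic and constant on no component, is a branched covering of finite degree onto its
target exactly if it is proper and surjective. In `periods`, the first homology group of
`x⁻¹(D i)` is generated by loops. -/
structure IsAdapted (C : SpectralCurve X) {k : ℕ} (D : Fin k → Set (OnePoint ℂ)) : Prop where
  isOpen : ∀ i, IsOpen (D i)
  isDisc : ∀ i, IsDisc (D i)
  closure_subset : ∀ i, closure (D i) ⊆ range C.x
  disjoint : Pairwise fun i j => Disjoint (closure (D i)) (closure (D j))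
  branch_point : ∀ i, (D i ∩ C.Br).Nonempty
  covers_branch_points : C.Br ⊆ ⋃ i, D i
  branched_covering : ∀ i, ∀ Dt, IsComponentOver C (D i) Dt →
    C.x '' Dt = D i ∧ ∀ K ⊆ D i, IsCompact K → IsCompact (Dt ∩ C.x ⁻¹' K)
  periods : ∀ i, ∀ γ : Loop X, range γ.toFun ⊆ C.x ⁻¹' D i →
    ∀ w₀ ∉ range γ.toFun, γ.integral (C.ω02 w₀) = 0

/-- The components of `x⁻¹(D)` that contain a ramification point. -/
def plusComponents (C : SpectralCurve X) (D : Set (OnePoint ℂ)) : Set (Set X) :=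
  {Dt | IsComponentOver C D Dt ∧ (Dt ∩ C.Ram).Nonempty}

/-- The union `D̃⁺` of all components with a ramification point. -/
def plusUnion (C : SpectralCurve X) {k : ℕ} (D : Fin k → Set (OnePoint ℂ)) : Set X :=
  ⋃ i, ⋃₀ plusComponents C (D i)

/-- `Γ` is a contour (finite collection of loops) in `Dt ∖ Ram` which represents the class of the
positively oriented boundary of the component `Dt` of `x⁻¹(D)` in the homology of `Dt ∖ Ram`.
This is the class of the preimage in `Dt` of the curve `t ↦ φ(ρ exp(2πit))`, where `φ` is a conformal
map from the unit disc onto `D` and `ρ < 1` is so large that all branch points of `Dt → D` are in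
`φ(|u| < ρ)`. As a chain this preimage is the sum, over the points `z ∈ F` of `Dt` above `φ(ρ)`, of the
lift `lift z` of that curve that starts at `z`. -/
def IsBoundaryContour (C : SpectralCurve X) (D : Set (OnePoint ℂ)) (Dt : Set X)
    (Γ : List (Loop X)) : Prop :=
  (∀ γ ∈ Γ, range γ.toFun ⊆ Dt \ C.Ram) ∧
  ∃ (φ : ℂ → OnePoint ℂ) (ρ : ℝ) (F : Finset X) (lift : X → C(unitInterval, X)),
    (∀ u ∈ ball (0 : ℂ) 1, HolomorphicAt φ u) ∧ InjOn φ (ball 0 1) ∧ φ '' ball 0 1 = D ∧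
    0 < ρ ∧ ρ < 1 ∧ C.x '' (Dt ∩ C.Ram) ⊆ φ '' ball 0 ρ ∧
    (F : Set X) = Dt ∩ C.x ⁻¹' {φ ρ} ∧
    (∀ z ∈ F, lift z 0 = z ∧ ∀ t : unitInterval, lift z t ∈ Dt ∧
      C.x (lift z t) = φ (ρ * Complex.exp (2 * Real.pi * Complex.I * (t : ℝ)))) ∧
    Homologous (Dt \ C.Ram) (Γ.map fun γ => Finsupp.single γ.simplex (1 : ℤ)).sum
      (∑ z ∈ F, Finsupp.single (lift z) (1 : ℤ))

end

end TopRec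

/-!
The recursion integrand over a set `A` is the product of the primitive `α(w₀; z)` with a `1`-form
`Qform` in `z` that does not involve `w₀`. The loop integrals of `ω02(w₀, ·)` over a component `D̃` of
the preimage of a disc vanish, so integration along curves gives a primitive over `D̃`
(`exists_isPrimitive`); it remains to see that the recursion may be run with this primitive and with all
the points of a fibre in `D̃`, and to turn residues into contour integrals.

*Independence of the primitive.* At a point `p`, the local `1`-form `Qform` has no residue. Its trace
under `x` vanishes, because the contributions of a fixed subset of the fibre, with each of its points in turn
in the role of `z`, add up to the top coefficient of a Lagrange interpolation of a constant
(`sum_prod_inv_sub_eq_zero`, `sum_Qform_div_dx`), and taking the trace preserves residues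
(`res_coeff_Qform_source`). Hence `Qform = dΨ` near `p`, and by parts the residue of the integrand is that
of `-ω02(w₀, ·) Ψ` (`residueAt_primitive_mul`). It does not depend on the primitive and is continuous
in `w₀ ≠ p`.

*Distant terms.* Globalisability over a fibre says that the terms that involve distant points have
residues with vanishing sum, for all choices of primitives. Adding `ω01(w₀)` to the primitive at one point
shows that their residues without `α` vanish as well, so they too can be integrated by parts; and as `w₀`
tends to a point `p` of the fibre, the pairing with the double pole of `ω02` recovers the principal part at `p`,
which is therefore zero (`removableAt_of_sum_res_eq_zero`, `FibreNhd.removableAt_Qform_sub`). So the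
integrand over `D̃` has the local residue at ramification points and is holomorphic at all others. The
recursion, which a priori holds off a discrete set of `w₀`, extends by continuity to all `w₀` off the
components (`corr_eq_sum_residueAt`).

*Residues and contours.* A `1`-form `η` that is holomorphic off the ramification points is closed there, so
its integral depends only on the homology class of the contour (`chainIntegral_eq_of_homologous`), and
the boundary class is represented by the lifts of a circle. The integrals along the lifts add up to the
integral along the circle of the trace of `η` under `x` (`sum_pathIntegral_lift`). The trace is
meromorphic, with residues the sums of those of `η` over the fibres (`trace_comp`), and the residue theorem in the
plane (`circleIntegral_eq_sum_res`) concludes (`IsBoundaryContour.integral_eq`).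
-/

set_option linter.unusedSectionVars false

namespace TopRec

/-! ### Residues in the plane -/

theorem res_congr {f g : ℂ → ℂ} {c : ℂ} (h : f =ᶠ[𝓝[≠] c] g) : res f c = res g c := by
  unfold res
  rw [limUnder, limUnder]
  congr 1
  apply Filter.map_congr
  rw [eventuallyEq_nhdsWithin_iff, Metric.eventually_nhds_iff] at h
  obtain ⟨δ, hδ, h⟩ := h
  filter_upwards [Ioo_mem_nhdsGT hδ] with ε hε
  congr 1
  apply circleIntegral.integral_congr hε.1.le
  intro z hz
  have hz' : dist z c = ε := hz
  exact h (by rw [hz']; exact hε.2) (by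
    rintro rfl
    rw [dist_self] at hz'
    exact hε.1.ne hz')

theorem res_eq_of_eventually {f : ℂ → ℂ} {c a : ℂ}
    (h : ∀ᶠ ε in 𝓝[>] (0 : ℝ), (2 * Real.pi * Complex.I)⁻¹ * (∮ t in C(c, ε), f t) = a) :
    res f c = a :=
  (tendsto_const_nhds.congr' (by filter_upwards [h] with ε hε using hε.symm)).limUnder_eq

/-- For a function that is holomorphic on a punctured disc, the residue is the integral over any
circle in that disc. -/
theorem res_eq_circleIntegral {f : ℂ → ℂ} {c : ℂ} {R ε : ℝ}
    (hf : DifferentiableOn ℂ f (ball c R \ {c})) (hε : 0 < ε) (hR : ε < R) :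
    res f c = (2 * Real.pi * Complex.I)⁻¹ * ∮ t in C(c, ε), f t := by
  apply res_eq_of_eventually
  filter_upwards [Ioo_mem_nhdsGT hε] with δ hδ
  congr 1
  have hop : IsOpen (ball c R \ {c}) := isOpen_ball.sdiff isClosed_singleton
  have hsub : closedBall c ε \ ball c δ ⊆ ball c R \ {c} := fun z hz =>
    ⟨closedBall_subset_ball hR hz.1, by rintro rfl; exact hz.2 (mem_ball_self hδ.1)⟩
  refine (Complex.circleIntegral_eq_of_differentiable_on_annulus_off_countable hδ.1 hδ.2.le
    countable_empty (hf.continuousOn.mono hsub) ?_).symm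
  intro z hz
  refine hf.differentiableAt (hop.mem_nhds (hsub ⟨ball_subset_closedBall hz.1.1, fun h => hz.1.2 ?_⟩))
  exact ball_subset_closedBall h

theorem _root_.MeromorphicAt.exists_differentiableOn {f : ℂ → ℂ} {c : ℂ} (hf : MeromorphicAt f c) :
    ∃ R > 0, DifferentiableOn ℂ f (ball c R \ {c}) := by
  have h := hf.eventually_analyticAt
  rw [eventually_nhdsWithin_iff, Metric.eventually_nhds_iff_ball] at h
  obtain ⟨R, hR, h⟩ := h
  exact ⟨R, hR, fun z hz => (h z hz.1 hz.2).differentiableAt.differentiableWithinAt⟩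

/-- On small circles a meromorphic function is integrable, with integral `2πi` times the residue. -/
theorem _root_.MeromorphicAt.eventually_circleIntegral {f : ℂ → ℂ} {c : ℂ} (hf : MeromorphicAt f c) :
    ∀ᶠ ε in 𝓝[>] (0 : ℝ), CircleIntegrable f c ε ∧
      (2 * Real.pi * Complex.I)⁻¹ * (∮ t in C(c, ε), f t) = res f c := by
  obtain ⟨R, hR, h⟩ := hf.exists_differentiableOn
  filter_upwards [Ioo_mem_nhdsGT hR] with ε hε
  refine ⟨ContinuousOn.circleIntegrable hε.1.le (h.continuousOn.mono ?_),
    (res_eq_circleIntegral h hε.1 hε.2).symm⟩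
  intro z hz
  have hz' : dist z c = ε := hz
  exact ⟨by rw [mem_ball, hz']; exact hε.2, by rintro rfl; rw [dist_self] at hz'; exact hε.1.ne hz'⟩

theorem res_add {f g : ℂ → ℂ} {c : ℂ} (hf : MeromorphicAt f c) (hg : MeromorphicAt g c) :
    res (fun t => f t + g t) c = res f c + res g c := by
  apply res_eq_of_eventually
  filter_upwards [hf.eventually_circleIntegral, hg.eventually_circleIntegral] with ε h1 h2
  rw [circleIntegral.integral_add h1.1 h2.1, mul_add, h1.2, h2.2]

theorem res_const_mul {f : ℂ → ℂ} {c : ℂ} (a : ℂ) (hf : MeromorphicAt f c) :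
    res (fun t => a * f t) c = a * res f c := by
  apply res_eq_of_eventually
  filter_upwards [hf.eventually_circleIntegral] with ε h1
  rw [circleIntegral.integral_const_mul, ← h1.2]
  ring

theorem res_neg {f : ℂ → ℂ} {c : ℂ} (hf : MeromorphicAt f c) :
    res (fun t => - f t) c = - res f c := by
  simpa using res_const_mul (-1) hf

theorem res_sub {f g : ℂ → ℂ} {c : ℂ} (hf : MeromorphicAt f c) (hg : MeromorphicAt g c) :
    res (fun t => f t - g t) c = res f c - res g c := by
  simpa [sub_eq_add_neg, res_neg hg] using res_add hf hg.fun_neg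

theorem res_zero (c : ℂ) : res (fun _ => 0) c = 0 :=
  res_eq_of_eventually (by simp [circleIntegral])

theorem res_sum {ι : Type*} (s : Finset ι) {f : ι → ℂ → ℂ} {c : ℂ}
    (hf : ∀ i ∈ s, MeromorphicAt (f i) c) :
    res (fun t => ∑ i ∈ s, f i t) c = ∑ i ∈ s, res (f i) c := by
  classical
  induction s using Finset.induction_on with
  | empty => simpa using res_zero c
  | insert a s ha ih =>
    rw [Finset.sum_insert ha, ← ih fun i hi => hf i (Finset.mem_insert_of_mem hi), ← res_add
      (hf a (Finset.mem_insert_self a s))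
      (MeromorphicAt.fun_sum fun i hi => hf i (Finset.mem_insert_of_mem hi))]
    simp only [Finset.sum_insert ha]

theorem res_of_hasDerivAt {F f : ℂ → ℂ} {c : ℂ} (h : ∀ᶠ t in 𝓝[≠] c, HasDerivAt F (f t) t) :
    res f c = 0 := by
  apply res_eq_of_eventually
  rw [eventually_nhdsWithin_iff, Metric.eventually_nhds_iff_ball] at h
  obtain ⟨R, hR, h⟩ := h
  filter_upwards [Ioo_mem_nhdsGT hR] with ε hε
  rw [circleIntegral.integral_eq_zero_of_hasDerivWithinAt hε.1.le, mul_zero]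
  intro z hz
  have hz' : dist z c = ε := hz
  exact (h z (by rw [mem_ball, hz']; exact hε.2)
    (by rintro rfl; rw [dist_self] at hz'; exact hε.1.ne hz')).hasDerivWithinAt

theorem _root_.AnalyticAt.exists_hasDerivAt {g : ℂ → ℂ} {c : ℂ} (hg : AnalyticAt ℂ g c) :
    ∃ G : ℂ → ℂ, AnalyticAt ℂ G c ∧ ∀ᶠ t in 𝓝 c, HasDerivAt G (g t) t := by
  obtain ⟨R, hR, h⟩ := Metric.eventually_nhds_iff_ball.1 hg.eventually_analyticAt
  obtain ⟨G, hG⟩ := DifferentiableOn.isExactOn_ball (c := c) (r := R) (f := g)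
    fun z hz => (h z hz).differentiableAt.differentiableWithinAt
  have hG' : ∀ᶠ t in 𝓝 c, HasDerivAt G (g t) t := by
    filter_upwards [ball_mem_nhds c hR] with t ht using hG t ht
  refine ⟨G, ?_, hG'⟩
  rw [Complex.analyticAt_iff_eventually_differentiableAt]
  exact hG'.mono fun t ht => ht.differentiableAt

theorem res_of_analyticAt {g : ℂ → ℂ} {c : ℂ} (hg : AnalyticAt ℂ g c) : res g c = 0 := by
  obtain ⟨G, -, h⟩ := hg.exists_hasDerivAt
  exact res_of_hasDerivAt (h.filter_mono nhdsWithin_le_nhds)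

theorem res_sub_center_inv (c : ℂ) : res (fun t => (t - c)⁻¹) c = 1 := by
  apply res_eq_of_eventually
  filter_upwards [self_mem_nhdsWithin] with ε hε
  rw [circleIntegral.integral_sub_center_inv c (ne_of_gt hε)]
  exact inv_mul_cancel₀ Complex.two_pi_I_ne_zero

theorem meromorphicAt_sub_inv_pow (c : ℂ) (k : ℕ) : MeromorphicAt (fun t : ℂ => (t - c)⁻¹ ^ k) c :=
  (((analyticAt_id.sub analyticAt_const).meromorphicAt).inv.pow k)

/-- The principal part of a meromorphic function. -/
theorem _root_.MeromorphicAt.exists_principalPart {f : ℂ → ℂ} {c : ℂ} (hf : MeromorphicAt f c) :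
    ∃ (N : ℕ) (a : ℕ → ℂ) (g : ℂ → ℂ), AnalyticAt ℂ g c ∧
      ∀ᶠ t in 𝓝[≠] c, f t = ∑ k ∈ Finset.range N, a k * (t - c)⁻¹ ^ (k + 1) + g t := by
  obtain ⟨n, g, hg, hfg⟩ := MeromorphicAt.iff_eventuallyEq_zpow_smul_analyticAt.1 hf
  have key : ∀ N : ℕ, ∀ g : ℂ → ℂ, AnalyticAt ℂ g c → ∃ (a : ℕ → ℂ) (h : ℂ → ℂ), AnalyticAt ℂ h c ∧
      ∀ t ≠ c, (t - c)⁻¹ ^ N * g t = ∑ k ∈ Finset.range N, a k * (t - c)⁻¹ ^ (k + 1) + h t := by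
    intro N
    induction N with
    | zero => intro g hg; exact ⟨0, g, hg, by simp⟩
    | succ N ih =>
      intro g hg
      obtain ⟨p, hp⟩ := hg
      obtain ⟨a, h, hh, e⟩ := ih (dslope g c) hp.has_fpower_series_dslope_fslope.analyticAt
      refine ⟨Function.update a N (g c), h, hh, fun t ht => ?_⟩
      have htc : t - c ≠ 0 := sub_ne_zero.2 ht
      rw [Finset.sum_range_succ, Function.update_self, Finset.sum_congr rfl (g := fun k =>
        a k * (t - c)⁻¹ ^ (k + 1)) fun k hk => by
          rw [Function.update_of_ne (Finset.mem_range.1 hk).ne], add_right_comm, ← e t ht,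
        dslope_of_ne _ ht, slope_def_field]
      rw [pow_succ]
      field_simp
      ring
  obtain ⟨m, rfl | rfl⟩ := n.eq_nat_or_neg
  · refine ⟨0, 0, fun t => (t - c) ^ m * g t, by fun_prop, ?_⟩
    filter_upwards [hfg] with t ht
    simp [ht]
  · obtain ⟨a, h, hh, e⟩ := key m g hg
    refine ⟨m, a, h, hh, ?_⟩
    filter_upwards [hfg, self_mem_nhdsWithin] with t ht ht'
    rw [ht, ← e t ht']
    simp

/-- A meromorphic function with residue `ρ` is `ρ / (t - c)` plus the derivative of a meromorphic
function. -/
theorem _root_.MeromorphicAt.exists_primitive {f : ℂ → ℂ} {c : ℂ} (hf : MeromorphicAt f c) :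
    ∃ Ψ : ℂ → ℂ, MeromorphicAt Ψ c ∧
      ∀ᶠ t in 𝓝[≠] c, HasDerivAt Ψ (f t - res f c * (t - c)⁻¹) t := by
  obtain ⟨N, a, g, hg, e⟩ := hf.exists_principalPart
  obtain ⟨G, hG, hG'⟩ := hg.exists_hasDerivAt
  have key : ∀ N : ℕ, ∃ (ρ : ℂ) (Ψ : ℂ → ℂ), MeromorphicAt Ψ c ∧ ∀ t ≠ c,
      HasDerivAt Ψ (∑ k ∈ Finset.range N, a k * (t - c)⁻¹ ^ (k + 1) - ρ * (t - c)⁻¹) t := by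
    intro N
    induction N with
    | zero => exact ⟨0, fun _ => 0, MeromorphicAt.const _ _, fun t _ => by simpa using hasDerivAt_const t (0 : ℂ)⟩
    | succ N ih =>
      obtain ⟨ρ, Ψ, hΨ, h⟩ := ih
      rcases N.eq_zero_or_pos with rfl | hN
      · exact ⟨a 0, fun _ => 0, MeromorphicAt.const _ _, fun t _ => by simpa using hasDerivAt_const t (0 : ℂ)⟩
      · refine ⟨ρ, fun t => Ψ t + (-(a N / N)) * (t - c)⁻¹ ^ N,
          hΨ.add ((MeromorphicAt.const _ _).mul (meromorphicAt_sub_inv_pow c N)), fun t ht => ?_⟩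
        have htc : t - c ≠ 0 := sub_ne_zero.2 ht
        have hN' : (N : ℂ) ≠ 0 := Nat.cast_ne_zero.2 hN.ne'
        have h1 : HasDerivAt (fun t : ℂ => (t - c)⁻¹ ^ N)
            (N * (t - c)⁻¹ ^ (N - 1) * (-1 / (t - c) ^ 2)) t :=
          ((((hasDerivAt_id t).sub_const c).inv htc)).pow N
        refine ((h t ht).add (h1.const_mul (-(a N / N)))).congr_deriv ?_
        rw [Finset.sum_range_succ]
        obtain ⟨n, rfl⟩ := Nat.exists_eq_succ_of_ne_zero hN.ne'
        rw [Nat.succ_eq_add_one] at hN' ⊢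
        rw [Nat.add_sub_cancel, show -1 / (t - c) ^ 2 = -((t - c)⁻¹ ^ 2) by field_simp]
        generalize ∑ k ∈ Finset.range (n + 1), a k * (t - c)⁻¹ ^ (k + 1) = S
        generalize (t - c)⁻¹ = v
        field_simp
        ring
  obtain ⟨ρ, Ψ, hΨ, h⟩ := key N
  have hd : ∀ᶠ t in 𝓝[≠] c, HasDerivAt (fun t => Ψ t + G t) (f t - ρ * (t - c)⁻¹) t := by
    filter_upwards [e, hG'.filter_mono nhdsWithin_le_nhds, self_mem_nhdsWithin] with t h1 h2 h3
    refine ((h t h3).add h2).congr_deriv ?_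
    rw [h1]; ring
  have hρ : res f c = ρ := by
    have h0 := res_of_hasDerivAt hd
    have hm : MeromorphicAt (fun t : ℂ => (t - c)⁻¹) c := by
      simpa using meromorphicAt_sub_inv_pow c 1
    rw [res_sub hf ((MeromorphicAt.const ρ c).fun_mul hm), res_const_mul ρ hm, res_sub_center_inv,
      mul_one] at h0
    exact sub_eq_zero.1 h0
  exact ⟨fun t => Ψ t + G t, hΨ.add hG.meromorphicAt, by rwa [hρ]⟩

/-- Integration by parts for residues: `A` and `Ψ` are primitives of `b` and `f`. -/
theorem res_mul_eq_neg_res_mul_of_hasDerivAt {A b Ψ f : ℂ → ℂ} {c : ℂ} (hA : MeromorphicAt A c)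
    (hb : MeromorphicAt b c) (hΨ : MeromorphicAt Ψ c) (hf : MeromorphicAt f c)
    (h1 : ∀ᶠ t in 𝓝[≠] c, HasDerivAt A (b t) t) (h2 : ∀ᶠ t in 𝓝[≠] c, HasDerivAt Ψ (f t) t) :
    res (fun t => A t * f t) c = - res (fun t => b t * Ψ t) c := by
  have := res_of_hasDerivAt (F := fun t => A t * Ψ t) (f := fun t => b t * Ψ t + A t * f t) (c := c) (by
    filter_upwards [h1, h2] with t h1 h2 using h1.mul h2)
  rw [res_add (hb.fun_mul hΨ) (hA.fun_mul hf)] at this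
  exact eq_neg_of_add_eq_zero_right this

theorem eventually_nhdsNE_comp {ψ : ℂ → ℂ} {c : ℂ} (hψ : ContinuousAt ψ c)
    (hne : ∀ᶠ t in 𝓝[≠] c, ψ t ≠ ψ c) {p : ℂ → Prop} (h : ∀ᶠ s in 𝓝[≠] (ψ c), p s) :
    ∀ᶠ t in 𝓝[≠] c, p (ψ t) :=
  (tendsto_nhdsWithin_iff.2 ⟨hψ.mono_left nhdsWithin_le_nhds, hne⟩).eventually h

/-- The residue of the pullback of a `1`-form by a map of local degree `k`. -/
theorem res_comp_mul_deriv {f ψ g : ℂ → ℂ} {c : ℂ} {k : ℕ} (hk : 0 < k)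
    (hf : MeromorphicAt f (ψ c)) (hψ : AnalyticAt ℂ ψ c) (hg : AnalyticAt ℂ g c) (hgc : g c ≠ 0)
    (e : ∀ᶠ t in 𝓝 c, ψ t = ψ c + (t - c) ^ k * g t) :
    res (fun t => f (ψ t) * deriv ψ t) c = k * res f (ψ c) := by
  have hne : ∀ᶠ t in 𝓝[≠] c, ψ t ≠ ψ c := by
    filter_upwards [e.filter_mono nhdsWithin_le_nhds, self_mem_nhdsWithin,
      (hg.continuousAt.eventually_ne hgc).filter_mono nhdsWithin_le_nhds] with t h1 h2 h3
    rw [h1]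
    simp [sub_ne_zero.2 h2, h3]
  obtain ⟨Ψ, hΨ, hd⟩ := hf.exists_primitive
  have hψd : ∀ᶠ t in 𝓝[≠] c, HasDerivAt ψ (deriv ψ t) t :=
    (hψ.eventually_analyticAt.mono fun t ht => ht.differentiableAt.hasDerivAt).filter_mono
      nhdsWithin_le_nhds
  have h1 : ∀ᶠ t in 𝓝[≠] c, HasDerivAt (fun t => Ψ (ψ t))
      ((f (ψ t) - res f (ψ c) * (ψ t - ψ c)⁻¹) * deriv ψ t) t := by
    filter_upwards [eventually_nhdsNE_comp hψ.continuousAt hne hd, hψd] with t h1 h2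
      using h1.comp t h2
  have h2 : ∀ᶠ t in 𝓝[≠] c, (ψ t - ψ c)⁻¹ * deriv ψ t = k * (t - c)⁻¹ + deriv g t / g t := by
    have e' := e.eventually_nhds
    filter_upwards [e'.filter_mono nhdsWithin_le_nhds, self_mem_nhdsWithin,
      (hg.continuousAt.eventually_ne hgc).filter_mono nhdsWithin_le_nhds,
      hg.eventually_analyticAt.filter_mono nhdsWithin_le_nhds] with t h1 h2 h3 h4
    have htc : t - c ≠ 0 := sub_ne_zero.2 h2
    have hd1 : HasDerivAt (fun t => ψ c + (t - c) ^ k * g t)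
        (k * (t - c) ^ (k - 1) * 1 * g t + (t - c) ^ k * deriv g t) t :=
      ((((hasDerivAt_id t).sub_const c).pow k).mul h4.differentiableAt.hasDerivAt).const_add _
    have h1' : ψ =ᶠ[𝓝 t] fun t => ψ c + (t - c) ^ k * g t := h1
    rw [h1'.deriv_eq, hd1.deriv, h1'.eq_of_nhds]
    obtain ⟨n, rfl⟩ := Nat.exists_eq_succ_of_ne_zero hk.ne'
    simp only [Nat.succ_eq_add_one, Nat.add_sub_cancel]
    field_simp
    ring
  have hm1 : MeromorphicAt (fun t => f (ψ t) * deriv ψ t) c :=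
    (hf.comp_analyticAt hψ).mul hψ.deriv.meromorphicAt
  have hm2 : MeromorphicAt (fun t : ℂ => (k : ℂ) * (t - c)⁻¹) c := by
    simpa using (MeromorphicAt.const (k : ℂ) c).fun_mul (meromorphicAt_sub_inv_pow c 1)
  have hm2' : MeromorphicAt (fun t : ℂ => (t - c)⁻¹) c := by
    simpa using (meromorphicAt_sub_inv_pow c 1)
  have han : AnalyticAt ℂ (fun t => deriv g t / g t) c := hg.deriv.div hg hgc
  have hm3 : MeromorphicAt (fun t : ℂ => (k : ℂ) * (t - c)⁻¹ + deriv g t / g t) c :=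
    hm2.add han.meromorphicAt
  have h3 := res_of_hasDerivAt h1
  rw [res_congr (g := fun t => f (ψ t) * deriv ψ t -
    res f (ψ c) * ((k : ℂ) * (t - c)⁻¹ + deriv g t / g t)) (by
      filter_upwards [h2] with t ht
      rw [← ht]; ring), res_sub hm1 ((MeromorphicAt.const _ _).fun_mul hm3), res_const_mul _ hm3,
      res_add hm2 han.meromorphicAt, res_const_mul _ hm2', res_sub_center_inv,
      res_of_analyticAt han] at h3
  linear_combination h3

/-- Invariance of the residue under changes of coordinates. -/
theorem res_comp_mul_deriv_of_deriv_ne_zero {f ψ : ℂ → ℂ} {c : ℂ}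
    (hf : MeromorphicAt f (ψ c)) (hψ : AnalyticAt ℂ ψ c) (h : deriv ψ c ≠ 0) :
    res (fun t => f (ψ t) * deriv ψ t) c = res f (ψ c) := by
  obtain ⟨p, hp⟩ := hψ
  have := res_comp_mul_deriv (g := dslope ψ c) one_pos hf ⟨p, hp⟩
    hp.has_fpower_series_dslope_fslope.analyticAt (by rwa [dslope_same]) (Eventually.of_forall
      fun t => by rw [pow_one, ← smul_eq_mul, sub_smul_dslope]; ring)
  simpa using this

/-! ### Traces, the residue theorem in the plane, and parameters -/

/-- A meromorphic function that is bounded near `c` extends analytically to `c`. -/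
theorem _root_.MeromorphicAt.exists_analyticAt_of_bound {f : ℂ → ℂ} {c : ℂ} (hf : MeromorphicAt f c)
    {B : ℝ} (hB : ∀ᶠ t in 𝓝[≠] c, ‖f t‖ ≤ B) :
    ∃ g : ℂ → ℂ, AnalyticAt ℂ g c ∧ f =ᶠ[𝓝[≠] c] g := by
  have hd := hf.eventually_analyticAt
  have h := hd.and hB
  rw [eventually_nhdsWithin_iff, Metric.eventually_nhds_iff_ball] at h
  obtain ⟨R, hR, h⟩ := h
  refine ⟨Function.update f c ((𝓝[≠] c).limUnder f), ?_, ?_⟩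
  · refine DifferentiableOn.analyticAt (Complex.differentiableOn_update_limUnder_of_bddAbove
      (ball_mem_nhds c hR) (fun z hz => (h z hz.1 hz.2).1.differentiableAt.differentiableWithinAt)
      ⟨B, ?_⟩) (ball_mem_nhds c hR)
    rintro _ ⟨z, hz, rfl⟩
    exact (h z hz.1 hz.2).2
  · filter_upwards [self_mem_nhdsWithin] with t ht
    rw [Function.update_of_ne ht]

theorem _root_.ContinuousAt.eventually_norm_le {g : ℂ → ℂ} {c : ℂ} (hg : ContinuousAt g c) :
    ∀ᶠ t in 𝓝[≠] c, ‖g t‖ ≤ ‖g c‖ + 1 :=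
  (hg.norm.eventually (gt_mem_nhds (lt_add_one _))).filter_mono nhdsWithin_le_nhds |>.mono
    fun _ h => le_of_lt h

/-- A function whose pullback by `u ↦ u ^ k` is meromorphic at `0` is meromorphic at `0`. -/
theorem meromorphicAt_of_comp_pow {f : ℂ → ℂ} {k : ℕ} (hk : 0 < k)
    (h : MeromorphicAt (fun u => f (u ^ k)) 0) : MeromorphicAt f 0 := by
  have hk' : (k : ℂ) ≠ 0 := Nat.cast_ne_zero.2 hk.ne'
  -- a pole of order `N` of the pullback is killed by `s ^ N`
  obtain ⟨N, hN⟩ := h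
  have hroot : ∀ s : ℂ, ∃ u : ℂ, u ^ k = s := fun s => IsAlgClosed.exists_pow_nat_eq s hk
  obtain ⟨R, hR, hb⟩ := Metric.eventually_nhds_iff_ball.1 (hN.eventually_analyticAt.and
    (hN.continuousAt.norm.eventually (gt_mem_nhds (lt_add_one _))))
  set B := ‖((0 : ℂ) - 0) ^ N • f (0 ^ k)‖ + 1
  have hsmall : ∀ {s u : ℂ}, u ^ k = s → s ∈ ball (0 : ℂ) ((min R 1) ^ k) → u ∈ ball (0 : ℂ) (min R 1) := by
    rintro s u rfl hs
    rw [mem_ball_zero_iff, norm_pow] at hs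
    rw [mem_ball_zero_iff]
    exact lt_of_pow_lt_pow_left₀ k (le_min hR.le zero_le_one) hs
  have hpos : 0 < (min R 1) ^ k := pow_pos (lt_min hR one_pos) k
  have hdiff : ∀ s ∈ ball (0 : ℂ) ((min R 1) ^ k), s ≠ 0 → DifferentiableAt ℂ f s := by
    intro s hs hs0
    obtain ⟨u, rfl⟩ := hroot s
    have hu : u ≠ 0 := by rintro rfl; exact hs0 (zero_pow hk.ne')
    have huR : u ∈ ball (0 : ℂ) R := ball_subset_ball (min_le_left _ _) (hsmall rfl hs)
    have hg : DifferentiableAt ℂ (fun u => f (u ^ k)) u := by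
      have h1 := (hb u huR).1.differentiableAt
      have h2 : DifferentiableAt ℂ (fun v : ℂ => (v ^ N)⁻¹ * ((v - 0) ^ N • f (v ^ k))) u :=
        ((differentiableAt_id.pow N).inv (pow_ne_zero N hu)).mul h1
      refine h2.congr_of_eventuallyEq ?_
      filter_upwards [isOpen_ne.mem_nhds hu] with v hv
      simp only [sub_zero, smul_eq_mul]
      rw [inv_mul_cancel_left₀ (pow_ne_zero N hv)]
    -- near `s`, the function is its pullback composed with a local inverse of the power map
    have hp : HasStrictDerivAt (fun v : ℂ => v ^ k) (k * u ^ (k - 1)) u := hasStrictDerivAt_pow k u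
    have hne : (k * u ^ (k - 1) : ℂ) ≠ 0 := mul_ne_zero hk' (pow_ne_zero _ hu)
    have hinv := hp.to_localInverse hne
    have h0 : hp.localInverse _ _ _ hne (u ^ k) = u := by
      exact HasStrictFDerivAt.localInverse_apply_image _
    have hcomp : DifferentiableAt ℂ (fun s => f (hp.localInverse _ _ _ hne s ^ k)) (u ^ k) := by
      have : DifferentiableAt ℂ (fun u => f (u ^ k)) (hp.localInverse _ _ _ hne (u ^ k)) := by rwa [h0]
      exact DifferentiableAt.comp (g := fun u => f (u ^ k)) (u ^ k) this hinv.hasDerivAt.differentiableAt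
    refine hcomp.congr_of_eventuallyEq ?_
    filter_upwards [HasStrictFDerivAt.eventually_right_inverse
      (hp.hasStrictFDerivAt_equiv hne)] with s hs
    have hs' : hp.localInverse _ _ _ hne s ^ k = s := hs
    rw [hs']
  have hbound : ∀ s ∈ ball (0 : ℂ) ((min R 1) ^ k), ‖s ^ N * f s‖ ≤ B := by
    intro s hs
    obtain ⟨u, rfl⟩ := hroot s
    have hu := hsmall rfl hs
    have huR : u ∈ ball (0 : ℂ) R := ball_subset_ball (min_le_left _ _) hu
    have h1 : ‖u‖ ≤ 1 := (mem_ball_zero_iff.1 (ball_subset_ball (min_le_right _ _) hu)).le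
    have h2 := (hb u huR).2
    rw [sub_zero, smul_eq_mul] at h2
    rw [← pow_mul, mul_comm k N, pow_mul]
    calc ‖(u ^ N) ^ k * f (u ^ k)‖ = ‖u ^ N‖ ^ (k - 1) * ‖u ^ N * f (u ^ k)‖ := by
          rw [norm_mul, norm_mul, norm_pow, ← mul_assoc, ← pow_succ, Nat.sub_add_cancel hk]
      _ ≤ 1 * ‖u ^ N * f (u ^ k)‖ := by
          gcongr
          refine pow_le_one₀ (norm_nonneg _) ?_
          rw [norm_pow]
          exact pow_le_one₀ (norm_nonneg _) h1
      _ ≤ B := by rw [one_mul]; exact h2.le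
  set S := ball (0 : ℂ) ((min R 1) ^ k)
  have hS : S ∈ 𝓝 (0 : ℂ) := ball_mem_nhds _ hpos
  have han := (Complex.differentiableOn_update_limUnder_of_bddAbove (f := fun s => s ^ N * f s)
    hS (fun s hs => ((differentiableAt_id.pow N).mul (hdiff s hs.1 hs.2)).differentiableWithinAt)
    ⟨B, by rintro _ ⟨s, hs, rfl⟩; exact hbound s hs.1⟩).analyticAt hS
  have hm : MeromorphicAt (fun s : ℂ => (s ^ N)⁻¹ *
      Function.update (fun s => s ^ N * f s) 0 ((𝓝[≠] 0).limUnder fun s => s ^ N * f s) s) 0 :=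
    (((MeromorphicAt.id 0).pow N).inv).mul han.meromorphicAt
  refine hm.congr ?_
  filter_upwards [self_mem_nhdsWithin] with s hs
  rw [Function.update_of_ne hs, inv_mul_cancel_left₀ (pow_ne_zero N hs)]

/-- The `r`-th roots of unity, as powers of a primitive one. -/
noncomputable def zetaRoot (r : ℕ) (j : ℕ) : ℂ := Complex.exp (2 * Real.pi * Complex.I / r) ^ j

theorem zetaRoot_ne_zero (r j : ℕ) : zetaRoot r j ≠ 0 := pow_ne_zero _ (Complex.exp_ne_zero _)

theorem zetaRoot_zero (r : ℕ) : zetaRoot r 0 = 1 := pow_zero _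

theorem zetaRoot_pow {r : ℕ} (hr : 0 < r) (j : ℕ) : zetaRoot r j ^ r = 1 := by
  have h := (Complex.isPrimitiveRoot_exp r hr.ne').pow_eq_one
  unfold zetaRoot
  rw [← pow_mul, mul_comm j, pow_mul, h, one_pow]

theorem norm_zetaRoot {r : ℕ} (hr : 0 < r) (j : ℕ) : ‖zetaRoot r j‖ = 1 :=
  by
  have h := congrArg norm (zetaRoot_pow hr j)
  rw [norm_pow, norm_one] at h
  exact (pow_eq_one_iff_of_nonneg (norm_nonneg _) hr.ne').1 h

theorem zetaRoot_injOn {r : ℕ} (hr : 0 < r) : InjOn (zetaRoot r) (Finset.range r) := by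
  intro i hi j hj h
  exact (Complex.isPrimitiveRoot_exp r hr.ne').pow_inj (Finset.mem_range.1 hi) (Finset.mem_range.1 hj) h

theorem exists_zetaRoot_mul {r : ℕ} (hr : 0 < r) {s t : ℂ} (h : s ^ r = t ^ r) :
    ∃ j ∈ Finset.range r, s = zetaRoot r j * t := by
  rcases eq_or_ne t 0 with rfl | ht
  · exact ⟨0, Finset.mem_range.2 hr, by
      rw [zero_pow hr.ne'] at h; rw [mul_zero]; exact pow_eq_zero_iff hr.ne' |>.1 h⟩
  · have : NeZero r := ⟨hr.ne'⟩
    obtain ⟨i, hi, e⟩ := (Complex.isPrimitiveRoot_exp r hr.ne').eq_pow_of_pow_eq_one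
      (ξ := s / t) (by rw [div_pow, h, div_self (pow_ne_zero _ ht)])
    exact ⟨i, Finset.mem_range.2 hi, by unfold zetaRoot; rw [e, div_mul_cancel₀ _ ht]⟩

/-- The residue of a `1`-form is that of its pullback by a rotation. -/
theorem res_rotate {a : ℂ → ℂ} (ha : MeromorphicAt a 0) {w : ℂ} (hw : w ≠ 0) :
    res (fun s => a (w * s) * w) 0 = res a 0 := by
  have hd : ∀ t, deriv (fun s : ℂ => w * s) t = w := fun t => by simp
  have := res_comp_mul_deriv_of_deriv_ne_zero (f := a) (ψ := fun s => w * s) (c := 0)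
    (by rwa [mul_zero]) (by fun_prop) (by rw [hd]; exact hw)
  simpa [hd] using this

/-- The trace `T(v) dv` of the `1`-form `a(s) ds` under `s ↦ v = s ^ r` is meromorphic, with the same
residue. -/
theorem meromorphicAt_trace {a T : ℂ → ℂ} {r : ℕ} (hr : 0 < r) (ha : MeromorphicAt a 0)
    (hT : ∀ᶠ s in 𝓝[≠] (0 : ℂ), T (s ^ r) =
      ∑ j ∈ Finset.range r, a (zetaRoot r j * s) / (r * (zetaRoot r j * s) ^ (r - 1))) :
    MeromorphicAt T 0 ∧ res T 0 = res a 0 := by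
  have hr' : (r : ℂ) ≠ 0 := Nat.cast_ne_zero.2 hr.ne'
  have hrot : ∀ j : ℕ, MeromorphicAt (fun s => a (zetaRoot r j * s)) 0 := fun j =>
    MeromorphicAt.comp_analyticAt (g := fun s : ℂ => zetaRoot r j * s) (by rwa [mul_zero])
      (by fun_prop)
  have hm : MeromorphicAt (fun s => T (s ^ r)) 0 := by
    refine MeromorphicAt.congr (MeromorphicAt.fun_sum (s := Finset.range r) (G := fun j s =>
      a (zetaRoot r j * s) / (r * (zetaRoot r j * s) ^ (r - 1))) fun j _ => (hrot j).fun_div ?_) ?_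
    · exact AnalyticAt.meromorphicAt (by fun_prop)
    · filter_upwards [hT] with s hs using hs.symm
  have hTm := meromorphicAt_of_comp_pow hr hm
  refine ⟨hTm, ?_⟩
  have hpow : res (fun s => T (s ^ r) * deriv (fun s : ℂ => s ^ r) s) 0 = r * res T (0 ^ r) :=
    res_comp_mul_deriv (f := T) (ψ := fun s => s ^ r) (g := fun _ => 1) (c := 0) hr
      (by rwa [zero_pow hr.ne']) (by fun_prop) (by fun_prop) one_ne_zero
      (Eventually.of_forall fun t => by simp [zero_pow hr.ne'])
  have hsum : res (fun s => T (s ^ r) * deriv (fun s : ℂ => s ^ r) s) 0 = r * res a 0 := by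
    rw [res_congr (g := fun s => ∑ j ∈ Finset.range r, a (zetaRoot r j * s) * zetaRoot r j), res_sum,
      Finset.sum_congr rfl fun j _ => res_rotate ha (zetaRoot_ne_zero r j), Finset.sum_const,
      Finset.card_range, nsmul_eq_mul]
    · exact fun j _ => (hrot j).fun_mul (MeromorphicAt.const _ _)
    · filter_upwards [hT, self_mem_nhdsWithin] with s hs hs0
      rw [hs, Finset.sum_mul]
      refine Finset.sum_congr rfl fun j _ => ?_
      have h1 : zetaRoot r j ^ (r - 1) * zetaRoot r j = 1 := by
        rw [← pow_succ, Nat.sub_add_cancel hr, zetaRoot_pow hr]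
      have h2 : s ^ (r - 1) ≠ 0 := pow_ne_zero _ hs0
      have h3 : zetaRoot r j ^ (r - 1) ≠ 0 := pow_ne_zero _ (zetaRoot_ne_zero r j)
      rw [deriv_pow_field, mul_pow, div_mul_eq_mul_div, div_eq_iff (by positivity)]
      linear_combination (-(a (zetaRoot r j * s) * r * s ^ (r - 1))) * h1
  rw [zero_pow hr.ne', hsum] at hpow
  exact (mul_left_cancel₀ hr' hpow).symm

/-- If `a(s) ds` has vanishing trace under `s ↦ s ^ r`, then it has residue `0`. -/
theorem res_eq_zero_of_trace_eq_zero {a : ℂ → ℂ} {r : ℕ} (hr : 0 < r) (ha : MeromorphicAt a 0)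
    (h : ∀ᶠ s in 𝓝[≠] (0 : ℂ),
      ∑ j ∈ Finset.range r, a (zetaRoot r j * s) / (r * (zetaRoot r j * s) ^ (r - 1)) = 0) :
    res a 0 = 0 := by
  rw [← (meromorphicAt_trace (T := fun _ => 0) hr ha (h.mono fun s hs => hs.symm)).2, res_zero]

theorem circleIntegral_sub_inv_pow_succ_succ (w c : ℂ) (R : ℝ) (k : ℕ) :
    (∮ t in C(c, R), (t - w)⁻¹ ^ (k + 2)) = 0 := by
  rw [← circleIntegral.integral_sub_zpow_of_ne (n := -((k : ℤ) + 2)) (by omega) c w R]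
  congr 1
  ext t
  rw [zpow_neg, inv_pow]
  norm_cast

theorem res_sub_inv_pow (c : ℂ) (k : ℕ) :
    res (fun t => (t - c)⁻¹ ^ (k + 1)) c = if k = 0 then 1 else 0 := by
  rcases k with _ | k
  · simpa using res_sub_center_inv c
  · exact res_eq_of_eventually (Eventually.of_forall fun ε => by
      rw [circleIntegral_sub_inv_pow_succ_succ]; simp)

/-- A function with removable singularities only is turned into a holomorphic one by taking limits. -/
theorem eventually_limUnder_eq {F g : ℂ → ℂ} {c : ℂ} (hg : AnalyticAt ℂ g c) (h : F =ᶠ[𝓝[≠] c] g) :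
    (fun t => limUnder (𝓝[≠] t) F) =ᶠ[𝓝 c] g := by
  have h1 : ∀ᶠ t in 𝓝 c, t ≠ c → F =ᶠ[𝓝 t] g := by
    refine (eventually_nhdsWithin_iff (s := {c}ᶜ)).1 ?_
    exact (eventually_eventually_nhdsWithin.2 h).mp (by
      filter_upwards [self_mem_nhdsWithin] with t ht h
      rw [(isOpen_compl_singleton (x := c)).nhdsWithin_eq ht] at h; exact h)
  filter_upwards [h1, hg.eventually_analyticAt] with t h1 h2
  refine Tendsto.limUnder_eq ?_
  rcases eq_or_ne t c with rfl | ht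
  · exact (h2.continuousAt.mono_left nhdsWithin_le_nhds).congr' h.symm
  · exact (h2.continuousAt.mono_left nhdsWithin_le_nhds).congr'
      ((h1 ht).filter_mono nhdsWithin_le_nhds).symm

/-- Cauchy's theorem for a function on a closed disc with removable singularities only. -/
theorem circleIntegral_eq_zero_of_removable {F : ℂ → ℂ} {R : ℝ} (hR : 0 < R)
    (h : ∀ t ∈ closedBall (0 : ℂ) R, ∃ g : ℂ → ℂ, AnalyticAt ℂ g t ∧ F =ᶠ[𝓝[≠] t] g) :
    CircleIntegrable F 0 R ∧ (∮ t in C(0, R), F t) = 0 := by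
  have han : ∀ t ∈ closedBall (0 : ℂ) R, AnalyticAt ℂ (fun t => limUnder (𝓝[≠] t) F) t := by
    intro t ht
    obtain ⟨g, hg, e⟩ := h t ht
    exact hg.congr (eventually_limUnder_eq hg e).symm
  have hcod : (fun t => limUnder (𝓝[≠] t) F) =ᶠ[codiscreteWithin (sphere 0 |R|)] F := by
    rw [Filter.EventuallyEq, Filter.Eventually, mem_codiscreteWithin_iff_forall_mem_nhdsNE]
    intro t ht
    rw [abs_of_pos hR] at ht
    obtain ⟨g, hg, e⟩ := h t (sphere_subset_closedBall ht)
    filter_upwards [(eventually_limUnder_eq hg e).filter_mono nhdsWithin_le_nhds, e] with s h1 h2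
    left
    exact h1.trans h2.symm
  have hi : CircleIntegrable (fun t => limUnder (𝓝[≠] t) F) 0 R :=
    ContinuousOn.circleIntegrable hR.le fun t ht =>
      (han t (sphere_subset_closedBall ht)).continuousAt.continuousWithinAt
  refine ⟨hi.congr_codiscreteWithin hcod, ?_⟩
  rw [← circleIntegral.circleIntegral_congr_codiscreteWithin hcod hR.ne']
  exact Complex.circleIntegral_eq_zero_of_differentiable_on_off_countable hR.le countable_empty
    (fun t ht => (han t ht).continuousAt.continuousWithinAt)
    fun t ht => (han t (ball_subset_closedBall ht.1)).differentiableAt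

/-- The residue theorem for a disc. -/
theorem circleIntegral_eq_sum_res {f : ℂ → ℂ} {R : ℝ} (hR : 0 < R) (S : Finset ℂ)
    (hS : ∀ s ∈ S, s ∈ ball (0 : ℂ) R) (hm : ∀ s ∈ S, MeromorphicAt f s)
    (hreg : ∀ t ∈ closedBall (0 : ℂ) R, t ∉ S → ∃ g : ℂ → ℂ, AnalyticAt ℂ g t ∧ f =ᶠ[𝓝[≠] t] g) :
    CircleIntegrable f 0 R ∧ (∮ t in C(0, R), f t) = 2 * Real.pi * Complex.I * ∑ s ∈ S, res f s := by
  classical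
  -- the principal parts `p s` at the points `s ∈ S`
  have hpp : ∀ s : ℂ, ∃ p : ℂ → ℂ, s ∈ S → AnalyticOnNhd ℂ p {s}ᶜ ∧
      (∮ t in C(0, R), p t) = 2 * Real.pi * Complex.I * res f s ∧
      ∃ g : ℂ → ℂ, AnalyticAt ℂ g s ∧ (fun t => f t - p t) =ᶠ[𝓝[≠] s] g := by
    intro s
    by_cases hs : s ∈ S
    swap
    · exact ⟨0, fun h => absurd h hs⟩
    obtain ⟨N, a, g, hg, e⟩ := (hm s hs).exists_principalPart
    have han : ∀ k, AnalyticOnNhd ℂ (fun t => a k * (t - s)⁻¹ ^ (k + 1)) {s}ᶜ := fun k t ht =>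
      analyticAt_const.mul (((analyticAt_id.sub analyticAt_const).inv (sub_ne_zero.2 ht)).pow _)
    have hmer : ∀ k, MeromorphicAt (fun t => a k * (t - s)⁻¹ ^ (k + 1)) s := fun k =>
      (MeromorphicAt.const _ _).fun_mul (meromorphicAt_sub_inv_pow s _)
    refine ⟨fun t => ∑ k ∈ Finset.range N, a k * (t - s)⁻¹ ^ (k + 1), fun _ =>
      ⟨fun t ht => Finset.analyticAt_fun_sum _ fun k _ => han k t ht, ?_, g, hg, ?_⟩⟩
    · rw [res_congr e, res_add (MeromorphicAt.fun_sum fun k _ => hmer k) hg.meromorphicAt,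
        res_of_analyticAt hg, add_zero, res_sum _ fun k _ => hmer k,
        circleIntegral.integral_fun_sum, Finset.mul_sum]
      · refine Finset.sum_congr rfl fun k _ => ?_
        rw [res_const_mul _ (meromorphicAt_sub_inv_pow s _), circleIntegral.integral_const_mul,
          res_sub_inv_pow]
        rcases k with _ | k
        · simp only [zero_add, pow_one]
          rw [circleIntegral.integral_sub_inv_of_mem_ball (hS s hs)]
          simp only [if_true]
          ring
        · rw [circleIntegral_sub_inv_pow_succ_succ]
          simp
      · intro k _
        refine ContinuousOn.circleIntegrable hR.le fun t ht => ?_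
        refine (han k t ?_).continuousAt.continuousWithinAt
        rintro rfl
        have h1 : dist t 0 < R := hS t hs
        have h2 : dist t 0 = R := ht
        exact h1.ne h2
    · filter_upwards [e] with t ht
      rw [ht]; ring
  choose p hp using hpp
  have hint : ∀ s ∈ S, CircleIntegrable (p s) 0 R := by
    intro s hs
    refine ContinuousOn.circleIntegrable hR.le fun t ht => ?_
    refine ((hp s hs).1 t ?_).continuousAt.continuousWithinAt
    rintro rfl
    have h1 : dist t 0 < R := hS t hs
    have h2 : dist t 0 = R := ht
    exact h1.ne h2
  obtain ⟨hFi, hF⟩ := circleIntegral_eq_zero_of_removable (F := fun t => f t - ∑ s ∈ S, p s t) hR (by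
    intro t ht
    by_cases hts : t ∈ S
    · obtain ⟨-, -, g, hg, e⟩ := hp t hts
      refine ⟨fun u => g u - ∑ s ∈ S.erase t, p s u, hg.fun_sub (Finset.analyticAt_fun_sum _ fun s hs =>
        (hp s (Finset.mem_of_mem_erase hs)).1 t (Finset.ne_of_mem_erase hs).symm), ?_⟩
      filter_upwards [e] with u hu
      rw [← hu, ← Finset.add_sum_erase _ _ hts]
      ring
    · obtain ⟨g, hg, e⟩ := hreg t ht hts
      refine ⟨fun u => g u - ∑ s ∈ S, p s u, hg.fun_sub (Finset.analyticAt_fun_sum _ fun s hs =>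
        (hp s hs).1 t (by rintro rfl; exact hts hs)), ?_⟩
      filter_upwards [e] with u hu
      rw [← hu])
  have hsum : CircleIntegrable (fun t => ∑ s ∈ S, p s t) 0 R := by
    convert! CircleIntegrable.sum S hint using 1
    ext t
    simp
  have hf : f = fun t => (f t - ∑ s ∈ S, p s t) + ∑ s ∈ S, p s t := by ext t; ring
  constructor
  · rw [hf]
    exact hFi.add hsum
  · conv_lhs => rw [hf]
    rw [circleIntegral.integral_add hFi hsum, hF, zero_add, circleIntegral.integral_fun_sum hint,
      Finset.mul_sum]
    exact Finset.sum_congr rfl fun s hs => (hp s hs).2.1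

/-- `t ↦ Res_{s = c} G(t, s) f(s)` is continuous. -/
theorem continuousAt_res_mul {G : ℂ × ℂ → ℂ} {f : ℂ → ℂ} {a c : ℂ} (hG : AnalyticAt ℂ G (a, c))
    (hf : MeromorphicAt f c) : ContinuousAt (fun t => res (fun s => G (t, s) * f s) c) a := by
  obtain ⟨R₁, hR₁, hf⟩ := hf.exists_differentiableOn
  obtain ⟨R₂, hR₂, hG⟩ := Metric.eventually_nhds_iff_ball.1 hG.eventually_analyticAt
  set R := min R₁ R₂
  have hR : 0 < R := lt_min hR₁ hR₂
  have hG' : ∀ t ∈ ball a R, ∀ s ∈ ball c R, AnalyticAt ℂ G (t, s) := fun t ht s hs =>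
    hG _ (by
      rw [← ball_prod_same]
      exact ⟨ball_subset_ball (min_le_right _ _) ht, ball_subset_ball (min_le_right _ _) hs⟩)
  have hres : ∀ t ∈ ball a R, res (fun s => G (t, s) * f s) c =
      (2 * Real.pi * Complex.I)⁻¹ * ∮ s in C(c, R / 2), G (t, s) * f s := by
    intro t ht
    refine res_eq_circleIntegral (R := R) (fun s hs => ?_) (half_pos hR) (half_lt_self hR)
    refine DifferentiableWithinAt.mul (DifferentiableAt.differentiableWithinAt ?_)
      ((hf s ⟨ball_subset_ball (min_le_left _ _) hs.1, hs.2⟩).mono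
        (sdiff_subset_sdiff_left (ball_subset_ball (min_le_left _ _))))
    exact (hG' t ht s hs.1).differentiableAt.comp s
      (by fun_prop : DifferentiableAt ℂ (fun s : ℂ => (t, s)) s)
  have hmem : ∀ θ : ℝ, circleMap c (R / 2) θ ∈ ball c R \ {c} := fun θ =>
    ⟨closedBall_subset_ball (half_lt_self hR) (circleMap_mem_closedBall c (half_pos hR).le θ), circleMap_ne_center (half_pos hR).ne'⟩
  have hcont : ContinuousOn (fun t => (2 * Real.pi * Complex.I)⁻¹ *
      ∮ s in C(c, R / 2), G (t, s) * f s) (ball a R) := by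
    refine ContinuousOn.mul continuousOn_const ?_
    rw [continuousOn_iff_continuous_domRestrict]
    unfold circleIntegral
    refine intervalIntegral.continuous_parametric_intervalIntegral_of_continuous' (f := fun (t : ball a R) θ =>
      deriv (circleMap c (R / 2)) θ • (G (t, circleMap c (R / 2) θ) * f (circleMap c (R / 2) θ))) ?_ _ _
    simp only [Function.uncurry_def, deriv_circleMap]
    have hcm : Continuous fun q : ball a R × ℝ => circleMap 0 (R / 2) q.2 :=
      (continuous_circleMap 0 (R / 2)).comp continuous_snd
    have hcm' : Continuous fun q : ball a R × ℝ => circleMap c (R / 2) q.2 :=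
      (continuous_circleMap c (R / 2)).comp continuous_snd
    refine Continuous.smul (hcm.mul continuous_const) (Continuous.mul ?_ ?_)
    · refine continuous_iff_continuousAt.2 fun q => ?_
      have h1 := (hG' q.1 q.1.2 _ (hmem q.2).1).continuousAt
      exact ContinuousAt.comp (f := fun q : ball a R × ℝ => ((q.1 : ℂ), circleMap c (R / 2) q.2)) h1
        (by fun_prop)
    · refine continuous_iff_continuousAt.2 fun q => ?_
      have h1 : ContinuousAt f (circleMap c (R / 2) q.2) :=
        (hf.differentiableAt ((isOpen_ball.sdiff isClosed_singleton).mem_nhds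
          ⟨ball_subset_ball (min_le_left _ _) (hmem q.2).1, (hmem q.2).2⟩)).continuousAt
      exact ContinuousAt.comp (f := fun q : ball a R × ℝ => circleMap c (R / 2) q.2) h1 (by fun_prop)
  refine (hcont.continuousAt (ball_mem_nhds a hR)).congr ?_
  filter_upwards [ball_mem_nhds a hR] with t ht using (hres t ht).symm

/-- Pairing with the Cauchy kernel reproduces a principal part, one term at a time. -/
theorem res_sub_inv_pow_mul_inv_sub {c t : ℂ} (ht : t ≠ c) (k : ℕ) :
    res (fun s => (s - c)⁻¹ ^ (k + 1) * (t - s)⁻¹) c = (t - c)⁻¹ ^ (k + 1) := by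
  have htc : t - c ≠ 0 := sub_ne_zero.2 ht
  have han : AnalyticAt ℂ (fun s => (t - s)⁻¹) c := (analyticAt_const.sub analyticAt_id).inv htc
  have hm : ∀ k, MeromorphicAt (fun s => (s - c)⁻¹ ^ k * (t - s)⁻¹) c := fun k =>
    (meromorphicAt_sub_inv_pow c k).fun_mul han.meromorphicAt
  have e : ∀ k, res (fun s => (s - c)⁻¹ ^ (k + 1) * (t - s)⁻¹) c = (t - c)⁻¹ *
      ((if k = 0 then 1 else 0) + res (fun s => (s - c)⁻¹ ^ k * (t - s)⁻¹) c) := by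
    intro k
    rw [← res_sub_inv_pow, ← res_add (meromorphicAt_sub_inv_pow c _) (hm k), ← res_const_mul _
      ((meromorphicAt_sub_inv_pow c _).fun_add (hm k))]
    apply res_congr
    filter_upwards [self_mem_nhdsWithin, (isOpen_ne.mem_nhds ht.symm : {s | s ≠ t} ∈ 𝓝 c) |>
      mem_nhdsWithin_of_mem_nhds] with s h1 h2
    have h1' : s - c ≠ 0 := sub_ne_zero.2 h1
    have h2' : t - s ≠ 0 := sub_ne_zero.2 (Ne.symm h2)
    rw [pow_succ]
    field_simp
    ring
  induction k with
  | zero =>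
    rw [e 0]
    simp [res_of_analyticAt han]
  | succ k ih =>
    rw [e (k + 1), ih, pow_succ' _ (k + 1)]
    simp

/-- The residue of `f(s) / (t - s)` at the pole `s = c` of `f` is the value at `t` of the principal
part of `f`; if it is bounded as `t → c`, the singularity is removable. -/
theorem exists_analyticAt_of_res_div_sub {f B : ℂ → ℂ} {c : ℂ} (hf : MeromorphicAt f c)
    (hB : ContinuousAt B c) (h : ∀ᶠ t in 𝓝[≠] c, res (fun s => f s * (t - s)⁻¹) c = B t) :
    ∃ g : ℂ → ℂ, AnalyticAt ℂ g c ∧ f =ᶠ[𝓝[≠] c] g := by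
  obtain ⟨N, a, g, hg, e⟩ := hf.exists_principalPart
  have key : ∀ t ≠ c, res (fun s => f s * (t - s)⁻¹) c =
      ∑ k ∈ Finset.range N, a k * (t - c)⁻¹ ^ (k + 1) := by
    intro t ht
    have htc : t - c ≠ 0 := sub_ne_zero.2 ht
    have han : AnalyticAt ℂ (fun s => (t - s)⁻¹) c := (analyticAt_const.sub analyticAt_id).inv htc
    have hm : ∀ k, MeromorphicAt (fun s => (s - c)⁻¹ ^ (k + 1) * (t - s)⁻¹) c := fun k =>
      (meromorphicAt_sub_inv_pow c _).fun_mul han.meromorphicAt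
    rw [res_congr (g := fun s => ∑ k ∈ Finset.range N, a k * ((s - c)⁻¹ ^ (k + 1) * (t - s)⁻¹) +
      g s * (t - s)⁻¹) (by
        filter_upwards [e] with s hs
        rw [hs, add_mul, Finset.sum_mul]
        simp only [mul_assoc]), res_add (MeromorphicAt.fun_sum fun k _ =>
        (MeromorphicAt.const _ _).fun_mul (hm k)) (hg.meromorphicAt.fun_mul han.meromorphicAt),
      res_of_analyticAt (hg.fun_mul han), add_zero, res_sum _ fun k _ =>
        (MeromorphicAt.const _ _).fun_mul (hm k)]
    refine Finset.sum_congr rfl fun k _ => ?_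
    rw [res_const_mul _ (hm k), res_sub_inv_pow_mul_inv_sub ht]
  refine hf.exists_analyticAt_of_bound (B := (‖B c‖ + 1) + (‖g c‖ + 1)) ?_
  filter_upwards [e, h, self_mem_nhdsWithin, ContinuousAt.eventually_norm_le hB,
    ContinuousAt.eventually_norm_le hg.continuousAt] with t h1 h2 h3 h4 h5
  rw [h1, ← key t h3, h2]
  exact (norm_add_le _ _).trans (add_le_add h4 h5)

/-- An injective holomorphic function has non-vanishing derivative: its inverse is continuous, and
holomorphic off the discrete set of critical values, hence holomorphic. -/
theorem deriv_ne_zero_of_injOn {f : ℂ → ℂ} {c : ℂ} (hf : AnalyticAt ℂ f c) {U : Set ℂ}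
    (hU : U ∈ 𝓝 c) (hinj : InjOn f U) : deriv f c ≠ 0 := by
  have hnc : ∀ t ∈ interior U, ¬ ∀ᶠ s in 𝓝 t, f s = f t := by
    intro t ht h
    have h1 := (h.filter_mono (nhdsWithin_le_nhds (s := {t}ᶜ))).and
      ((Eventually.filter_mono (nhdsWithin_le_nhds (s := {t}ᶜ))
        (isOpen_interior.eventually_mem ht)).and self_mem_nhdsWithin)
    obtain ⟨s, hs1, hs2, hs3⟩ := h1.exists
    exact hs3 (hinj (interior_subset hs2) (interior_subset ht) hs1)
  have hcU : c ∈ interior U := mem_interior_iff_mem_nhds.2 hU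
  have hd : ∀ᶠ t in 𝓝[≠] c, deriv f t ≠ 0 := by
    refine hf.deriv.eventually_eq_zero_or_eventually_ne_zero.resolve_left fun h0 => hnc c hcU ?_
    obtain ⟨R, hR, hb⟩ := Metric.eventually_nhds_iff_ball.1 (h0.and hf.eventually_analyticAt)
    filter_upwards [ball_mem_nhds c hR] with s hs
    exact (convex_ball c R).is_const_of_fderivWithin_eq_zero (𝕜 := ℂ)
      (fun z hz => (hb z hz).2.differentiableAt.differentiableWithinAt)
      (fun z hz => by
        rw [fderivWithin_of_isOpen isOpen_ball hz]
        ext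
        simpa using (hb z hz).1) hs (mem_ball_self hR)
  obtain ⟨R, hR, hb⟩ := Metric.eventually_nhds_iff_ball.1
    ((isOpen_interior.eventually_mem hcU).and (hf.eventually_analyticAt.and
      (eventually_nhdsWithin_iff.1 hd)))
  set V := ball c R
  have hVinj : InjOn f V := hinj.mono fun z hz => interior_subset (hb z hz).1
  have hopen : ∀ t ∈ V, 𝓝 (f t) ≤ map f (𝓝 t) := fun t ht =>
    (hb t ht).2.1.eventually_constant_or_nhds_le_map_nhds.resolve_left (hnc t (hb t ht).1)
  set h := Function.invFunOn f V
  have hleft : ∀ t ∈ V, h (f t) = t := fun t ht => hVinj.leftInvOn_invFunOn ht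
  have hcont : ∀ t ∈ V, ContinuousAt h (f t) := by
    intro t ht N hN
    rw [hleft t ht] at hN
    have h1 : f '' (N ∩ V) ∈ 𝓝 (f t) :=
      hopen t ht (image_mem_map (inter_mem hN (isOpen_ball.mem_nhds ht)))
    refine mem_map.2 (mem_of_superset h1 ?_)
    rintro _ ⟨s, hs, rfl⟩
    rw [mem_preimage, hleft s hs.2]
    exact hs.1
  have hcV : c ∈ V := mem_ball_self hR
  have han : AnalyticAt ℂ h (f c) := by
    refine Complex.analyticAt_of_differentiable_on_punctured_nhds_of_continuousAt ?_ (hcont c hcV)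
    have h1 : f '' V ∈ 𝓝 (f c) := hopen c hcV (image_mem_map (isOpen_ball.mem_nhds hcV))
    filter_upwards [mem_nhdsWithin_of_mem_nhds h1, self_mem_nhdsWithin] with w hw hwc
    obtain ⟨t, ht, rfl⟩ := hw
    have htc : t ≠ c := fun e => hwc (by rw [e]; rfl)
    refine (HasDerivAt.of_local_left_inverse (hcont t ht) (f := f) (f' := deriv f t) ?_
      ((hb t ht).2.2 htc) ?_).differentiableAt
    · rw [hleft t ht]
      exact (hb t ht).2.1.differentiableAt.hasDerivAt
    · have h2 : f '' V ∈ 𝓝 (f t) := hopen t ht (image_mem_map (isOpen_ball.mem_nhds ht))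
      filter_upwards [h2] with y hy
      obtain ⟨s, hs, rfl⟩ := hy
      rw [hleft s hs]
  intro h0
  have h1 : HasDerivAt (fun t => h (f t)) (deriv h (f c) * deriv f c) c :=
    han.differentiableAt.hasDerivAt.comp c hf.differentiableAt.hasDerivAt
  have h2 : HasDerivAt (fun t => h (f t)) 1 c := (hasDerivAt_id c).congr_of_eventuallyEq (by
    filter_upwards [isOpen_ball.mem_nhds hcV] with t ht using hleft t ht)
  have := h1.unique h2
  rw [h0, mul_zero] at this
  exact zero_ne_one this

/-- A holomorphic function of two variables has a primitive in the second one that depends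
holomorphically on the first. -/
theorem _root_.AnalyticAt.exists_primitive_right {G : ℂ × ℂ → ℂ} {a c : ℂ} (hG : AnalyticAt ℂ G (a, c)) :
    ∃ R > 0, ∃ H : ℂ → ℂ → ℂ, (∀ t ∈ ball a R, ∀ s ∈ ball c R, HasDerivAt (H t) (G (t, s)) s) ∧
      ∀ s ∈ ball c R, AnalyticAt ℂ (fun t => H t s) a := by
  obtain ⟨R, hR, hb⟩ := Metric.eventually_nhds_iff_ball.1 (hG.eventually_analyticAt.and
    (hG.fderiv.continuousAt.norm.eventually (gt_mem_nhds (lt_add_one _))))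
  set B := ‖fderiv ℂ G (a, c)‖ + 1
  have hb' : ∀ t ∈ ball a R, ∀ s ∈ ball c R, AnalyticAt ℂ G (t, s) ∧ ‖fderiv ℂ G (t, s)‖ < B :=
    fun t ht s hs => hb _ (by rw [← ball_prod_same]; exact ⟨ht, hs⟩)
  have hex : ∀ t : ℂ, ∃ P : ℂ → ℂ, t ∈ ball a R →
      P c = 0 ∧ ∀ s ∈ ball c R, HasDerivAt P (G (t, s)) s := by
    intro t
    by_cases ht : t ∈ ball a R
    · obtain ⟨P, hP, hP'⟩ := (DifferentiableOn.isExactOn_ball (c := c) (r := R)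
        (f := fun s => G (t, s)) fun s hs => ((hb' t ht s hs).1.differentiableAt.comp s
          (by fun_prop : DifferentiableAt ℂ (fun s : ℂ => (t, s)) s)).differentiableWithinAt).with_val_at c 0
      exact ⟨P, fun _ => ⟨hP, hP'⟩⟩
    · exact ⟨0, fun h => absurd h ht⟩
  choose H hH using hex
  refine ⟨R, hR, H, fun t ht => (hH t ht).2, fun s hs => ?_⟩
  have hseg : ∀ τ ∈ Icc (0 : ℝ) 1, c + τ * (s - c) ∈ ball c R := by
    intro τ hτ
    rw [mem_ball, dist_eq_norm] at hs ⊢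
    rw [add_sub_cancel_left, norm_mul, Complex.norm_real, Real.norm_of_nonneg hτ.1]
    exact lt_of_le_of_lt (mul_le_of_le_one_left (norm_nonneg _) hτ.2) hs
  -- an integral over a fixed segment, which may be differentiated in the parameter
  have hint : ∀ t ∈ ball a R, H t s = (s - c) * ∫ τ in (0 : ℝ)..1, G (t, c + τ * (s - c)) := by
    intro t ht
    have h1 : ∀ τ ∈ uIcc (0 : ℝ) 1, HasDerivAt (fun τ : ℝ => H t (c + τ * (s - c)))
        ((s - c) * G (t, c + τ * (s - c))) τ := by
      intro τ hτ
      rw [uIcc_of_le zero_le_one] at hτ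
      have h2 : HasDerivAt (fun τ : ℝ => c + (τ : ℂ) * (s - c)) (1 * (s - c)) τ :=
        (Complex.ofRealCLM.hasDerivAt.mul_const (s - c)).const_add c
      have := ((hH t ht).2 _ (hseg τ hτ)).comp_of_eq τ h2 rfl
      refine this.congr_deriv (by ring)
    rw [← intervalIntegral.integral_const_mul, intervalIntegral.integral_eq_sub_of_hasDerivAt h1]
    · simp [(hH t ht).1]
    · refine ContinuousOn.intervalIntegrable fun τ hτ => ?_
      rw [uIcc_of_le zero_le_one] at hτ
      refine ContinuousAt.continuousWithinAt (continuousAt_const.mul ?_)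
      exact ContinuousAt.comp (f := fun τ : ℝ => (t, c + (τ : ℂ) * (s - c)))
        (hb' t ht _ (hseg τ hτ)).1.continuousAt (by fun_prop)
  have hdiff : ∀ t ∈ ball a R, DifferentiableAt ℂ (fun t => ∫ τ in (0 : ℝ)..1, G (t, c + τ * (s - c))) t := by
    intro t ht
    have hcG : ∀ u ∈ ball a R, ContinuousOn (fun τ : ℝ => G (u, c + τ * (s - c))) (uIcc 0 1) := by
      intro u hu τ hτ
      rw [uIcc_of_le zero_le_one] at hτ
      refine ContinuousAt.continuousWithinAt ?_
      exact ContinuousAt.comp (f := fun τ : ℝ => (u, c + (τ : ℂ) * (s - c)))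
        (hb' u hu _ (hseg τ hτ)).1.continuousAt (by fun_prop)
    have hIoc : uIoc (0 : ℝ) 1 ⊆ uIcc 0 1 := uIoc_subset_uIcc
    refine (intervalIntegral.hasDerivAt_integral_of_dominated_loc_of_deriv_le
      (F := fun u τ => G (u, c + (τ : ℂ) * (s - c)))
      (F' := fun u τ => fderiv ℂ G (u, c + (τ : ℂ) * (s - c)) (1, 0)) (bound := fun _ => B * ‖((1 : ℂ), (0 : ℂ))‖)
      (isOpen_ball.mem_nhds ht) ?_ ?_ ?_ ?_ ?_ ?_).2.differentiableAt
    · filter_upwards [isOpen_ball.mem_nhds ht] with u hu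
      exact ((hcG u hu).mono hIoc).aestronglyMeasurable measurableSet_uIoc
    · exact (hcG t ht).intervalIntegrable
    · refine ContinuousOn.aestronglyMeasurable ?_ measurableSet_uIoc
      intro τ hτ
      have hτ' := hIoc hτ
      rw [uIcc_of_le zero_le_one] at hτ'
      refine ContinuousAt.continuousWithinAt (ContinuousAt.clm_apply ?_ continuousAt_const)
      exact ContinuousAt.comp (f := fun τ : ℝ => (t, c + (τ : ℂ) * (s - c)))
        (hb' t ht _ (hseg τ hτ')).1.fderiv.continuousAt (by fun_prop)
    · refine Eventually.of_forall fun τ hτ u hu => ?_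
      have hτ' := hIoc hτ
      rw [uIcc_of_le zero_le_one] at hτ'
      exact (ContinuousLinearMap.le_opNorm _ _).trans
        (mul_le_mul_of_nonneg_right (hb' u hu _ (hseg τ hτ')).2.le (norm_nonneg _))
    · exact intervalIntegrable_const
    · refine Eventually.of_forall fun τ hτ u hu => ?_
      have hτ' := hIoc hτ
      rw [uIcc_of_le zero_le_one] at hτ'
      have h1 : HasDerivAt (fun u : ℂ => (u, c + (τ : ℂ) * (s - c))) (1, 0) u :=
        (hasDerivAt_id u).prodMk (hasDerivAt_const _ _)
      exact (hb' u hu _ (hseg τ hτ')).1.differentiableAt.hasFDerivAt.comp_hasDerivAt u h1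
  have han : AnalyticAt ℂ (fun t => (s - c) * ∫ τ in (0 : ℝ)..1, G (t, c + τ * (s - c))) a :=
    analyticAt_const.mul (DifferentiableOn.analyticAt
      (fun t ht => (hdiff t ht).differentiableWithinAt) (ball_mem_nhds a hR))
  refine han.congr ?_
  filter_upwards [ball_mem_nhds a hR] with t ht using (hint t ht).symm

/-- The top coefficient of the Lagrange interpolation of a constant at two or more nodes vanishes. -/
theorem sum_prod_inv_sub_eq_zero {ι : Type*} [DecidableEq ι] {A : Finset ι} {v : ι → ℂ}
    (hv : InjOn v A) (hA : 2 ≤ A.card) :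
    ∑ i ∈ A, (∏ j ∈ A.erase i, (v j - v i))⁻¹ = 0 := by
  have h := Lagrange.coeff_eq_sum hv (P := Polynomial.C ((-1 : ℂ) ^ (A.card - 1))) (by
    refine lt_of_le_of_lt Polynomial.degree_C_le ?_
    exact_mod_cast (by omega : 0 < A.card))
  rw [Polynomial.coeff_C_of_ne_zero (by omega)] at h
  rw [h]
  refine Finset.sum_congr rfl fun i hi => ?_
  rw [Polynomial.eval_C, Finset.prod_congr rfl (g := fun j => (-1) * (v i - v j)) fun j _ => by ring,
    Finset.prod_mul_distrib, Finset.prod_const, Finset.card_erase_of_mem hi, mul_inv, div_eq_mul_inv,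
    ← inv_pow]
  norm_num

/-! ### Coordinate changes on a Riemann surface -/

section Charts

variable {X : Type*} [TopologicalSpace X] [ChartedSpace ℂ X]

theorem eventually_nhds_iff_chart (e : OpenPartialHomeomorph X ℂ) {p : X} (hp : p ∈ e.source)
    {P : X → Prop} : (∀ᶠ z in 𝓝 p, P z) ↔ ∀ᶠ t in 𝓝 (e p), P (e.symm t) := by
  have h := e.symm.map_nhds_eq (e.map_source hp)
  rw [e.left_inv hp] at h
  rw [← h, eventually_map]

theorem eventually_nhdsNE_iff_chart (e : OpenPartialHomeomorph X ℂ) {p : X} (hp : p ∈ e.source)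
    {P : X → Prop} : (∀ᶠ z in 𝓝[≠] p, P z) ↔ ∀ᶠ t in 𝓝[≠] (e p), P (e.symm t) := by
  rw [eventually_nhdsWithin_iff, eventually_nhdsWithin_iff, eventually_nhds_iff_chart e hp]
  refine eventually_congr ?_
  filter_upwards [e.open_target.mem_nhds (e.map_source hp)] with t ht
  have : e.symm t ≠ p ↔ t ≠ e p := by
    constructor
    · rintro h rfl; exact h (e.left_inv hp)
    · rintro h rfl; exact h (e.right_inv ht).symm
  simp only [mem_compl_iff, mem_singleton_iff]
  rw [← ne_eq, ← ne_eq, this]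

theorem nhdsNE_neBot (p : X) : (𝓝[≠] p).NeBot := by
  by_contra h
  rw [not_neBot] at h
  have : ∀ᶠ z in 𝓝[≠] p, False := by rw [h]; exact eventually_bot
  rw [eventually_nhdsNE_iff_chart (chartAt ℂ p) (mem_chart_source ℂ p)] at this
  exact this.exists.elim fun _ h => h

theorem deriv_symm_self {e : OpenPartialHomeomorph X ℂ} {t : ℂ} (ht : t ∈ e.target) : deriv (fun s => e (e.symm s)) t = 1 := by
  refine HasDerivAt.deriv ((hasDerivAt_id t).congr_of_eventuallyEq ?_)
  filter_upwards [e.open_target.mem_nhds ht] with s hs using e.right_inv hs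

theorem jac_chartAt_self (z : X) : jac (chartAt ℂ z) (chartAt ℂ z z) = 1 := by
  unfold jac
  rw [(chartAt ℂ z).left_inv (mem_chart_source ℂ z)]
  exact deriv_symm_self (mem_chart_target ℂ z)

theorem coeff_chartAt_self (φ : X → ℂ) (z : X) : coeff (chartAt ℂ z) φ (chartAt ℂ z z) = φ z := by
  unfold coeff
  rw [jac_chartAt_self, (chartAt ℂ z).left_inv (mem_chart_source ℂ z), mul_one]

variable [IsManifold 𝓘(ℂ) ⊤ X]

theorem chart_mem_atlas (p : X) : chartAt ℂ p ∈ IsManifold.maximalAtlas 𝓘(ℂ) ⊤ X :=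
  IsManifold.chart_mem_maximalAtlas p

variable {e e' : OpenPartialHomeomorph X ℂ}

theorem analyticAt_transition (he : e ∈ IsManifold.maximalAtlas 𝓘(ℂ) ⊤ X)
    (he' : e' ∈ IsManifold.maximalAtlas 𝓘(ℂ) ⊤ X) {t : ℂ} (ht : t ∈ e.target)
    (ht' : e.symm t ∈ e'.source) : AnalyticAt ℂ (fun s => e' (e.symm s)) t := by
  have h := (contDiffGroupoid ⊤ 𝓘(ℂ)).compatible_of_mem_maximalAtlas he he'
  rw [contDiffGroupoid, mem_groupoid_of_pregroupoid] at h
  have h1 := h.1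
  simp only [contDiffPregroupoid, modelWithCornersSelf_coe, modelWithCornersSelf_coe_symm,
    Function.id_comp, Function.comp_id, range_id, inter_univ, preimage_id] at h1
  have hmem : t ∈ (e.symm.trans e').source := by
    rw [OpenPartialHomeomorph.trans_source]
    exact ⟨ht, ht'⟩
  exact (h1.contDiffAt ((e.symm.trans e').open_source.mem_nhds hmem)).analyticAt

theorem deriv_transition_comp (he : e ∈ IsManifold.maximalAtlas 𝓘(ℂ) ⊤ X)
    (he' : e' ∈ IsManifold.maximalAtlas 𝓘(ℂ) ⊤ X) {t : ℂ} (ht : t ∈ e.target)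
    (ht' : e.symm t ∈ e'.source) {F : ℂ → ℂ} {a : ℂ} (hF : HasDerivAt F a (e' (e.symm t))) :
    HasDerivAt (fun s => F (e' (e.symm s))) (a * deriv (fun s => e' (e.symm s)) t) t :=
  hF.comp t (analyticAt_transition he he' ht ht').differentiableAt.hasDerivAt

theorem eventually_mem_target (e : OpenPartialHomeomorph X ℂ) {t : ℂ} (ht : t ∈ e.target)
    {V : Set X} (hV : IsOpen V) (htV : e.symm t ∈ V) : ∀ᶠ s in 𝓝 t, s ∈ e.target ∧ e.symm s ∈ V :=
  (e.open_target.eventually_mem ht).and ((e.continuousAt_symm ht).eventually (hV.mem_nhds htV))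

theorem deriv_transition_mul (he : e ∈ IsManifold.maximalAtlas 𝓘(ℂ) ⊤ X)
    (he' : e' ∈ IsManifold.maximalAtlas 𝓘(ℂ) ⊤ X) {e'' : OpenPartialHomeomorph X ℂ}
    (he'' : e'' ∈ IsManifold.maximalAtlas 𝓘(ℂ) ⊤ X) {t : ℂ} (ht : t ∈ e.target)
    (ht' : e.symm t ∈ e'.source) (ht'' : e.symm t ∈ e''.source) :
    deriv (fun s => e'' (e.symm s)) t =
      deriv (fun s => e'' (e'.symm s)) (e' (e.symm t)) * deriv (fun s => e' (e.symm s)) t := by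
  have h1 : HasDerivAt (fun s => e'' (e'.symm s)) _ (e' (e.symm t)) :=
    (analyticAt_transition he' he'' (e'.map_source ht')
      (by rwa [e'.left_inv ht'])).differentiableAt.hasDerivAt
  refine HasDerivAt.deriv ((deriv_transition_comp he he' ht ht' h1).congr_of_eventuallyEq ?_)
  filter_upwards [eventually_mem_target e ht e'.open_source ht'] with s hs
  rw [e'.left_inv hs.2]

theorem deriv_transition_ne_zero (he : e ∈ IsManifold.maximalAtlas 𝓘(ℂ) ⊤ X)
    (he' : e' ∈ IsManifold.maximalAtlas 𝓘(ℂ) ⊤ X) {t : ℂ} (ht : t ∈ e.target)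
    (ht' : e.symm t ∈ e'.source) : deriv (fun s => e' (e.symm s)) t ≠ 0 := by
  have h := deriv_transition_mul he he' he ht ht' (e.map_target ht)
  rw [deriv_symm_self ht] at h
  exact right_ne_zero_of_mul (h ▸ one_ne_zero)

theorem jac_ne_zero (he : e ∈ IsManifold.maximalAtlas 𝓘(ℂ) ⊤ X) {t : ℂ} (ht : t ∈ e.target) :
    jac e t ≠ 0 :=
  deriv_transition_ne_zero he (chart_mem_atlas _) ht (mem_chart_source ℂ _)

theorem jac_eq_mul (he : e ∈ IsManifold.maximalAtlas 𝓘(ℂ) ⊤ X)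
    (he' : e' ∈ IsManifold.maximalAtlas 𝓘(ℂ) ⊤ X) {t : ℂ} (ht : t ∈ e.target)
    (ht' : e.symm t ∈ e'.source) :
    jac e t = jac e' (e' (e.symm t)) * deriv (fun s => e' (e.symm s)) t := by
  unfold jac
  rw [deriv_transition_mul he he' (chart_mem_atlas (e.symm t)) ht ht' (mem_chart_source ℂ _),
    e'.left_inv ht']

theorem coeff_eq_mul (he : e ∈ IsManifold.maximalAtlas 𝓘(ℂ) ⊤ X)
    (he' : e' ∈ IsManifold.maximalAtlas 𝓘(ℂ) ⊤ X) (φ : X → ℂ) {t : ℂ} (ht : t ∈ e.target)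
    (ht' : e.symm t ∈ e'.source) :
    coeff e φ t = coeff e' φ (e' (e.symm t)) * deriv (fun s => e' (e.symm s)) t := by
  unfold coeff
  rw [jac_eq_mul he he' ht ht', e'.left_inv ht', mul_assoc]

/-- The derivative at `z` of the function `f` is the value at `z` of the `1`-form `φ`. -/
def HasPrimAt (f φ : X → ℂ) (z : X) : Prop :=
  HasDerivAt (fun t => f ((chartAt ℂ z).symm t)) (φ z) (chartAt ℂ z z)

theorem hasPrimAt_iff (he : e ∈ IsManifold.maximalAtlas 𝓘(ℂ) ⊤ X) {f φ : X → ℂ} {t : ℂ}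
    (ht : t ∈ e.target) :
    HasPrimAt f φ (e.symm t) ↔ HasDerivAt (fun s => f (e.symm s)) (coeff e φ t) t := by
  set z := e.symm t
  have hz : z ∈ e.source := e.map_target ht
  constructor
  · intro h
    refine (deriv_transition_comp he (chart_mem_atlas z) ht (mem_chart_source ℂ z) h).congr_of_eventuallyEq ?_
    filter_upwards [eventually_mem_target e ht (chartAt ℂ z).open_source (mem_chart_source ℂ z)] with s hs
    rw [(chartAt ℂ z).left_inv hs.2]
  · intro h
    unfold HasPrimAt
    have h0 : (chartAt ℂ z).symm (chartAt ℂ z z) ∈ e.source := by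
      rwa [(chartAt ℂ z).left_inv (mem_chart_source ℂ z)]
    have ht0 : e ((chartAt ℂ z).symm (chartAt ℂ z z)) = t := by
      rw [(chartAt ℂ z).left_inv (mem_chart_source ℂ z), e.right_inv ht]
    rw [← ht0] at h
    have h1 := deriv_transition_comp (chart_mem_atlas z) he (mem_chart_target ℂ z) h0 h
    rw [← coeff_eq_mul (chart_mem_atlas z) he φ (mem_chart_target ℂ z) h0, coeff_chartAt_self] at h1
    refine h1.congr_of_eventuallyEq ?_
    filter_upwards [eventually_mem_target _ (mem_chart_target ℂ z) e.open_source h0] with s hs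
    rw [e.left_inv hs.2]

theorem coeff_eventuallyEq (he : e ∈ IsManifold.maximalAtlas 𝓘(ℂ) ⊤ X)
    (he' : e' ∈ IsManifold.maximalAtlas 𝓘(ℂ) ⊤ X) (φ : X → ℂ) {p : X} (hp : p ∈ e.source)
    (hp' : p ∈ e'.source) : coeff e φ =ᶠ[𝓝 (e p)] fun t =>
      coeff e' φ (e' (e.symm t)) * deriv (fun s => e' (e.symm s)) t := by
  filter_upwards [eventually_mem_target e (e.map_source hp) e'.open_source
    (by rwa [e.left_inv hp])] with t ht using coeff_eq_mul he he' φ ht.1 ht.2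

theorem meromorphicAt_coeff_of (he : e ∈ IsManifold.maximalAtlas 𝓘(ℂ) ⊤ X)
    (he' : e' ∈ IsManifold.maximalAtlas 𝓘(ℂ) ⊤ X) {φ : X → ℂ} {p : X} (hp : p ∈ e.source)
    (hp' : p ∈ e'.source) (h : MeromorphicAt (coeff e' φ) (e' p)) :
    MeromorphicAt (coeff e φ) (e p) := by
  have han := analyticAt_transition he he' (e.map_source hp) (by rwa [e.left_inv hp])
  refine MeromorphicAt.congr ?_
    ((coeff_eventuallyEq he he' φ hp hp').symm.filter_mono nhdsWithin_le_nhds)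
  exact (MeromorphicAt.comp_analyticAt (g := fun t => e' (e.symm t))
    (by rwa [e.left_inv hp]) han).fun_mul han.deriv.meromorphicAt

theorem residueAt_eq (he : e ∈ IsManifold.maximalAtlas 𝓘(ℂ) ⊤ X) {φ : X → ℂ} {p : X}
    (hp : p ∈ e.source) (h : MeromorphicAt (coeff e φ) (e p)) :
    residueAt φ p = res (coeff e φ) (e p) := by
  have hc := chart_mem_atlas (X := X) p
  have hp' := mem_chart_source ℂ p
  have hpe : (chartAt ℂ p).symm (chartAt ℂ p p) ∈ e.source := by
    rwa [(chartAt ℂ p).left_inv hp']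
  have h0 : e ((chartAt ℂ p).symm (chartAt ℂ p p)) = e p := by rw [(chartAt ℂ p).left_inv hp']
  unfold residueAt
  rw [res_congr ((coeff_eventuallyEq hc he φ hp' hp).filter_mono nhdsWithin_le_nhds)]
  have := res_comp_mul_deriv_of_deriv_ne_zero (f := coeff e φ) (ψ := fun t => e ((chartAt ℂ p).symm t))
    (c := chartAt ℂ p p) (by rwa [h0]) (analyticAt_transition hc he (mem_chart_target ℂ p) hpe)
    (deriv_transition_ne_zero hc he (mem_chart_target ℂ p) hpe)
  rwa [h0] at this

/-- A local expression of a function on a Riemann surface is analytic in every chart once it is so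
in one. -/
theorem analyticAt_comp_symm_of (he : e ∈ IsManifold.maximalAtlas 𝓘(ℂ) ⊤ X)
    (he' : e' ∈ IsManifold.maximalAtlas 𝓘(ℂ) ⊤ X) {f : X → ℂ} {p : X} (hp : p ∈ e.source)
    (hp' : p ∈ e'.source) (h : AnalyticAt ℂ (fun t => f (e'.symm t)) (e' p)) :
    AnalyticAt ℂ (fun t => f (e.symm t)) (e p) := by
  have han := analyticAt_transition he he' (e.map_source hp) (by rwa [e.left_inv hp])
  refine AnalyticAt.congr (AnalyticAt.comp_of_eq (f := fun t => e' (e.symm t)) h han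
    (by rw [e.left_inv hp])) ?_
  filter_upwards [eventually_mem_target e (e.map_source hp) e'.open_source
    (by rwa [e.left_inv hp])] with t ht
  simp only [Function.comp]
  rw [e'.left_inv ht.2]

end Charts

/-! ### Primitives of closed forms without periods -/

section Curves

variable {X : Type*} [TopologicalSpace X] [ChartedSpace ℂ X]

/-- The curve `γ` is of class `C¹` at `t`. -/
def C1At (γ : ℝ → X) (t : ℝ) : Prop :=
  ContinuousAt γ t ∧ ContDiffAt ℝ 1 (fun s => chartAt ℂ (γ t) (γ s)) t

/-- The integrand of the integral of the `1`-form `φ` along the curve `γ`. -/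
noncomputable def curvePullback (γ : ℝ → X) (φ : X → ℂ) (t : ℝ) : ℂ :=
  φ (γ t) * deriv (fun s => chartAt ℂ (γ t) (γ s)) t

theorem c1At_iff_contMDiffAt {γ : ℝ → X} {t : ℝ} :
    ContMDiffAt 𝓘(ℝ, ℝ) 𝓘(ℝ, ℂ) 1 γ t ↔ C1At γ t := by
  rw [contMDiffAt_iff, C1At]
  simp only [mfld_simps, contDiffWithinAt_univ, Function.comp_def]
  rfl

theorem C1At.congr {γ δ : ℝ → X} {t : ℝ} (h : C1At γ t) (e : δ =ᶠ[𝓝 t] γ) : C1At δ t := by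
  refine ⟨h.1.congr e.symm, h.2.congr_of_eventuallyEq ?_⟩
  filter_upwards [e] with s hs
  rw [hs, e.eq_of_nhds]

theorem curvePullback_congr {γ δ : ℝ → X} {t : ℝ} (φ : X → ℂ) (e : δ =ᶠ[𝓝 t] γ) :
    curvePullback δ φ t = curvePullback γ φ t := by
  unfold curvePullback
  rw [e.eq_of_nhds]
  congr 1
  apply EventuallyEq.deriv_eq
  filter_upwards [e] with s hs
  rw [hs]

theorem c1At_const (z : X) (t : ℝ) : C1At (fun _ => z) t := ⟨continuousAt_const, contDiffAt_const⟩

theorem C1At.comp_affine {γ : ℝ → X} {a b t : ℝ} (h : C1At γ (a * t + b)) :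
    C1At (fun s => γ (a * s + b)) t := by
  have hc : ContDiff ℝ 1 fun s : ℝ => a * s + b := by fun_prop
  exact ⟨ContinuousAt.comp (f := fun s : ℝ => a * s + b) h.1 hc.continuous.continuousAt,
    ContDiffAt.comp (f := fun s : ℝ => a * s + b) t h.2 hc.contDiffAt⟩

theorem curvePullback_comp_affine {γ : ℝ → X} (φ : X → ℂ) {a b t : ℝ} (h : C1At γ (a * t + b)) :
    curvePullback (fun s => γ (a * s + b)) φ t = a * curvePullback γ φ (a * t + b) := by
  unfold curvePullback
  have h1 := (h.2.differentiableAt one_ne_zero).hasDerivAt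
  have h2 : HasDerivAt (fun s : ℝ => a * s + b) a t := by
    simpa using ((hasDerivAt_id t).const_mul a).add_const b
  have h3 := HasDerivAt.scomp (g₁ := fun s => chartAt ℂ (γ (a * t + b)) (γ s))
    (h := fun s : ℝ => a * s + b) t h1 h2
  simp only [Function.comp_def] at h3
  rw [h3.deriv, Complex.real_smul]
  ring

/-- The chain rule for a primitive along a curve. -/
theorem HasPrimAt.hasDerivAt_comp {f φ : X → ℂ} {γ : ℝ → X} {t : ℝ} (h : HasPrimAt f φ (γ t))
    (hγ : C1At γ t) : HasDerivAt (fun s => f (γ s)) (curvePullback γ φ t) t := by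
  have h1 := (hγ.2.differentiableAt one_ne_zero).hasDerivAt
  have h2 : HasDerivAt (fun u => f ((chartAt ℂ (γ t)).symm u)) (φ (γ t)) (chartAt ℂ (γ t) (γ t)) := h
  refine (HasDerivAt.comp (h := fun s => chartAt ℂ (γ t) (γ s)) t h2 h1).congr_of_eventuallyEq ?_
  filter_upwards [hγ.1.eventually ((chartAt ℂ (γ t)).open_source.mem_nhds (mem_chart_source ℂ _))] with s hs
  simp only [Function.comp]
  rw [(chartAt ℂ (γ t)).left_inv hs]

/-- `a` is the integral of the `1`-form `φ` along some `C¹` curve in `V` from `z` to `z'` that is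
constant near its ends. (The function `F` is the integral along the initial part of the curve.) -/
def JoinedWith (V : Set X) (φ : X → ℂ) (z z' : X) (a : ℂ) : Prop :=
  ∃ (γ : ℝ → X) (F : ℝ → ℂ) (T : ℝ), 0 < T ∧ (∀ t, γ t ∈ V ∧ C1At γ t ∧ ContDiffAt ℝ 1 F t ∧
    HasDerivAt F (curvePullback γ φ t) t) ∧ (∀ t ≤ 0, γ t = z ∧ F t = 0) ∧ ∀ t ≥ T, γ t = z' ∧ F t = a

variable {V : Set X} {φ : X → ℂ}

theorem JoinedWith.refl {z : X} (hz : z ∈ V) : JoinedWith V φ z z 0 :=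
  ⟨fun _ => z, fun _ => 0, 1, one_pos, fun t => ⟨hz, c1At_const z t, contDiffAt_const, by
    simpa [curvePullback] using hasDerivAt_const t (0 : ℂ)⟩, fun _ _ => ⟨rfl, rfl⟩, fun _ _ => ⟨rfl, rfl⟩⟩

theorem JoinedWith.symm {z z' : X} {a : ℂ} (h : JoinedWith V φ z z' a) : JoinedWith V φ z' z (-a) := by
  obtain ⟨γ, F, T, hT, h, h0, h1⟩ := h
  refine ⟨fun t => γ (-1 * t + T), fun t => F (-1 * t + T) - a, T, hT, fun t => ?_, fun t ht => ?_, fun t ht => ?_⟩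
  · obtain ⟨ha, hb, hc, hd⟩ := h (-1 * t + T)
    have h2 : HasDerivAt (fun s : ℝ => -1 * s + T) (-1) t := by
      simpa using ((hasDerivAt_id t).const_mul (-1)).add_const T
    refine ⟨ha, hb.comp_affine, ?_, ?_⟩
    · exact (ContDiffAt.comp (f := fun s : ℝ => -1 * s + T) t hc (by fun_prop)).sub contDiffAt_const
    · rw [curvePullback_comp_affine φ hb]
      simpa using (hd.scomp t h2).sub_const a
  · have := h1 (-1 * t + T) (by linarith)
    exact ⟨this.1, by simp only [this.2, sub_self]⟩
  · have := h0 (-1 * t + T) (by linarith)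
    exact ⟨this.1, by simp only [this.2, zero_sub]⟩

theorem JoinedWith.trans {z z' z'' : X} {a b : ℂ} (h : JoinedWith V φ z z' a)
    (h' : JoinedWith V φ z' z'' b) : JoinedWith V φ z z'' (a + b) := by
  obtain ⟨γ, F, T, hT, h, h0, h1⟩ := h
  obtain ⟨γ', F', T', hT', h', h0', h1'⟩ := h'
  set δ : ℝ → X := fun t => if t ≤ T + 1 then γ t else γ' (1 * t + -(T + 2))
  set G : ℝ → ℂ := fun t => if t ≤ T + 1 then F t else a + F' (1 * t + -(T + 2))
  have e1 : ∀ t < T + 2, δ t = γ t ∧ G t = F t := by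
    intro t ht
    by_cases h : t ≤ T + 1
    · simp [δ, G, h]
    · have h2 := h0' (1 * t + -(T + 2)) (by linarith)
      have h3 := h1 t (by linarith)
      simp only [δ, G, if_neg h, h2, h3, add_zero, and_self]
  have e2 : ∀ t > T, δ t = γ' (1 * t + -(T + 2)) ∧ G t = a + F' (1 * t + -(T + 2)) := by
    intro t ht
    by_cases h : t ≤ T + 1
    · have h2 := h0' (1 * t + -(T + 2)) (by linarith)
      have h3 := h1 t ht.le
      simp only [δ, G, if_pos h, h2, h3, add_zero, and_self]
    · simp [δ, G, h]
  refine ⟨δ, G, T + 2 + T', by positivity, fun t => ?_, fun t ht => ?_, fun t ht => ?_⟩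
  · rcases lt_or_ge t (T + 2) with ht | ht
    · have hev : ∀ᶠ s in 𝓝 t, δ s = γ s ∧ G s = F s := by
        filter_upwards [gt_mem_nhds ht] with s hs using e1 s hs
      have hδ : δ =ᶠ[𝓝 t] γ := hev.mono fun s hs => hs.1
      have hG : G =ᶠ[𝓝 t] F := hev.mono fun s hs => hs.2
      obtain ⟨ha, hb, hc, hd⟩ := h t
      exact ⟨by rwa [hδ.eq_of_nhds], hb.congr hδ, hc.congr_of_eventuallyEq hG, by
        rw [curvePullback_congr φ hδ]; exact hd.congr_of_eventuallyEq hG⟩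
    · have hev : ∀ᶠ s in 𝓝 t, δ s = γ' (1 * s + -(T + 2)) ∧ G s = a + F' (1 * s + -(T + 2)) := by
        filter_upwards [lt_mem_nhds (show T < t by linarith)] with s hs using e2 s hs
      have hδ : δ =ᶠ[𝓝 t] fun s => γ' (1 * s + -(T + 2)) := hev.mono fun s hs => hs.1
      have hG : G =ᶠ[𝓝 t] fun s => a + F' (1 * s + -(T + 2)) := hev.mono fun s hs => hs.2
      obtain ⟨ha, hb, hc, hd⟩ := h' (1 * t + -(T + 2))
      have h2 : HasDerivAt (fun s : ℝ => 1 * s + -(T + 2)) 1 t := by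
        simpa using (hasDerivAt_id t).add_const (-(T + 2))
      refine ⟨by rwa [hδ.eq_of_nhds], hb.comp_affine.congr hδ, ContDiffAt.congr_of_eventuallyEq ?_ hG, ?_⟩
      · exact contDiffAt_const.add (ContDiffAt.comp (f := fun s : ℝ => 1 * s + -(T + 2)) t hc (by fun_prop))
      · rw [curvePullback_congr φ hδ, curvePullback_comp_affine φ hb]
        refine HasDerivAt.congr_of_eventuallyEq ?_ hG
        simpa using (hd.scomp t h2).const_add a
  · have h2 := e1 t (by linarith)
    rw [h2.1, h2.2]
    exact h0 t ht
  · have h2 := e2 t (by linarith)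
    have h3 := h1' (1 * t + -(T + 2)) (by linarith)
    rw [h2.1, h2.2, h3.1, h3.2]
    exact ⟨rfl, rfl⟩

/-- A closed curve that is constant near its ends, as a loop. -/
theorem JoinedWith.exists_loop {z : X} {a : ℂ} (h : JoinedWith V φ z z a) :
    ∃ γ : Loop X, range γ.toFun ⊆ V ∧ γ.integral φ = a := by
  obtain ⟨γ, F, T, hT, h, h0, h1⟩ := h
  have hL : 0 < T + 2 := by linarith
  -- the curve on `[-1, T + 1]`, rescaled and extended periodically; it is constant near the seams
  set δ : ℝ → X := fun t => γ ((T + 2) * Int.fract t + -1)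
  have hconst : ∀ s : ℝ, s ≤ 0 ∨ T ≤ s → γ s = z := fun s hs =>
    hs.elim (fun h => (h0 s h).1) fun h => (h1 s h).1
  have hδ : ∀ (n : ℤ) (t : ℝ), n ≤ t → t ≤ n + 1 →
      δ =ᶠ[𝓝 t] fun s => γ ((T + 2) * s + (-1 - (T + 2) * n)) := by
    intro n t hn hn'
    have hw : (n : ℝ) - 1 / (T + 2) < t ∧ t < n + 1 + 1 / (T + 2) := by
      have : 0 < 1 / (T + 2) := by positivity
      constructor <;> linarith
    have hmul : (T + 2) * (1 / (T + 2)) = 1 := mul_one_div_cancel hL.ne'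
    have hlt : 1 / (T + 2) < 1 := (div_lt_one hL).2 (by linarith)
    filter_upwards [Ioo_mem_nhds hw.1 hw.2] with s hs
    rcases lt_or_ge s n with h2 | h2
    · have hf : Int.fract s = s - (n - 1) := by
        rw [Int.fract, (Int.floor_eq_iff (a := s) (z := n - 1)).2 ⟨by push_cast; linarith [hs.1], by push_cast; linarith⟩]
        push_cast; ring
      simp only [δ, hf]
      rw [hconst _ (Or.inr (by nlinarith [hs.1])), hconst _ (Or.inl (by nlinarith))]
    · rcases lt_or_ge s (n + 1) with h3 | h3
      · have hf : Int.fract s = s - n := by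
          rw [Int.fract, (Int.floor_eq_iff (a := s) (z := n)).2 ⟨h2, h3⟩]
        simp only [δ, hf]
        congr 1
        ring
      · have hf : Int.fract s = s - (n + 1) := by
          rw [Int.fract, (Int.floor_eq_iff (a := s) (z := n + 1)).2 ⟨by push_cast; linarith [hs.1], by push_cast; linarith [hs.2]⟩]
          push_cast; ring
        simp only [δ, hf]
        rw [hconst _ (Or.inl (by nlinarith [hs.2])), hconst _ (Or.inr (by nlinarith))]
  have hC1 : ∀ t, C1At δ t := fun t =>
    (C1At.comp_affine (h _).2.1).congr (hδ ⌊t⌋ t (Int.floor_le t) (Int.lt_floor_add_one t).le)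
  refine ⟨⟨δ, fun t => c1At_iff_contMDiffAt.2 (hC1 t), fun t => by simp only [δ, Int.fract_add_one]⟩, ?_, ?_⟩
  · rintro _ ⟨t, rfl⟩
    exact (h _).1
  · have hd : ∀ t ∈ uIcc (0 : ℝ) 1, HasDerivAt (fun s => F ((T + 2) * s + (-1 - (T + 2) * (0 : ℤ))))
        (curvePullback δ φ t) t := by
      intro t ht
      rw [uIcc_of_le zero_le_one] at ht
      obtain ⟨ha, hb, hc, hd⟩ := h ((T + 2) * t + (-1 - (T + 2) * (0 : ℤ)))
      have h2 : HasDerivAt (fun s : ℝ => (T + 2) * s + (-1 - (T + 2) * (0 : ℤ))) (T + 2) t := by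
        simpa using ((hasDerivAt_id t).const_mul (T + 2)).add_const (-1 - (T + 2) * (0 : ℤ))
      rw [curvePullback_congr φ (hδ 0 t (by simpa using ht.1) (by simpa using ht.2)),
        curvePullback_comp_affine φ hb]
      exact (hd.scomp t h2).congr_deriv (Complex.real_smul ..)
    have hF : ContDiff ℝ 1 fun s => F ((T + 2) * s + (-1 - (T + 2) * (0 : ℤ))) :=
      (contDiff_iff_contDiffAt.2 fun t => (h t).2.2.1).comp (by fun_prop)
    change (∫ t in (0 : ℝ)..1, curvePullback δ φ t) = a
    rw [intervalIntegral.integral_eq_sub_of_hasDerivAt hd]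
    · have h2 := h1 ((T + 2) * 1 + (-1 - (T + 2) * (0 : ℤ))) (by simp)
      have h3 := h0 ((T + 2) * 0 + (-1 - (T + 2) * (0 : ℤ))) (by simp)
      rw [h2.2, h3.2, sub_zero]
    · have hcont : Continuous (deriv fun s => F ((T + 2) * s + (-1 - (T + 2) * (0 : ℤ)))) :=
        hF.continuous_deriv le_rfl
      refine (hcont.continuousOn.congr fun t ht => ?_).intervalIntegrable
      exact (hd t ht).deriv.symm

variable [IsManifold 𝓘(ℂ) ⊤ X]

/-- Near a point where the form is holomorphic, it has a primitive, and nearby points are joined by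
short curves. -/
theorem exists_local_primitive_joined (hV : IsOpen V) {z : X} (hz : z ∈ V)
    (h : AnalyticAt ℂ (coeff (chartAt ℂ z) φ) (chartAt ℂ z z)) :
    ∃ f : X → ℂ, (∀ᶠ z' in 𝓝 z, HasPrimAt f φ z') ∧ ∀ᶠ z' in 𝓝 z, JoinedWith V φ z z' (f z' - f z) := by
  set e := chartAt ℂ z
  have he := chart_mem_atlas (X := X) z
  have hze : z ∈ e.source := mem_chart_source ℂ z
  obtain ⟨G, hG, hd⟩ := h.exists_hasDerivAt
  have hev := (eventually_mem_target e (e.map_source hze) hV (by rwa [e.left_inv hze])).and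
    (hd.and hG.eventually_analyticAt)
  obtain ⟨R, hR, hb⟩ := Metric.eventually_nhds_iff_ball.1 hev
  have hprim : ∀ t ∈ ball (e z) R, HasPrimAt (fun x => G (e x)) φ (e.symm t) := by
    intro t ht
    rw [hasPrimAt_iff he (hb t ht).1.1]
    refine (hb t ht).2.1.congr_of_eventuallyEq ?_
    filter_upwards [e.open_target.mem_nhds (hb t ht).1.1] with s hs
    rw [e.right_inv hs]
  refine ⟨fun x => G (e x), ?_, ?_⟩
  · rw [eventually_nhds_iff_chart e hze]
    filter_upwards [ball_mem_nhds (e z) hR] with t ht using hprim t ht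
  · rw [eventually_nhds_iff_chart e hze]
    filter_upwards [ball_mem_nhds (e z) hR] with w hw
    -- the segment from `e z` to `w`, traversed so that it rests at both ends
    set c : ℝ → ℂ := fun t => e z + (Real.smoothTransition t : ℂ) * (w - e z)
    have hc : ContDiff ℝ 1 c := by
      refine contDiff_const.add (ContDiff.mul ?_ contDiff_const)
      exact Complex.ofRealCLM.contDiff.comp Real.smoothTransition.contDiff
    have hcb : ∀ t, c t ∈ ball (e z) R := by
      intro t
      rw [mem_ball, dist_eq_norm] at hw ⊢
      simp only [c]
      rw [add_sub_cancel_left, norm_mul, Complex.norm_real, Real.norm_of_nonneg (Real.smoothTransition.nonneg t)]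
      exact lt_of_le_of_lt (mul_le_of_le_one_left (norm_nonneg _) (Real.smoothTransition.le_one t)) hw
    have hC1 : ∀ t, C1At (fun t => e.symm (c t)) t := by
      intro t
      have ht := (hb _ (hcb t)).1.1
      refine ⟨ContinuousAt.comp (f := c) (e.continuousAt_symm ht) hc.continuous.continuousAt, ?_⟩
      have h1 := (analyticAt_transition he (chart_mem_atlas (e.symm (c t))) ht
        (mem_chart_source ℂ _)).contDiffAt (n := 1)
      exact ContDiffAt.comp (f := c) t (h1.restrict_scalars ℝ) hc.contDiffAt
    refine ⟨fun t => e.symm (c t), fun t => G (e (e.symm (c t))) - G (e z), 1, one_pos,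
      fun t => ⟨(hb _ (hcb t)).1.2, hC1 t, ?_, ?_⟩, fun t ht => ?_, fun t ht => ?_⟩
    · have h1 := ((hb _ (hcb t)).2.2.contDiffAt (n := 1)).restrict_scalars ℝ
      refine ContDiffAt.congr_of_eventuallyEq ((ContDiffAt.comp (f := c) t h1 hc.contDiffAt).sub
        (contDiffAt_const (c := G (e z)))) (Eventually.of_forall fun s => ?_)
      simp only [Function.comp]
      rw [e.right_inv (hb _ (hcb s)).1.1]
    · exact (HasPrimAt.hasDerivAt_comp (f := fun x => G (e x)) (γ := fun t => e.symm (c t))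
        (hprim _ (hcb t)) (hC1 t)).sub_const _
    · simp only [c]
      rw [Real.smoothTransition.zero_of_nonpos ht]
      simp [e.left_inv hze]
    · simp only [c]
      rw [Real.smoothTransition.one_of_one_le ht]
      simp

/-- A holomorphic `1`-form on an open set all of whose integrals along loops vanish has a primitive. -/
theorem exists_primitive_of_loop_integral_eq_zero (hV : IsOpen V)
    (h : ∀ z ∈ V, AnalyticAt ℂ (coeff (chartAt ℂ z) φ) (chartAt ℂ z z))
    (hloop : ∀ γ : Loop X, range γ.toFun ⊆ V → γ.integral φ = 0) :
    ∃ f : X → ℂ, ∀ z ∈ V, HasPrimAt f φ z := by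
  classical
  have huniq : ∀ {z z' a b}, JoinedWith V φ z z' a → JoinedWith V φ z z' b → a = b := by
    intro z z' a b ha hb
    obtain ⟨γ, hγ, e⟩ := (ha.trans hb.symm).exists_loop
    rw [hloop γ hγ] at e
    linear_combination -e
  let S : Setoid V := ⟨fun z z' => ∃ a, JoinedWith V φ z z' a, fun z => ⟨0, .refl z.2⟩,
    fun ⟨a, h⟩ => ⟨-a, h.symm⟩, fun ⟨a, h⟩ ⟨b, h'⟩ => ⟨a + b, h.trans h'⟩⟩
  -- a base point in each arc component, and the integral from there
  let rep : V → V := fun z => (Quotient.mk S z).out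
  have hrep : ∀ z : V, ∃ a, JoinedWith V φ (rep z) z a := fun z =>
    Quotient.exact (s := S) (Quotient.out_eq (Quotient.mk S z))
  choose F hF using hrep
  refine ⟨fun z => if hz : z ∈ V then F ⟨z, hz⟩ else 0, fun z hz => ?_⟩
  obtain ⟨f, hf, hj⟩ := exists_local_primitive_joined hV hz (h z hz)
  have heq : ∀ᶠ z' in 𝓝 z, (if hz : z' ∈ V then F ⟨z', hz⟩ else 0) = f z' + (F ⟨z, hz⟩ - f z) := by
    filter_upwards [hj, hV.mem_nhds hz] with z' hj hz'
    rw [dif_pos hz']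
    have hr : rep ⟨z', hz'⟩ = rep ⟨z, hz⟩ := by
      have : Quotient.mk S ⟨z', hz'⟩ = Quotient.mk S ⟨z, hz⟩ := Quotient.sound ⟨_, hj.symm⟩
      simp only [rep, this]
    have h1 := hF ⟨z', hz'⟩
    rw [hr] at h1
    rw [huniq h1 ((hF ⟨z, hz⟩).trans hj)]
    ring
  rw [eventually_nhds_iff_chart (chartAt ℂ z) (mem_chart_source ℂ z)] at heq
  exact (HasDerivAt.add_const _ (hf.self_of_nhds : HasPrimAt f φ z)).congr_of_eventuallyEq heq

end Curves

/-! ### Primitives of `ω02` -/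

theorem isPreconnected_ball_sdiff_center (c : ℂ) (R : ℝ) : IsPreconnected (ball c R \ {c}) := by
  have h : ball c R \ {c} = (fun q : ℝ × ℝ => circleMap c q.1 q.2) '' (Ioo 0 R ×ˢ univ) := by
    ext z
    constructor
    · rintro ⟨hz, hzc⟩
      refine ⟨(‖z - c‖, (z - c).arg), ⟨⟨norm_pos_iff.2 (sub_ne_zero.2 hzc), ?_⟩, mem_univ _⟩, ?_⟩
      · rwa [mem_ball, dist_eq_norm] at hz
      · simp only [circleMap]
        rw [Complex.norm_mul_exp_arg_mul_I]
        ring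
    · rintro ⟨⟨r, θ⟩, ⟨⟨h0, h1⟩, -⟩, rfl⟩
      refine ⟨?_, circleMap_ne_center h0.ne'⟩
      rw [mem_ball, dist_eq_norm]
      simpa [circleMap, abs_of_pos h0] using h1
  rw [h]
  refine (isPreconnected_Ioo.prod isPreconnected_univ).image _ ?_
  unfold circleMap
  fun_prop

theorem eq_of_hasDerivAt_zero_punctured {h : ℂ → ℂ} {c : ℂ} {R : ℝ}
    (hd : ∀ s ∈ ball c R, s ≠ c → HasDerivAt h 0 s) {s s' : ℂ} (hs : s ∈ ball c R) (hsc : s ≠ c)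
    (hs' : s' ∈ ball c R) (hsc' : s' ≠ c) : h s = h s' :=
  (isOpen_ball.sdiff isClosed_singleton).is_const_of_deriv_eq_zero
    (isPreconnected_ball_sdiff_center c R)
    (fun z hz => (hd z hz.1 hz.2).differentiableAt.differentiableWithinAt)
    (fun z hz => (hd z hz.1 hz.2).deriv) ⟨hs, hsc⟩ ⟨hs', hsc'⟩

theorem eq_of_hasDerivAt_zero_ball {h : ℂ → ℂ} {c : ℂ} {R : ℝ}
    (hd : ∀ s ∈ ball c R, HasDerivAt h 0 s) {s s' : ℂ} (hs : s ∈ ball c R)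
    (hs' : s' ∈ ball c R) : h s = h s' :=
  isOpen_ball.is_const_of_deriv_eq_zero (convex_ball c R).isPreconnected
    (fun z hz => (hd z hz).differentiableAt.differentiableWithinAt)
    (fun z hz => (hd z hz).deriv) hs hs'

/-- A primitive of a meromorphic function on a punctured disc is meromorphic. -/
theorem meromorphicAt_of_hasDerivAt {f g : ℂ → ℂ} {c : ℂ} (hg : MeromorphicAt g c)
    (h : ∀ᶠ t in 𝓝[≠] c, HasDerivAt f (g t) t) : MeromorphicAt f c := by
  obtain ⟨Ψ, hΨ, hd⟩ := hg.exists_primitive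
  rw [res_of_hasDerivAt h] at hd
  have h2 := h.and hd
  rw [eventually_nhdsWithin_iff, Metric.eventually_nhds_iff_ball] at h2
  obtain ⟨R, hR, hb⟩ := h2
  have hd0 : ∀ s ∈ ball c R, s ≠ c → HasDerivAt (fun s => f s - Ψ s) 0 s := fun s hs hsc =>
    ((hb s hs hsc).1.sub (hb s hs hsc).2).congr_deriv (by ring)
  have hball : ∀ᶠ s in 𝓝[≠] c, s ∈ ball c R ∧ s ≠ c :=
    (eventually_mem_nhdsWithin.and (mem_nhdsWithin_of_mem_nhds (ball_mem_nhds c hR))).mono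
      fun s hs => ⟨hs.2, hs.1⟩
  obtain ⟨s₀, hs₀⟩ := hball.exists
  refine (hΨ.fun_add (MeromorphicAt.const (f s₀ - Ψ s₀) c)).congr ?_
  filter_upwards [hball] with s hs
  have := eq_of_hasDerivAt_zero_punctured hd0 hs.1 hs.2 hs₀.1 hs₀.2
  linear_combination -this

section

variable {X : Type*} [TopologicalSpace X] [ChartedSpace ℂ X]

theorem coeff₂_eq_mul (e e' : OpenPartialHomeomorph X ℂ) (φ : X → X → ℂ) (t s : ℂ) :
    coeff₂ e e' φ (t, s) = jac e t * coeff e' (φ (e.symm t)) s := by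
  unfold coeff₂ coeff
  ring

theorem coeff₂_chartAt_self (e' : OpenPartialHomeomorph X ℂ) (φ : X → X → ℂ) (p : X) (s : ℂ) :
    coeff₂ (chartAt ℂ p) e' φ (chartAt ℂ p p, s) = coeff e' (φ p) s := by
  rw [coeff₂_eq_mul, jac_chartAt_self, (chartAt ℂ p).left_inv (mem_chart_source ℂ p), one_mul]

variable [IsManifold 𝓘(ℂ) ⊤ X] {C : SpectralCurve X}

theorem analyticAt_coeff_ω02 (C : SpectralCurve X) {w₀ z : X} (h : w₀ ≠ z) :
    AnalyticAt ℂ (coeff (chartAt ℂ z) (C.ω02 w₀)) (chartAt ℂ z z) := by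
  have h1 := C.ω02_fundamental.off_diagonal w₀ z h
  have h2 : AnalyticAt ℂ (fun s : ℂ => (chartAt ℂ w₀ w₀, s)) (chartAt ℂ z z) := by fun_prop
  refine (AnalyticAt.comp_of_eq h1 h2 rfl).congr (Eventually.of_forall fun s => ?_)
  exact coeff₂_chartAt_self _ _ _ _

/-- If `α(w₀; z)` is a primitive in `z` of `ω02(w₀, z)`, then its increments along short arcs in `z`
are meromorphic in `w₀`. -/
theorem meromorphicAt_increment [T2Space X] {U : Set X} (hU : IsOpen U) {α : X → X → ℂ}
    (hα : ∀ w₀, ∀ z ∈ U, z ≠ w₀ → HasPrimAt (α w₀) (C.ω02 w₀) z) (p : X) {z : X} (hz : z ∈ U) :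
    ∃ W ∈ 𝓝 z, ∀ z' ∈ W, ∀ z'' ∈ W,
      MeromorphicAt (coeff (chartAt ℂ p) fun w₀ => α w₀ z' - α w₀ z'') (chartAt ℂ p p) := by
  set e := chartAt ℂ p
  set e' := chartAt ℂ z
  have hp : p ∈ e.source := mem_chart_source ℂ p
  have hz' : z ∈ e'.source := mem_chart_source ℂ z
  have he' := chart_mem_atlas (X := X) z
  have htgt : ∀ᶠ s in 𝓝 (e' z), s ∈ e'.target ∧ e'.symm s ∈ U :=
    eventually_mem_target e' (e'.map_source hz') hU (by rwa [e'.left_inv hz'])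
  have hcoeff : ∀ t z' z'', coeff e (fun w₀ => α w₀ z' - α w₀ z'') t =
      α (e.symm t) z' * jac e t - α (e.symm t) z'' * jac e t := by
    intro t z' z''
    unfold coeff
    ring
  have hder : ∀ t s, s ∈ e'.target → e'.symm s ∈ U → e'.symm s ≠ e.symm t →
      HasDerivAt (fun s => α (e.symm t) (e'.symm s) * jac e t) (coeff₂ e e' C.ω02 (t, s)) s := by
    intro t s hs hsU hne
    rw [coeff₂_eq_mul, mul_comm]
    exact HasDerivAt.mul_const ((hasPrimAt_iff he' hs).1 (hα _ _ hsU hne)) _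
  rcases eq_or_ne p z with rfl | hpz
  · -- near the diagonal the increments are those of `1 / (t - s)` plus a holomorphic function
    obtain ⟨G, hG, hd⟩ := C.ω02_fundamental.diagonal p
    obtain ⟨R₁, hR₁, H, hH, hHa⟩ := hG.exists_primitive_right
    obtain ⟨R₂, hR₂, hb₂⟩ := Metric.eventually_nhds_iff_ball.1 hd
    obtain ⟨R₃, hR₃, hb₃⟩ := Metric.eventually_nhds_iff_ball.1 htgt
    set R := min R₁ (min R₂ R₃)
    have hR : 0 < R := lt_min hR₁ (lt_min hR₂ hR₃)
    have key : ∀ t ∈ ball (e p) (R / 2), ∀ s ∈ ball t (R / 2), s ≠ t →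
        HasDerivAt (fun s => α (e.symm t) (e.symm s) * jac e t - (t - s)⁻¹ - H t s) 0 s := by
      intro t ht s hs hst
      have ht' : t ∈ ball (e p) R := ball_subset_ball (half_le_self hR.le) ht
      have hs' : s ∈ ball (e p) R := by
        rw [mem_ball] at *
        linarith [dist_triangle s t (e p)]
      have htR : t ∈ e.target := (hb₃ t (ball_subset_ball ((min_le_right _ _).trans (min_le_right _ _)) ht')).1
      have hsR := hb₃ s (ball_subset_ball ((min_le_right _ _).trans (min_le_right _ _)) hs')
      have h1 := hder t s hsR.1 hsR.2 fun h => hst (e.symm.injOn hsR.1 htR h)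
      have h2 := hb₂ (t, s) (ball_subset_ball ((min_le_right _ _).trans (min_le_left _ _))
        (by rw [← ball_prod_same]; exact ⟨ht', hs'⟩)) hst.symm
      have h3 := hH t (ball_subset_ball (min_le_left _ _) ht') s (ball_subset_ball (min_le_left _ _) hs')
      have h4 : HasDerivAt (fun s => (t - s)⁻¹) (-(-1) / (t - s) ^ 2) s :=
        ((hasDerivAt_id s).const_sub t).inv (sub_ne_zero.2 hst.symm)
      refine ((h1.sub h4).sub h3).congr_deriv ?_
      rw [h2]
      ring
    refine ⟨e.source ∩ e ⁻¹' ball (e p) (R / 4), e.continuousAt hp |>.preimage_mem_nhds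
      (ball_mem_nhds _ (by linarith)) |> inter_mem (e.open_source.mem_nhds hp), ?_⟩
    rintro z' ⟨hz's, hz'b⟩ z'' ⟨hz''s, hz''b⟩
    have hm : ∀ z' : X, MeromorphicAt (fun t : ℂ => (t - e z')⁻¹) (e p) := fun z' =>
      MeromorphicAt.inv (f := fun t : ℂ => t - e z') (AnalyticAt.meromorphicAt (by fun_prop))
    have hin : ∀ z', z' ∈ e ⁻¹' ball (e p) (R / 4) → AnalyticAt ℂ (fun t => H t (e z')) (e p) := fun z' h =>
      hHa _ (ball_subset_ball (by linarith [min_le_left R₁ (min R₂ R₃)]) h)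
    refine MeromorphicAt.congr (((hm z').fun_sub (hm z'')).fun_add
      ((hin z' hz'b).fun_sub (hin z'' hz''b)).meromorphicAt) ?_
    have hne : ∀ z' : X, ∀ᶠ t in 𝓝[≠] (e p), e z' ≠ t := by
      intro z'
      rcases eq_or_ne (e z') (e p) with h | h
      · filter_upwards [self_mem_nhdsWithin] with t ht
        rw [h]; exact Ne.symm ht
      · exact ((isOpen_ne.eventually_mem h.symm).filter_mono nhdsWithin_le_nhds).mono fun _ h => Ne.symm h
    filter_upwards [hne z', hne z'', mem_nhdsWithin_of_mem_nhds (ball_mem_nhds (e p) (by linarith : 0 < R / 4))]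
      with t h1 h2 ht
    have hmem : ∀ u ∈ ball (e p) (R / 4), u ∈ ball t (R / 2) := by
      intro u hu
      rw [mem_ball] at *
      linarith [dist_triangle_right u t (e p)]
    have := eq_of_hasDerivAt_zero_punctured (key t (ball_subset_ball (by linarith) ht))
      (hmem _ hz'b) h1 (hmem _ hz''b) h2
    rw [hcoeff t]
    simp only [e.left_inv hz's, e.left_inv hz''s] at this
    linear_combination -this
  · have hG := C.ω02_fundamental.off_diagonal p z hpz
    obtain ⟨R₁, hR₁, H, hH, hHa⟩ := hG.exists_primitive_right
    obtain ⟨O, O', hO, hO', hpO, hzO', hdisj⟩ := t2_separation hpz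
    have h3 := eventually_mem_target e' (e'.map_source hz') hO' (by rwa [e'.left_inv hz'])
    obtain ⟨R₃, hR₃, hb₃⟩ := Metric.eventually_nhds_iff_ball.1 (htgt.and h3)
    have h4 := eventually_mem_target e (e.map_source hp) hO (by rwa [e.left_inv hp])
    set R := min R₁ R₃
    have hR : 0 < R := lt_min hR₁ hR₃
    refine ⟨e'.source ∩ e' ⁻¹' ball (e' z) R, e'.continuousAt hz' |>.preimage_mem_nhds
      (ball_mem_nhds _ hR) |> inter_mem (e'.open_source.mem_nhds hz'), ?_⟩
    rintro z' ⟨hz's, hz'b⟩ z'' ⟨hz''s, hz''b⟩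
    refine MeromorphicAt.congr ((hHa _ (ball_subset_ball (min_le_left _ _) hz'b)).fun_sub
      (hHa _ (ball_subset_ball (min_le_left _ _) hz''b))).meromorphicAt ?_
    filter_upwards [mem_nhdsWithin_of_mem_nhds (ball_mem_nhds (e p) hR₁),
      h4.filter_mono nhdsWithin_le_nhds] with t ht ht'
    have key : ∀ s ∈ ball (e' z) R,
        HasDerivAt (fun s => α (e.symm t) (e'.symm s) * jac e t - H t s) 0 s := by
      intro s hs
      have h5 := hb₃ s (ball_subset_ball (min_le_right _ _) hs)
      have h1 := hder t s h5.1.1 h5.1.2 fun h => hdisj.le_bot ⟨ht'.2, h ▸ h5.2.2⟩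
      exact (h1.sub (hH t ht s (ball_subset_ball (min_le_left _ _) hs))).congr_deriv (sub_self _)
    have := eq_of_hasDerivAt_zero_ball key hz'b hz''b
    rw [hcoeff t]
    simp only [e'.left_inv hz's, e'.left_inv hz''s] at this
    linear_combination -this

/-- On a connected open set over which the integrals of `ω02` along loops vanish, `ω02` has a
primitive, normalised to vanish at a base point. -/
theorem exists_isPrimitive [T2Space X] {U : Set X} (hU : IsOpen U) (hconn : IsPreconnected U)
    (hper : ∀ γ : Loop X, range γ.toFun ⊆ U → ∀ w₀ ∉ range γ.toFun, γ.integral (C.ω02 w₀) = 0) :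
    ∃ α, IsPrimitive C U α := by
  rcases U.eq_empty_or_nonempty with rfl | ⟨z₁, hz₁⟩
  · exact ⟨fun _ _ => 0, by simp, by simp, by simp⟩
  have hex : ∀ w₀, ∃ f : X → ℂ, ∀ z ∈ U \ {w₀}, HasPrimAt f (C.ω02 w₀) z := fun w₀ =>
    exists_primitive_of_loop_integral_eq_zero (hU.sdiff isClosed_singleton)
      (fun z hz => analyticAt_coeff_ω02 C (Ne.symm hz.2))
      fun γ hγ => hper γ (hγ.trans sdiff_subset) w₀ fun h => (hγ h).2 rfl
  choose f hf using hex
  have hα : ∀ w₀, ∀ z ∈ U, z ≠ w₀ → HasPrimAt (fun z => f w₀ z - f w₀ z₁) (C.ω02 w₀) z :=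
    fun w₀ z hz hne => HasDerivAt.sub_const _ (hf w₀ z ⟨hz, hne⟩)
  refine ⟨fun w₀ z => f w₀ z - f w₀ z₁, ?_, ?_, hα⟩
  -- meromorphy in `w₀` spreads from the base point, where the primitive vanishes, by connectedness
  · intro z hz p
    have := hconn.induction₂' (fun z' z'' => MeromorphicAt (coeff (chartAt ℂ p) fun w₀ =>
      (f w₀ z' - f w₀ z₁) - (f w₀ z'' - f w₀ z₁)) (chartAt ℂ p p)) (fun z' hz' => by
        obtain ⟨W, hW, h⟩ := meromorphicAt_increment hU hα p hz'
        filter_upwards [mem_nhdsWithin_of_mem_nhds hW] with z'' hz''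
        exact ⟨h _ (mem_of_mem_nhds hW) _ hz'', h _ hz'' _ (mem_of_mem_nhds hW)⟩)
      (fun a b c _ _ _ h1 h2 => by
        refine (h1.fun_add h2).congr (Eventually.of_forall fun t => ?_)
        simp only [coeff]
        ring) hz hz₁
    simpa using this
  · intro w₀ z hz
    set e := chartAt ℂ z
    have he := chart_mem_atlas (X := X) z
    have hzs : z ∈ e.source := mem_chart_source ℂ z
    have htgt : ∀ᶠ s in 𝓝 (e z), s ∈ e.target ∧ e.symm s ∈ U :=
      eventually_mem_target e (e.map_source hzs) hU (by rwa [e.left_inv hzs])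
    have hne : ∀ᶠ z' in 𝓝[≠] z, z' ≠ w₀ := by
      rcases eq_or_ne z w₀ with rfl | h
      · exact self_mem_nhdsWithin
      · exact mem_nhdsWithin_of_mem_nhds (isOpen_ne.mem_nhds h)
    rw [eventually_nhdsNE_iff_chart e hzs] at hne
    have hd : ∀ᶠ s in 𝓝[≠] (e z), HasDerivAt (fun s => f w₀ (e.symm s) - f w₀ z₁) (coeff e (C.ω02 w₀) s) s := by
      filter_upwards [hne, htgt.filter_mono nhdsWithin_le_nhds] with s h1 h2
      exact (hasPrimAt_iff he h2.1).1 (hα w₀ _ h2.2 h1)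
    refine meromorphicAt_of_hasDerivAt ?_ hd
    rcases eq_or_ne w₀ z with rfl | h
    · obtain ⟨G, hG, hd⟩ := C.ω02_fundamental.diagonal w₀
      have h2 : AnalyticAt ℂ (fun s : ℂ => (e w₀, s)) (e w₀) := by fun_prop
      have h3 := AnalyticAt.comp_of_eq hG h2 rfl
      have h4 : MeromorphicAt (fun s : ℂ => 1 / (e w₀ - s) ^ 2) (e w₀) :=
        (MeromorphicAt.const 1 _).fun_div (AnalyticAt.meromorphicAt (by fun_prop))
      refine (h4.fun_add h3.meromorphicAt).congr ?_
      have h5 := (h2.continuousAt.eventually hd).filter_mono (nhdsWithin_le_nhds (s := {e w₀}ᶜ))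
      filter_upwards [h5, self_mem_nhdsWithin] with s hs hs'
      rw [← coeff₂_chartAt_self, hs (Ne.symm hs')]
      rfl
    · exact (analyticAt_coeff_ω02 C h).meromorphicAt

end

/-! ### Homology invariance of contour integrals -/

section AbstractLifting

/-- The complex numbers with the discrete topology. -/
@[ext]
structure DiscreteComplex where
  /-- The underlying complex number. -/
  val : ℂ

instance : TopologicalSpace DiscreteComplex := ⊥

instance : DiscreteTopology DiscreteComplex := ⟨rfl⟩

variable {Y : Type*} [TopologicalSpace Y]

/-- The covering space of `Y` whose sections over `W i` are the functions that differ from `f i` by a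
locally constant function. -/
def primitiveCover (W : Y → Set Y) (f : Y → Y → ℂ) (hW : ∀ y, IsOpen (W y)) (hy : ∀ y, y ∈ W y)
    (hf : ∀ i j, ∀ x ∈ W i ∩ W j, ∀ᶠ x' in 𝓝 x, f i x' - f j x' = f i x - f j x) :
    FiberBundleCore Y Y DiscreteComplex where
  baseSet := W
  isOpen_baseSet := hW
  indexAt := id
  mem_baseSet_at := hy
  coordChange i j x v := ⟨v.val + (f i x - f j x)⟩
  coordChange_self i x _ v := by
    ext
    change v.val + (f i x - f i x) = v.val
    ring
  continuousOn_coordChange i j := by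
    rintro ⟨x, v⟩ ⟨hx, -⟩
    refine ContinuousAt.continuousWithinAt ?_
    refine (continuousAt_const (y := (⟨v.val + (f i x - f j x)⟩ : DiscreteComplex))).congr ?_
    have h1 := (hf i j x hx).prod_inl_nhds (y := v)
    have h2 : ∀ᶠ q : Y × DiscreteComplex in 𝓝 (x, v), q.2 = v :=
      (continuousAt_snd (p := (x, v))).tendsto.eventually (p := fun u => u = v) (by simp [nhds_discrete])
    filter_upwards [h1, h2] with q hq hq'
    simp only [hq', hq]
  coordChange_comp i j k x _ v := by
    ext
    change (v.val + (f i x - f j x)) + (f j x - f k x) = v.val + (f i x - f k x)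
    ring

/-- A family of functions with locally constant differences can be continued along every contracted
map into `Y`. -/
theorem exists_continuation {W : Y → Set Y} {f : Y → Y → ℂ} (hW : ∀ y, IsOpen (W y)) (hy : ∀ y, y ∈ W y)
    (hf : ∀ i j, ∀ x ∈ W i ∩ W j, ∀ᶠ x' in 𝓝 x, f i x' - f j x' = f i x - f j x)
    {A : Type*} [TopologicalSpace A] (H : C(unitInterval × A, Y)) {y₀ : Y} (H0 : ∀ a, H (0, a) = y₀) :
    ∃ F : A → ℂ, ∀ a, ∃ i, H (1, a) ∈ W i ∧
      ∀ᶠ a' in 𝓝 a, F a' - F a = f i (H (1, a')) - f i (H (1, a)) := by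
  let Z := primitiveCover W f hW hy hf
  have cov : IsCoveringMap Z.proj := FiberBundle.isCoveringMap
  let e₀ : Z.TotalSpace := ⟨y₀, (⟨0⟩ : DiscreteComplex)⟩
  let G := cov.liftHomotopy H (.const A e₀) H0
  have hG : ∀ a, (G (1, a)).1 = H (1, a) := fun a =>
    congr_fun (cov.liftHomotopy_lifts H (.const A e₀) H0) (1, a)
  let val : Z.TotalSpace → ℂ := fun e => (show DiscreteComplex from e.2).val + f e.1 e.1
  refine ⟨fun a => val (G (1, a)), fun a => ⟨H (1, a), hy _, ?_⟩⟩
  set i := H (1, a)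
  have hmem : G (1, a) ∈ (Z.localTriv i).source := (Z.mem_localTriv_source i _).2 (by
    change (G (1, a)).1 ∈ W i
    rw [hG]; exact hy _)
  have hcont : ContinuousAt (fun a' => (Z.localTriv i (G (1, a'))).2) a := by
    have h1 : ContinuousAt (fun e => (Z.localTriv i e).2) (G (1, a)) :=
      ((Z.localTriv i).continuousAt ((Z.localTriv i).mem_source.1 hmem |> fun h => by
        exact hmem)).snd
    have h2 : Continuous fun a' => G (1, a') := G.continuous.comp (by fun_prop)
    exact ContinuousAt.comp (f := fun a' => G (1, a')) h1 h2.continuousAt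
  have hconst : ∀ᶠ a' in 𝓝 a, (Z.localTriv i (G (1, a'))).2 = (Z.localTriv i (G (1, a))).2 :=
    hcont.eventually (p := fun v => v = _) (by simp [nhds_discrete])
  have hval : ∀ e : Z.TotalSpace, val e = (Z.localTriv i e).2.val + f i e.1 := by
    intro e
    change (show DiscreteComplex from e.2).val + f e.1 e.1 =
      ((show DiscreteComplex from e.2).val + (f e.1 e.1 - f i e.1)) + f i e.1
    ring
  filter_upwards [hconst] with a' ha'
  rw [hval, hval, ha', hG, hG]
  ring

end AbstractLifting

section Integrals

variable {X : Type*} [TopologicalSpace X] [ChartedSpace ℂ X] {η : X → ℂ}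

/-- `f` is a holomorphic primitive of the `1`-form `η` on a neighbourhood of `z`, where the value of `η`
at `z` itself is disregarded. -/
def LocPrim (η : X → ℂ) (z : X) (f : X → ℂ) : Prop :=
  AnalyticAt ℂ (fun t => f ((chartAt ℂ z).symm t)) (chartAt ℂ z z) ∧ ∀ᶠ z' in 𝓝[≠] z, HasPrimAt f η z'

variable [IsManifold 𝓘(ℂ) ⊤ X]

theorem LocPrim.sub_eventually_const {z : X} {f g : X → ℂ} (hf : LocPrim η z f) (hg : LocPrim η z g) :
    ∀ᶠ z' in 𝓝 z, f z' - g z' = f z - g z := by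
  set e := chartAt ℂ z
  have hz : z ∈ e.source := mem_chart_source ℂ z
  have he := chart_mem_atlas (X := X) z
  have han := hf.1.fun_sub hg.1
  have h0 : ∀ᶠ s in 𝓝[≠] (e z), deriv (fun t => f (e.symm t) - g (e.symm t)) s = 0 := by
    have h1 := (eventually_nhdsNE_iff_chart e hz).1 (hf.2.and hg.2)
    filter_upwards [h1, (e.open_target.eventually_mem (e.map_source hz)).filter_mono nhdsWithin_le_nhds]
      with s hs hst
    exact ((((hasPrimAt_iff he hst).1 hs.1).sub ((hasPrimAt_iff he hst).1 hs.2)).congr_deriv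
      (sub_self _)).deriv
  have h1 := han.deriv.frequently_zero_iff_eventually_zero.1 h0.frequently
  obtain ⟨R, hR, hb⟩ := Metric.eventually_nhds_iff_ball.1 (h1.and han.eventually_analyticAt)
  rw [eventually_nhds_iff_chart e hz]
  filter_upwards [ball_mem_nhds (e z) hR] with t ht
  have := eq_of_hasDerivAt_zero_ball (fun s hs => (hb s hs).1 ▸ (hb s hs).2.differentiableAt.hasDerivAt)
    ht (mem_ball_self hR)
  rwa [e.left_inv hz] at this

theorem LocPrim.eventually [T2Space X] {z : X} {f : X → ℂ} (hf : LocPrim η z f) : ∀ᶠ z' in 𝓝 z, LocPrim η z' f := by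
  set e := chartAt ℂ z
  have hz : z ∈ e.source := mem_chart_source ℂ z
  have he := chart_mem_atlas (X := X) z
  have h1 := eventually_nhdsWithin_iff.1 hf.2
  have h2 : ∀ᶠ z' in 𝓝 z, AnalyticAt ℂ (fun t => f (e.symm t)) (e z') :=
    (e.continuousAt hz).eventually hf.1.eventually_analyticAt
  filter_upwards [h1.eventually_nhds, h2, e.open_source.eventually_mem hz] with z' h3 h4 h5
  refine ⟨analyticAt_comp_symm_of (chart_mem_atlas z') he (mem_chart_source ℂ z') h5 h4, ?_⟩
  have hne : ∀ᶠ z'' in 𝓝[≠] z', z'' ≠ z := by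
    rcases eq_or_ne z' z with rfl | h
    · exact self_mem_nhdsWithin
    · exact (isOpen_ne.eventually_mem h).filter_mono nhdsWithin_le_nhds
  filter_upwards [h3.filter_mono nhdsWithin_le_nhds, hne] with z'' h6 h7 using h6 h7

/-- `F` is a primitive of `η` along the map `σ`. -/
def PrimAlong {A : Type*} [TopologicalSpace A] (η : X → ℂ) (σ : A → X) (F : A → ℂ) : Prop :=
  ∀ a, ∃ f, LocPrim η (σ a) f ∧ ∀ᶠ a' in 𝓝 a, F a' - F a = f (σ a') - f (σ a)

theorem PrimAlong.comp {A B : Type*} [TopologicalSpace A] [TopologicalSpace B] {σ : A → X} {F : A → ℂ}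
    (h : PrimAlong η σ F) {g : B → A} (hg : Continuous g) : PrimAlong η (fun b => σ (g b)) fun b => F (g b) := by
  intro b
  obtain ⟨f, hf, he⟩ := h (g b)
  exact ⟨f, hf, hg.continuousAt.eventually he⟩

theorem PrimAlong.sub_eq {A : Type*} [TopologicalSpace A] [PreconnectedSpace A] {σ : A → X}
    (hσ : Continuous σ) {F G : A → ℂ} (hF : PrimAlong η σ F) (hG : PrimAlong η σ G) (a b : A) :
    F b - F a = G b - G a := by
  have h : IsLocallyConstant fun a => F a - G a := by
    rw [IsLocallyConstant.iff_eventually_eq]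
    intro a
    obtain ⟨f, hf, h1⟩ := hF a
    obtain ⟨g, hg, h2⟩ := hG a
    filter_upwards [h1, h2, hσ.continuousAt.eventually (hf.sub_eventually_const hg)] with a' e1 e2 e3
    linear_combination e1 - e2 + e3
  have := h.apply_eq_of_preconnectedSpace a b
  linear_combination -this

/-- A map with a contraction to a point, such as a path or a singular simplex, carries a primitive: local
primitives are continued along the contraction. -/
theorem exists_primAlong [T2Space X] {V : Set X} (hη : ∀ z ∈ V, ∃ f, LocPrim η z f)
    {A : Type*} [TopologicalSpace A] (H : C(unitInterval × A, X)) (hH : ∀ q, H q ∈ V) {y₀ : X}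
    (H0 : ∀ a, H (0, a) = y₀) : ∃ F : A → ℂ, PrimAlong η (fun a => H (1, a)) F := by
  rcases isEmpty_or_nonempty A with hA | ⟨⟨a₀⟩⟩
  · exact ⟨fun _ => 0, fun a => hA.elim a⟩
  choose f hf using fun z : V => hη z z.2
  have hW : ∀ z : V, ∃ W : Set X, IsOpen W ∧ ↑z ∈ W ∧ ∀ z' ∈ W, LocPrim η z' (f z) := fun z => by
    obtain ⟨W, h1, h2, h3⟩ := eventually_nhds_iff.1 (hf z).eventually
    exact ⟨W, h2, h3, h1⟩
  choose W hWo hWm hWp using hW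
  obtain ⟨F, hF⟩ := exists_continuation (Y := V) (W := fun z => ((↑) : V → X) ⁻¹' W z) (f := fun z z' => f z z')
    (fun z => (hWo z).preimage continuous_subtype_val) (fun z => hWm z) (fun i j x hx => by
      exact continuousAt_subtype_val.eventually ((hWp i x hx.1).sub_eventually_const (hWp j x hx.2)))
    (A := A) ⟨fun q => ⟨H q, hH q⟩, by fun_prop⟩ (y₀ := ⟨y₀, H0 a₀ ▸ hH _⟩) (fun a => Subtype.ext (H0 a))
  refine ⟨F, fun a => ?_⟩
  obtain ⟨i, hi, he⟩ := hF a
  exact ⟨f i, hWp i _ hi, he⟩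

theorem exists_primAlong_path [T2Space X] {V : Set X} (hη : ∀ z ∈ V, ∃ f, LocPrim η z f)
    (σ : C(unitInterval, X)) (hσ : range σ ⊆ V) : ∃ F : unitInterval → ℂ, PrimAlong η σ F := by
  obtain ⟨F, hF⟩ := exists_primAlong hη (A := unitInterval) ⟨fun q => σ (q.1 * q.2), by fun_prop⟩
    (fun q => hσ ⟨_, rfl⟩) (y₀ := σ 0) (fun a => by simp)
  exact ⟨F, by simpa using hF⟩

theorem exists_primAlong_simplex [T2Space X] {V : Set X} (hη : ∀ z ∈ V, ∃ f, LocPrim η z f)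
    (σ : C(stdSimplex ℝ (Fin 3), X)) (hσ : range σ ⊆ V) :
    ∃ F : stdSimplex ℝ (Fin 3) → ℂ, PrimAlong η σ F := by
  -- contract the simplex along straight lines to a vertex
  let g : unitInterval × stdSimplex ℝ (Fin 3) → stdSimplex ℝ (Fin 3) := fun q =>
    ⟨fun k => (1 - (q.1 : ℝ)) * Pi.single (M := fun _ => ℝ) 0 1 k + (q.1 : ℝ) * q.2.1 k,
      (convex_stdSimplex ℝ (Fin 3)) (single_mem_stdSimplex ℝ 0) q.2.2
        (sub_nonneg.2 q.1.2.2) q.1.2.1 (sub_add_cancel _ _)⟩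
  have hg : Continuous g := by
    refine Continuous.subtype_mk (continuous_pi fun k => ?_) _
    have h1 : Continuous fun q : unitInterval × stdSimplex ℝ (Fin 3) => (q.2.1 : Fin 3 → ℝ) :=
      continuous_subtype_val.comp continuous_snd
    have h2 : Continuous fun q : unitInterval × stdSimplex ℝ (Fin 3) => q.2.1 k :=
      (continuous_apply k).comp h1
    fun_prop
  obtain ⟨F, hF⟩ := exists_primAlong hη (A := stdSimplex ℝ (Fin 3)) ⟨fun q => σ (g q), by fun_prop⟩
    (fun q => hσ ⟨_, rfl⟩) (y₀ := σ ⟨Pi.single 0 1, single_mem_stdSimplex ℝ 0⟩) (fun a => by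
      simp only [ContinuousMap.coe_mk]
      congr 1
      ext k
      simp [g])
  refine ⟨F, ?_⟩
  have : (fun a => σ (g (1, a))) = σ := by
    ext a
    congr 1
    ext k
    simp [g]
  simpa [this] using hF

open Classical in
/-- The integral of `η` along a path, as the increment of a primitive along it. -/
noncomputable def pathIntegral (η : X → ℂ) (c : C(unitInterval, X)) : ℂ :=
  if h : ∃ F, PrimAlong η c F then h.choose 1 - h.choose 0 else 0

theorem PrimAlong.pathIntegral_eq {c : C(unitInterval, X)} {F : unitInterval → ℂ} (h : PrimAlong η c F) :
    pathIntegral η c = F 1 - F 0 := by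
  have hex : ∃ F, PrimAlong η c F := ⟨F, h⟩
  rw [pathIntegral, dif_pos hex]
  exact PrimAlong.sub_eq c.continuous hex.choose_spec h 0 1

/-- The integral of `η` along a singular `1`-chain. -/
noncomputable def chainIntegral (η : X → ℂ) : (C(unitInterval, X) →₀ ℤ) →+ ℂ :=
  Finsupp.liftAddHom fun c => AddMonoidHom.flip (smulAddHom ℤ ℂ) (pathIntegral η c)

theorem chainIntegral_single (c : C(unitInterval, X)) :
    chainIntegral η (Finsupp.single c 1) = pathIntegral η c := by
  simp [chainIntegral]

theorem chainIntegral_boundary [T2Space X] {V : Set X} (hη : ∀ z ∈ V, ∃ f, LocPrim η z f)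
    (σ : C(stdSimplex ℝ (Fin 3), X)) (hσ : range σ ⊆ V) : chainIntegral η (boundary σ) = 0 := by
  obtain ⟨F, hF⟩ := exists_primAlong_simplex hη σ hσ
  have h : ∀ i j, pathIntegral η (edge σ i j) = F (edgePt i j 1) - F (edgePt i j 0) := fun i j =>
    PrimAlong.pathIntegral_eq (c := edge σ i j) (hF.comp (continuous_edgePt i j))
  have h0 : ∀ i j j', edgePt i j 0 = edgePt i j' 0 := fun i j j' => by
    ext k; simp [edgePt]
  have h1 : ∀ i i' j, edgePt i j 1 = edgePt i' j 1 := fun i i' j => by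
    ext k; simp [edgePt]
  have h2 : ∀ i j k, edgePt i j 1 = edgePt j k 0 := fun i j k => by
    ext l; simp [edgePt]
  rw [boundary, map_add, map_sub, chainIntegral_single, chainIntegral_single, chainIntegral_single,
    h, h, h, h1 1 0 2, h0 0 2 1, h2 0 1 2]
  ring

/-- A `1`-form with local primitives has the same integrals along homologous chains. -/
theorem chainIntegral_eq_of_homologous [T2Space X] {V : Set X}
    (hη : ∀ z ∈ V, ∃ f, LocPrim η z f) {c c' : C(unitInterval, X) →₀ ℤ} (h : Homologous V c c') :
    chainIntegral η c = chainIntegral η c' := by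
  have : c - c' ∈ (chainIntegral η).ker := by
    refine (AddSubgroup.closure_le _).2 ?_ h
    rintro _ ⟨σ, hσ, rfl⟩
    exact chainIntegral_boundary hη σ hσ
  rwa [AddMonoidHom.mem_ker, map_sub, sub_eq_zero] at this

/-- A set of real numbers all of whose points are isolated is countable. -/
theorem countable_of_eventually_notMem {S : Set ℝ} (h : ∀ t ∈ S, ∀ᶠ s in 𝓝[≠] t, s ∉ S) : S.Countable := by
  refine (HereditarilyLindelofSpace.isLindelof S).countable ?_
  rw [discreteTopology_subtype_iff]
  intro t ht
  rw [← disjoint_iff, Filter.disjoint_iff]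
  exact ⟨Sᶜ, h t ht, S, mem_principal_self S, disjoint_compl_left⟩

/-- The integral along a loop of a `1`-form with local primitives; the values of the form at isolated
points do not matter. -/
theorem Loop.integral_eq_pathIntegral [T2Space X] {V : Set X}
    (hη : ∀ z ∈ V, ∃ f, LocPrim η z f) (γ : Loop X) (hγ : range γ.toFun ⊆ V) :
    IntervalIntegrable (γ.pullback η) MeasureTheory.volume 0 1 ∧
      γ.integral η = pathIntegral η γ.simplex := by
  have hc : Continuous γ.toFun := γ.smooth.continuous
  -- continue along the loop a little beyond both ends
  let σ : C(unitInterval, X) := ⟨fun s => γ.toFun (3 * s - 1), by fun_prop⟩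
  obtain ⟨F, hF⟩ := exists_primAlong_path hη σ (by rintro _ ⟨s, rfl⟩; exact hγ ⟨_, rfl⟩)
  let g : ℝ → unitInterval := fun t => projIcc 0 1 zero_le_one ((t + 1) / 3)
  have hg : Continuous g := continuous_projIcc.comp (by fun_prop)
  have hσg : ∀ t ∈ Icc (-1 : ℝ) 2, σ (g t) = γ.toFun t := by
    intro t ht
    have : ((g t : unitInterval) : ℝ) = (t + 1) / 3 := by
      simp only [g]
      rw [projIcc_of_mem zero_le_one ⟨by linarith [ht.1], by linarith [ht.2]⟩]
    simp only [σ, ContinuousMap.coe_mk, this]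
    congr 1
    ring
  have hloc : ∀ t ∈ Ioo (-1 : ℝ) 2, ∃ f, LocPrim η (γ.toFun t) f ∧
      ∀ᶠ s in 𝓝 t, F (g s) = f (γ.toFun s) + (F (g t) - f (γ.toFun t)) := by
    intro t ht
    obtain ⟨f, hf, he⟩ := (hF.comp hg) t
    simp only [hσg t (Ioo_subset_Icc_self ht)] at hf he
    refine ⟨f, hf, ?_⟩
    filter_upwards [he, Ioo_mem_nhds ht.1 ht.2] with s hs hs'
    rw [hσg s (Ioo_subset_Icc_self hs')] at hs
    linear_combination hs
  have hC1 : ∀ t, C1At γ.toFun t := fun t => c1At_iff_contMDiffAt.1 (γ.smooth t)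
  have hdiff : ContDiffOn ℝ 1 (fun t => F (g t)) (Ioo (-1) 2) := by
    intro t ht
    obtain ⟨f, hf, he⟩ := hloc t ht
    refine ContDiffAt.contDiffWithinAt (ContDiffAt.congr_of_eventuallyEq ?_ he)
    refine ContDiffAt.add ?_ contDiffAt_const
    have h1 := (hf.1.contDiffAt (n := 1)).restrict_scalars ℝ
    refine (ContDiffAt.comp (f := fun s => chartAt ℂ (γ.toFun t) (γ.toFun s)) t h1 (hC1 t).2).congr_of_eventuallyEq ?_
    filter_upwards [hc.continuousAt.eventually ((chartAt ℂ (γ.toFun t)).open_source.mem_nhds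
      (mem_chart_source ℂ _))] with s hs
    simp only [Function.comp]
    rw [(chartAt ℂ (γ.toFun t)).left_inv hs]
  have hsub : Icc (0 : ℝ) 1 ⊆ Ioo (-1) 2 := fun t ht => ⟨by linarith [ht.1], by linarith [ht.2]⟩
  -- the exceptional times, at which the loop passes through a point where the value of `η` is arbitrary and
  -- moves with nonzero velocity, so that it leaves the point at once
  set B : Set ℝ := {t | t ∈ Ioo (-1 : ℝ) 2 ∧ γ.pullback η t ≠ deriv (fun t => F (g t)) t}
  have hB : B.Countable := by
    refine countable_of_eventually_notMem fun t ⟨ht, hne⟩ => ?_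
    obtain ⟨f, hf, he⟩ := hloc t ht
    have key : ∀ s, HasPrimAt f η (γ.toFun s) →
        (∀ᶠ s' in 𝓝 s, F (g s') = f (γ.toFun s') + (F (g t) - f (γ.toFun t))) →
        γ.pullback η s = deriv (fun t => F (g t)) s := by
      intro s h1 h2
      have h3 := (h1.hasDerivAt_comp (hC1 s)).add_const (F (g t) - f (γ.toFun t))
      exact (h3.congr_of_eventuallyEq h2).deriv.symm
    have hder : deriv (fun s => chartAt ℂ (γ.toFun t) (γ.toFun s)) t ≠ 0 := by
      intro h0
      apply hne
      have h1 := hf.1.differentiableAt.hasDerivAt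
      have h2 := ((hC1 t).2.differentiableAt one_ne_zero).hasDerivAt
      have h3 := HasDerivAt.comp (h := fun s => chartAt ℂ (γ.toFun t) (γ.toFun s)) t h1 h2
      rw [h0, mul_zero] at h3
      have h4 : HasDerivAt (fun t => F (g t)) 0 t := by
        refine (h3.add_const (F (g t) - f (γ.toFun t))).congr_of_eventuallyEq ?_
        filter_upwards [he, hc.continuousAt.eventually ((chartAt ℂ (γ.toFun t)).open_source.mem_nhds
          (mem_chart_source ℂ _))] with s hs hs'
        rw [hs]
        simp only [Function.comp]
        rw [(chartAt ℂ (γ.toFun t)).left_inv hs']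
      rw [h4.deriv, Loop.pullback, h0, mul_zero]
    have hne' := ((hC1 t).2.differentiableAt one_ne_zero).hasDerivAt.eventually_ne (c := chartAt ℂ (γ.toFun t) (γ.toFun t)) hder
    have hprim : ∀ᶠ s in 𝓝 t, γ.toFun s ≠ γ.toFun t → HasPrimAt f η (γ.toFun s) :=
      hc.continuousAt.eventually (eventually_nhdsWithin_iff.1 hf.2)
    filter_upwards [hne', hprim.filter_mono nhdsWithin_le_nhds,
      he.eventually_nhds.filter_mono nhdsWithin_le_nhds] with s h1 h2 h3 h4
    exact h4.2 (key s (h2 fun h => h1 (by rw [h])) h3)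
  have hae : ∀ᵐ t ∂MeasureTheory.volume, t ∈ uIoc (0 : ℝ) 1 → γ.pullback η t = deriv (fun t => F (g t)) t := by
    have : ∀ᵐ t ∂(MeasureTheory.volume : MeasureTheory.Measure ℝ), t ∉ B :=
      MeasureTheory.measure_eq_zero_iff_ae_notMem.1 (hB.measure_zero _)
    filter_upwards [this] with t ht hm
    rw [uIoc_of_le zero_le_one] at hm
    by_contra h
    exact ht ⟨hsub (Ioc_subset_Icc_self hm), h⟩
  have hcont : ContinuousOn (deriv fun t => F (g t)) (uIcc 0 1) := by
    rw [uIcc_of_le zero_le_one]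
    exact (hdiff.continuousOn_deriv_of_isOpen isOpen_Ioo le_rfl).mono hsub
  have hint := hcont.intervalIntegrable (μ := MeasureTheory.volume)
  refine ⟨hint.congr_ae ?_, ?_⟩
  · rw [Filter.EventuallyEq, MeasureTheory.ae_restrict_iff' measurableSet_uIoc]
    filter_upwards [hae] with t h1 h2 using (h1 h2).symm
  · have h1 : γ.integral η = ∫ t in (0 : ℝ)..1, deriv (fun t => F (g t)) t :=
      intervalIntegral.integral_congr_ae hae
    have h2 : ∀ t ∈ uIcc (0 : ℝ) 1, DifferentiableAt ℝ (fun t => F (g t)) t := fun t ht => by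
      rw [uIcc_of_le zero_le_one] at ht
      exact (hdiff.contDiffAt (isOpen_Ioo.mem_nhds (hsub ht))).differentiableAt one_ne_zero
    have h3 : PrimAlong η γ.simplex fun s : unitInterval => F (g s) := by
      have := hF.comp (g := fun s : unitInterval => g s) (hg.comp continuous_subtype_val)
      have e : (fun b : unitInterval => σ (g b)) = γ.simplex := by
        ext s
        exact hσg s ⟨by linarith [s.2.1], by linarith [s.2.2]⟩
      rwa [e] at this
    rw [h1, intervalIntegral.integral_deriv_eq_sub h2 hint, h3.pathIntegral_eq]
    simp

end Integrals

/-! ### Coordinates of the Riemann sphere -/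

theorem eventually_of_eventually_pow {k : ℕ} (hk : 0 < k) {p : ℂ → Prop}
    (h : ∀ᶠ u in 𝓝[≠] (0 : ℂ), p (u ^ k)) : ∀ᶠ t in 𝓝[≠] (0 : ℂ), p t := by
  rw [eventually_nhdsWithin_iff, Metric.eventually_nhds_iff_ball] at h ⊢
  obtain ⟨R, hR, hb⟩ := h
  refine ⟨R ^ k, by positivity, fun t ht ht0 => ?_⟩
  obtain ⟨u, rfl⟩ := IsAlgClosed.exists_pow_nat_eq t hk
  refine hb u ?_ ?_
  · rw [mem_ball_zero_iff] at *
    rw [norm_pow] at ht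
    exact lt_of_pow_lt_pow_left₀ k hR.le ht
  · rintro rfl
    exact ht0 (zero_pow hk.ne')

section SphereCoord

open Classical in
/-- The inverse of the coordinate of the Riemann sphere centred at `q` that is affine if `q` is finite,
and the inverse of the affine coordinate if `q = ∞`. -/
noncomputable def sphereCoord (q : OnePoint ℂ) (v : ℂ) : OnePoint ℂ :=
  if q = ∞ then (if v = 0 then ∞ else ((v⁻¹ : ℂ) : OnePoint ℂ)) else ((affine q + v : ℂ) : OnePoint ℂ)

@[simp] theorem affine_coe (z : ℂ) : affine (z : OnePoint ℂ) = z := rfl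

@[simp] theorem affine_infty : affine ∞ = 0 := rfl

theorem coe_affine {q : OnePoint ℂ} (h : q ≠ ∞) : ((affine q : ℂ) : OnePoint ℂ) = q := by
  obtain ⟨z, rfl⟩ := OnePoint.ne_infty_iff_exists.1 h
  rfl

theorem sphereCoord_coe (z v : ℂ) : sphereCoord (z : OnePoint ℂ) v = ((z + v : ℂ) : OnePoint ℂ) := by
  simp [sphereCoord]

theorem sphereCoord_infty_of_ne {v : ℂ} (hv : v ≠ 0) : sphereCoord ∞ v = ((v⁻¹ : ℂ) : OnePoint ℂ) := by
  simp [sphereCoord, hv]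

theorem sphereCoord_zero (q : OnePoint ℂ) : sphereCoord q 0 = q := by
  induction q using OnePoint.rec with
  | infty => simp [sphereCoord]
  | coe z => simp [sphereCoord_coe]

theorem sphereCoord_injective (q : OnePoint ℂ) : Function.Injective (sphereCoord q) := by
  induction q using OnePoint.rec with
  | infty =>
    intro v v' h
    by_cases hv : v = 0 <;> by_cases hv' : v' = 0 <;> simp_all [sphereCoord]
  | coe z =>
    intro v v' h
    simpa [sphereCoord_coe] using h

theorem continuousAt_sphereCoord (q : OnePoint ℂ) : ContinuousAt (sphereCoord q) 0 := by
  induction q using OnePoint.rec with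
  | infty =>
    have h1 : Tendsto (fun v : ℂ => ((v⁻¹ : ℂ) : OnePoint ℂ)) (𝓝[≠] 0) (𝓝 ∞) := by
      have h2 := (OnePoint.tendsto_coe_infty (X := ℂ))
      rw [Filter.coclosedCompact_eq_cocompact, ← Metric.cobounded_eq_cocompact] at h2
      exact h2.comp Filter.tendsto_inv₀_nhdsNE_zero
    have h3 : Tendsto (sphereCoord ∞) (𝓝[≠] 0) (𝓝 (sphereCoord ∞ 0)) := by
      rw [sphereCoord_zero]
      refine h1.congr' ?_
      filter_upwards [self_mem_nhdsWithin] with v hv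
      rw [sphereCoord_infty_of_ne hv]
    exact continuousAt_iff_punctured_nhds.2 h3
  | coe z =>
    have : sphereCoord (z : OnePoint ℂ) = fun v => ((z + v : ℂ) : OnePoint ℂ) := funext (sphereCoord_coe z)
    rw [this]
    exact (OnePoint.continuous_coe.comp (by fun_prop)).continuousAt

theorem sphereCoord_ne_infty (q : OnePoint ℂ) {v : ℂ} (hv : v ≠ 0) : sphereCoord q v ≠ ∞ := by
  induction q using OnePoint.rec with
  | infty => rw [sphereCoord_infty_of_ne hv]; exact OnePoint.coe_ne_infty _
  | coe z => rw [sphereCoord_coe]; exact OnePoint.coe_ne_infty _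

open Classical in
/-- The derivative of the affine coordinate of `sphereCoord q v` with respect to `v`. -/
noncomputable def sphereDeriv (q : OnePoint ℂ) (v : ℂ) : ℂ := if q = ∞ then -(v ^ 2)⁻¹ else 1

theorem sphereDeriv_ne_zero (q : OnePoint ℂ) {v : ℂ} (hv : v ≠ 0) : sphereDeriv q v ≠ 0 := by
  unfold sphereDeriv
  split_ifs
  · exact neg_ne_zero.2 (inv_ne_zero (pow_ne_zero _ hv))
  · exact one_ne_zero

theorem hasDerivAt_affine_sphereCoord (q : OnePoint ℂ) {v : ℂ} (hv : v ≠ 0) :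
    HasDerivAt (fun v => affine (sphereCoord q v)) (sphereDeriv q v) v := by
  induction q using OnePoint.rec with
  | infty =>
    simp only [sphereDeriv, if_true]
    refine (hasDerivAt_inv hv).congr_of_eventuallyEq ?_
    filter_upwards [isOpen_ne.mem_nhds hv] with u hu
    rw [sphereCoord_infty_of_ne hu, affine_coe]
  | coe z =>
    simp only [sphereDeriv, OnePoint.coe_ne_infty, if_false, sphereCoord_coe, affine_coe]
    exact (hasDerivAt_id v).const_add z

theorem meromorphicAt_sphereDeriv (q : OnePoint ℂ) : MeromorphicAt (sphereDeriv q) 0 := by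
  unfold sphereDeriv
  split_ifs
  · exact (AnalyticAt.meromorphicAt (f := fun v : ℂ => v ^ 2) (by fun_prop)).fun_inv.fun_neg
  · exact MeromorphicAt.const 1 0

theorem eq_sphereCoord_of_finite {q s : OnePoint ℂ} (hq : q ≠ ∞) (hs : s ≠ ∞) :
    s = sphereCoord q (affine s - affine q) := by
  obtain ⟨z, rfl⟩ := OnePoint.ne_infty_iff_exists.1 hq
  obtain ⟨z', rfl⟩ := OnePoint.ne_infty_iff_exists.1 hs
  simp [sphereCoord_coe]

theorem eq_sphereCoord_infty {s : OnePoint ℂ} (hs : affine s ≠ 0 ∨ s = ∞) :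
    s = sphereCoord ∞ (affine s)⁻¹ := by
  induction s using OnePoint.rec with
  | infty => simp [sphereCoord_zero]
  | coe z =>
    have hz : z ≠ 0 := by simpa using hs
    simp [sphereCoord_infty_of_ne, hz]

end SphereCoord

/-! ### Fibres of `x` -/

section Fibres

variable {X : Type*} [TopologicalSpace X] [ChartedSpace ℂ X] {C : SpectralCurve X}

theorem SpectralCurve.continuous_x (C : SpectralCurve X) : Continuous C.x := by
  refine continuous_iff_continuousAt.2 fun p => ?_
  have h1 := (C.x_holomorphic p).1
  have h2 : ContinuousAt (fun z => C.x ((chartAt ℂ p).symm (chartAt ℂ p z))) p :=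
    ContinuousAt.comp (f := chartAt ℂ p) h1 ((chartAt ℂ p).continuousAt (mem_chart_source ℂ p))
  refine h2.congr ?_
  filter_upwards [(chartAt ℂ p).open_source.mem_nhds (mem_chart_source ℂ p)] with z hz
  rw [(chartAt ℂ p).left_inv hz]

theorem IsComponentOver.isOpen {D : Set (OnePoint ℂ)} (hD : IsOpen D) {Dt : Set X}
    (h : IsComponentOver C D Dt) : IsOpen Dt := by
  have : LocallyConnectedSpace X := ChartedSpace.locallyConnectedSpace ℂ X
  obtain ⟨p, hp, rfl⟩ := h
  exact (hD.preimage C.continuous_x).connectedComponentIn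

variable {p : X} {r : ℕ} {ζ : OpenPartialHomeomorph X ℂ}

namespace IsStandardCoordinate

theorem x_eq (h : IsStandardCoordinate C p r ζ) {z : X} (hz : z ∈ ζ.source) :
    C.x z = sphereCoord (C.x p) (ζ z ^ r) := by
  rcases h.normal_form with ⟨q, hq⟩ | ⟨hp, hq⟩
  · have := hq p h.mem_source
    rw [h.map_center, zero_pow h.order_pos.ne', add_zero] at this
    rw [this, sphereCoord_coe, hq z hz]
  · rcases eq_or_ne z p with rfl | hne
    · rw [h.map_center, zero_pow h.order_pos.ne', sphereCoord_zero]
    · have h0 : ζ z ≠ 0 := fun h0 => hne (ζ.injOn hz h.mem_source (h0.trans h.map_center.symm))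
      rw [hp, sphereCoord_infty_of_ne (pow_ne_zero _ h0), hq z hz hne]

theorem zero_mem_target (h : IsStandardCoordinate C p r ζ) : (0 : ℂ) ∈ ζ.target :=
  h.map_center ▸ ζ.map_source h.mem_source

theorem symm_zero (h : IsStandardCoordinate C p r ζ) : ζ.symm 0 = p := by
  rw [← h.map_center, ζ.left_inv h.mem_source]

theorem x_symm (h : IsStandardCoordinate C p r ζ) {t : ℂ} (ht : t ∈ ζ.target) :
    C.x (ζ.symm t) = sphereCoord (C.x p) (t ^ r) := by
  rw [h.x_eq (ζ.map_target ht), ζ.right_inv ht]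

theorem ne_zero (h : IsStandardCoordinate C p r ζ) {z : X} (hz : z ∈ ζ.source) (hne : z ≠ p) : ζ z ≠ 0 :=
  fun h0 => hne (ζ.injOn hz h.mem_source (h0.trans h.map_center.symm))

variable [IsManifold 𝓘(ℂ) ⊤ X]

/-- A standard coordinate restricts to a standard coordinate with values in a smaller disc. -/
theorem exists_restrict (h : IsStandardCoordinate C p r ζ) {ρ : ℝ} (hρ : 0 < ρ)
    (hsub : ball 0 ρ ⊆ ζ.target) : ∃ ζ' : OpenPartialHomeomorph X ℂ, IsStandardCoordinate C p r ζ' ∧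
      ζ'.target = ball 0 ρ ∧ ζ'.source = ζ.source ∩ ζ ⁻¹' ball 0 ρ ∧ ⇑ζ' = ζ ∧ ⇑ζ'.symm = ζ.symm := by
  set s := ζ.source ∩ ζ ⁻¹' ball 0 ρ
  have hs : IsOpen s := ζ.isOpen_inter_preimage isOpen_ball
  have hsrc : (ζ.restr s).source = s := by
    rw [OpenPartialHomeomorph.restr_source, hs.interior_eq]
    exact inter_eq_right.2 inter_subset_left
  have htgt : (ζ.restr s).target = ball 0 ρ := by
    rw [← OpenPartialHomeomorph.image_source_eq_target, hsrc]
    ext t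
    constructor
    · rintro ⟨z, hz, rfl⟩
      exact hz.2
    · intro ht
      exact ⟨ζ.symm t, ⟨ζ.map_target (hsub ht), by rwa [mem_preimage, ζ.right_inv (hsub ht)]⟩,
        ζ.right_inv (hsub ht)⟩
  refine ⟨ζ.restr s, ⟨restr_mem_maximalAtlas _ h.mem_atlas hs, ?_, h.map_center, ⟨ρ, hρ, htgt⟩, h.order_pos, ?_⟩,
    htgt, hsrc, rfl, rfl⟩
  · rw [hsrc]
    exact ⟨h.mem_source, by rw [mem_preimage, h.map_center]; exact mem_ball_self hρ⟩
  · rw [hsrc]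
    rcases h.normal_form with ⟨q, hq⟩ | ⟨hp, hq⟩
    · exact Or.inl ⟨q, fun z hz => hq z hz.1⟩
    · exact Or.inr ⟨hp, fun z hz => hq z hz.1⟩

end IsStandardCoordinate

variable [IsManifold 𝓘(ℂ) ⊤ X]

theorem analyticAt_affine_x (C : SpectralCurve X) {z : X} (hz : C.x z ≠ ∞) :
    AnalyticAt ℂ (fun t => affine (C.x ((chartAt ℂ z).symm t))) (chartAt ℂ z z) :=
  (C.x_holomorphic z).2.1 (by simpa only [(chartAt ℂ z).left_inv (mem_chart_source ℂ z)] using hz)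

/-- Where `x` is finite, `dx` is the derivative of its affine coordinate. -/
theorem hasPrimAt_dx (C : SpectralCurve X) {z : X} (hz : C.x z ≠ ∞) :
    HasPrimAt (fun z => affine (C.x z)) C.dx z :=
  (analyticAt_affine_x C hz).differentiableAt.hasDerivAt

namespace IsStandardCoordinate

/-- `dx` in a standard coordinate: `x` is `t ↦ t ^ r` followed by the coordinate of the sphere. -/
theorem coeff_dx (h : IsStandardCoordinate C p r ζ) {t : ℂ} (ht : t ∈ ζ.target) (h0 : t ≠ 0) :
    coeff ζ C.dx t = sphereDeriv (C.x p) (t ^ r) * (r * t ^ (r - 1)) := by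
  have hx : C.x (ζ.symm t) ≠ ∞ := by
    rw [h.x_symm ht]
    exact sphereCoord_ne_infty _ (pow_ne_zero _ h0)
  have h1 := (hasPrimAt_iff h.mem_atlas ht).1 (hasPrimAt_dx C hx)
  have h2 := HasDerivAt.comp (h := fun t => t ^ r) t (hasDerivAt_affine_sphereCoord (C.x p) (pow_ne_zero r h0))
    (hasDerivAt_pow r t)
  refine h1.unique (h2.congr_of_eventuallyEq ?_)
  filter_upwards [ζ.open_target.mem_nhds ht] with s hs
  simp only [Function.comp]
  rw [h.x_symm hs]

theorem coeff_dx_ne_zero (h : IsStandardCoordinate C p r ζ) {t : ℂ} (ht : t ∈ ζ.target) (h0 : t ≠ 0) :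
    coeff ζ C.dx t ≠ 0 := by
  rw [h.coeff_dx ht h0]
  refine mul_ne_zero (sphereDeriv_ne_zero _ (pow_ne_zero _ h0)) (mul_ne_zero ?_ (pow_ne_zero _ h0))
  exact_mod_cast h.order_pos.ne'

theorem dx_ne_zero (h : IsStandardCoordinate C p r ζ) {z : X} (hz : z ∈ ζ.source) (hne : z ≠ p) :
    C.dx z ≠ 0 := by
  have h1 := h.coeff_dx_ne_zero (ζ.map_source hz) (h.ne_zero hz hne)
  rw [coeff, ζ.left_inv hz] at h1
  exact left_ne_zero_of_mul h1

theorem x_ne_infty (h : IsStandardCoordinate C p r ζ) {z : X} (hz : z ∈ ζ.source) (hne : z ≠ p) :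
    C.x z ≠ ∞ := by
  rw [h.x_eq hz]
  exact sphereCoord_ne_infty _ (pow_ne_zero _ (h.ne_zero hz hne))

/-- At a ramification point where `x` is finite, `dx` vanishes. -/
theorem dx_eq_zero (h : IsStandardCoordinate C p r ζ) (hr : 2 ≤ r) (hp : C.x p ≠ ∞) : C.dx p = 0 := by
  have h1 := (hasPrimAt_iff h.mem_atlas h.zero_mem_target).1 (by
    rw [h.symm_zero]; exact hasPrimAt_dx C hp)
  have h2 : HasDerivAt (fun t : ℂ => affine (C.x p) + t ^ r) 0 0 := by
    refine ((hasDerivAt_pow r (0 : ℂ)).const_add _).congr_deriv ?_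
    rw [zero_pow (by omega), mul_zero]
  have h3 : coeff ζ C.dx 0 = 0 := by
    refine h1.unique (h2.congr_of_eventuallyEq ?_)
    filter_upwards [ζ.open_target.mem_nhds h.zero_mem_target] with s hs
    rw [h.x_symm hs, ← coe_affine hp, sphereCoord_coe, affine_coe, affine_coe]
  rw [coeff, h.symm_zero] at h3
  exact (mul_eq_zero.1 h3).resolve_right (jac_ne_zero h.mem_atlas h.zero_mem_target)

theorem notMem_Ram (h : IsStandardCoordinate C p r ζ) {z : X} (hz : z ∈ ζ.source) (hne : z ≠ p) :
    z ∉ C.Ram := by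
  rintro ⟨r', ζ', hr', h'⟩
  exact h.dx_ne_zero hz hne (h'.dx_eq_zero hr' (h.x_ne_infty hz hne))

theorem meromorphicAt_coeff_dx (h : IsStandardCoordinate C p r ζ) : MeromorphicAt (coeff ζ C.dx) 0 := by
  have h1 : MeromorphicAt (fun t : ℂ => sphereDeriv (C.x p) (t ^ r)) 0 :=
    MeromorphicAt.comp_analyticAt (f := sphereDeriv (C.x p)) (g := fun t : ℂ => t ^ r) (x := 0)
      (by rw [zero_pow h.order_pos.ne']; exact meromorphicAt_sphereDeriv _) (by fun_prop)
  have h2 : MeromorphicAt (fun t : ℂ => (r * t ^ (r - 1) : ℂ)) 0 := AnalyticAt.meromorphicAt (by fun_prop)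
  refine (h1.fun_mul h2).congr ?_
  filter_upwards [self_mem_nhdsWithin, (ζ.open_target.eventually_mem h.zero_mem_target).filter_mono nhdsWithin_le_nhds]
    with t ht ht' using (h.coeff_dx ht' ht).symm

theorem meromorphicAt_coeff (h : IsStandardCoordinate C p r ζ) {φ : X → ℂ}
    (hφ : MeromorphicAt (coeff (chartAt ℂ p) φ) (chartAt ℂ p p)) : MeromorphicAt (coeff ζ φ) 0 := by
  have := meromorphicAt_coeff_of h.mem_atlas (chart_mem_atlas p) h.mem_source (mem_chart_source ℂ p) hφ
  rwa [h.map_center] at this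

theorem residueAt_eq (h : IsStandardCoordinate C p r ζ) {φ : X → ℂ} (hφ : MeromorphicAt (coeff ζ φ) 0) :
    residueAt φ p = res (coeff ζ φ) 0 := by
  have := TopRec.residueAt_eq h.mem_atlas h.mem_source (by rwa [h.map_center])
  rwa [h.map_center] at this

theorem eventually_iff (h : IsStandardCoordinate C p r ζ) {P : X → Prop} :
    (∀ᶠ z in 𝓝[≠] p, P z) ↔ ∀ᶠ t in 𝓝[≠] (0 : ℂ), P (ζ.symm t) := by
  rw [eventually_nhdsNE_iff_chart ζ h.mem_source, h.map_center]

end IsStandardCoordinate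

/-- Every point has a standard coordinate; part of the data of topological recursion. -/
def HasStandardCoordinates (C : SpectralCurve X) : Prop := ∀ p, ∃ r ζ, IsStandardCoordinate C p r ζ

/-- Compatible standard coordinates `ζ p`, of orders `r p`, at the points `p` of the fibre over `b` in the
open set `A`: with `m` a common multiple of the `r p`, the equation `x = sphereCoord b (u ^ m)` is solved
in `A` by the points with `ζ p = (root of unity) * u ^ k p`, for `‖u‖ < ρ`. -/
structure FibreNhd (C : SpectralCurve X) (A : Set X) (b : OnePoint ℂ) where
  P : Finset X
  ζ : X → OpenPartialHomeomorph X ℂ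
  r : X → ℕ
  k : X → ℕ
  m : ℕ
  ρ : ℝ
  ρ_pos : 0 < ρ
  m_pos : 0 < m
  coe_P : (P : Set X) = A ∩ C.x ⁻¹' {b}
  std : ∀ p ∈ P, IsStandardCoordinate C p (r p) (ζ p)
  k_mul : ∀ p ∈ P, k p * r p = m
  target : ∀ p ∈ P, (ζ p).target = ball 0 (ρ ^ k p)
  subset : ∀ p ∈ P, (ζ p).source ⊆ A
  disj : (P : Set X).PairwiseDisjoint fun p => (ζ p).source
  exhaust : ∀ z ∈ A, ∀ v, ‖v‖ < ρ ^ m → C.x z = sphereCoord b v → ∃ p ∈ P, z ∈ (ζ p).source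

/-- Fibre neighbourhoods exist over an open disc over which `x` is proper. -/
theorem exists_fibreNhd [T2Space X] (hstd : HasStandardCoordinates C) {A : Set X} (hA : IsOpen A)
    {D : Set (OnePoint ℂ)} (hD : IsOpen D) (hprop : ∀ K ⊆ D, IsCompact K → IsCompact (A ∩ C.x ⁻¹' K))
    {b : OnePoint ℂ} (hb : b ∈ D) (P : Finset X) (hP : (P : Set X) = A ∩ C.x ⁻¹' {b})
    (O : X → Set X) (hO : ∀ p ∈ P, IsOpen (O p) ∧ p ∈ O p) :
    ∃ N : FibreNhd C A b, N.P = P ∧ ∀ p ∈ P, (N.ζ p).source ⊆ O p := by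
  classical
  choose r ζ hζ using hstd
  have hmemP : ∀ p ∈ P, p ∈ A ∧ C.x p = b := fun p hp => by
    have : p ∈ (P : Set X) := hp
    rwa [hP] at this
  obtain ⟨S, hS, hSd⟩ := P.finite_toSet.t2_separation
  have hε : ∀ p, ∃ ε > 0, p ∈ P → ∀ t ∈ ball (0 : ℂ) ε, t ∈ (ζ p).target ∧ (ζ p).symm t ∈ A ∩ S p ∩ O p := by
    intro p
    by_cases hp : p ∈ P
    · obtain ⟨ε, hε, h⟩ := Metric.eventually_nhds_iff_ball.1 (eventually_mem_target (ζ p) (hζ p).zero_mem_target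
        ((hA.inter (hS p).2).inter (hO p hp).1) (by rw [(hζ p).symm_zero]; exact ⟨⟨(hmemP p hp).1, (hS p).1⟩, (hO p hp).2⟩))
      exact ⟨ε, hε, fun _ => h⟩
    · exact ⟨1, one_pos, fun h => absurd h hp⟩
  choose ε hε hεb using hε
  obtain ⟨ρ₀, hρ₀, hρ₀1, hρ₀ε⟩ : ∃ ρ₀ > 0, ρ₀ ≤ 1 ∧ ∀ p ∈ P, ρ₀ ≤ ε p := by
    rcases P.eq_empty_or_nonempty with rfl | hne
    · exact ⟨1, one_pos, le_rfl, by simp⟩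
    · refine ⟨min 1 (P.inf' hne ε), lt_min one_pos ((Finset.lt_inf'_iff hne).2 fun p _ => hε p), min_le_left _ _,
        fun p hp => (min_le_right _ _).trans (Finset.inf'_le ε hp)⟩
  -- radii `ρ ^ k p` with `k p * r p` independent of `p`, so that all members have the same image under `x`
  set m := ∏ p ∈ P, r p
  set k : X → ℕ := fun p => ∏ p' ∈ P.erase p, r p'
  have hk : ∀ p, 0 < k p := fun p => Finset.prod_pos fun p' _ => (hζ p').order_pos
  have hkm : ∀ p ∈ P, k p * r p = m := fun p hp => Finset.prod_erase_mul _ _ hp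
  have hm : 0 < m := Finset.prod_pos fun p' _ => (hζ p').order_pos
  set W : Set X := ⋃ p ∈ P, (ζ p).source ∩ ζ p ⁻¹' ball 0 (ρ₀ ^ k p)
  have hW : IsOpen W := isOpen_biUnion fun p _ => (ζ p).isOpen_inter_preimage isOpen_ball
  -- by properness, the points of `A` over a neighbourhood of `b` lie in `W`
  obtain ⟨K, hK, hbK, hKD⟩ := exists_compact_subset hD hb
  set L : Set (OnePoint ℂ) := C.x '' ((A ∩ C.x ⁻¹' K) \ W)
  have hL : IsClosed L := (((hprop K hKD hK).diff hW).image C.continuous_x).isClosed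
  have hbL : b ∉ L := by
    rintro ⟨z, ⟨⟨hzA, -⟩, hzW⟩, hz⟩
    have hzP : z ∈ P := by
      have : z ∈ (P : Set X) := by rw [hP]; exact ⟨hzA, hz⟩
      exact this
    refine hzW (mem_biUnion hzP ⟨(hζ z).mem_source, ?_⟩)
    rw [mem_preimage, (hζ z).map_center]
    exact mem_ball_self (pow_pos hρ₀ _)
  have hN : ∀ᶠ v in 𝓝 (0 : ℂ), sphereCoord b v ∈ interior K ∩ Lᶜ := by
    refine (continuousAt_sphereCoord b).eventually ?_
    rw [sphereCoord_zero]
    exact (isOpen_interior.inter hL.isOpen_compl).mem_nhds ⟨hbK, hbL⟩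
  obtain ⟨δ, hδ, hδb⟩ := Metric.eventually_nhds_iff_ball.1 hN
  set ρ := min ρ₀ δ
  have hρ : 0 < ρ := lt_min hρ₀ hδ
  have hρ1 : ρ ≤ 1 := (min_le_left _ _).trans hρ₀1
  have hρε : ∀ p ∈ P, ρ ^ k p ≤ ε p := fun p hp =>
    (pow_le_of_le_one hρ.le hρ1 (hk p).ne').trans ((min_le_left _ _).trans (hρ₀ε p hp))
  have hex : ∀ p, ∃ ζ' : OpenPartialHomeomorph X ℂ, p ∈ P → IsStandardCoordinate C p (r p) ζ' ∧
      ζ'.target = ball 0 (ρ ^ k p) ∧ ζ'.source = (ζ p).source ∩ ζ p ⁻¹' ball 0 (ρ ^ k p) := by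
    intro p
    by_cases hp : p ∈ P
    · obtain ⟨ζ', h1, h2, h3, -, -⟩ := (hζ p).exists_restrict (pow_pos hρ (k p))
        fun t ht => (hεb p hp t (ball_subset_ball (hρε p hp) ht)).1
      exact ⟨ζ', fun _ => ⟨h1, h2, h3⟩⟩
    · exact ⟨ζ p, fun h => absurd h hp⟩
  choose ζ' hζ' using hex
  have hsub : ∀ p ∈ P, (ζ' p).source ⊆ A ∩ S p ∩ O p := by
    intro p hp z hz
    rw [(hζ' p hp).2.2] at hz
    have := (hεb p hp _ (ball_subset_ball (hρε p hp) hz.2)).2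
    rwa [(ζ p).left_inv hz.1] at this
  refine ⟨⟨P, ζ', r, k, m, ρ, hρ, hm, hP, fun p hp => (hζ' p hp).1, hkm, fun p hp => (hζ' p hp).2.1,
    fun p hp => (hsub p hp).trans (inter_subset_left.trans inter_subset_left),
    fun p hp p' hp' hne => (hSd hp hp' hne).mono ((hsub p hp).trans fun z hz => hz.1.2)
      ((hsub p' hp').trans fun z hz => hz.1.2), ?_⟩, rfl, fun p hp => (hsub p hp).trans inter_subset_right⟩
  intro z hz v hv hxz
  have hvδ : v ∈ ball (0 : ℂ) δ := by
    rw [mem_ball_zero_iff]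
    exact hv.trans_le ((pow_le_of_le_one hρ.le hρ1 hm.ne').trans (min_le_right _ _))
  have h1 := hδb v hvδ
  rw [← hxz] at h1
  have hzW : z ∈ W := by
    by_contra hzW
    exact h1.2 ⟨z, ⟨⟨hz, (interior_subset h1.1 : C.x z ∈ K)⟩, hzW⟩, rfl⟩
  obtain ⟨p, hp, hzp⟩ := mem_iUnion₂.1 hzW
  refine ⟨p, hp, ?_⟩
  rw [(hζ' p hp).2.2]
  refine ⟨hzp.1, ?_⟩
  rw [(hζ p).x_eq hzp.1, (hmemP p hp).2] at hxz
  rw [mem_preimage, mem_ball_zero_iff]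
  rw [← sphereCoord_injective b hxz, norm_pow, ← hkm p hp, pow_mul] at hv
  exact lt_of_pow_lt_pow_left₀ _ (by positivity) hv

namespace FibreNhd

variable {A : Set X} {b : OnePoint ℂ} (N : FibreNhd C A b)

theorem k_pos {p : X} (hp : p ∈ N.P) : 0 < N.k p :=
  Nat.pos_of_mul_pos_right (b := N.r p) (by rw [N.k_mul p hp]; exact N.m_pos)

theorem x_center {p : X} (hp : p ∈ N.P) : C.x p = b := by
  have : p ∈ (N.P : Set X) := hp
  rw [N.coe_P] at this
  exact this.2

/-- The points over `sphereCoord b (u ^ m)` near the points of `S`, where `S ⊆ P`, are indexed by a point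
of `S` and the exponent of a root of unity. -/
def idx (S : Finset X) : Finset (Σ _ : X, ℕ) := S.sigma fun p => Finset.range (N.r p)

/-- The solution with index `i` of `x = sphereCoord b (u ^ m)`. -/
noncomputable def arc (i : Σ _ : X, ℕ) (u : ℂ) : X :=
  (N.ζ i.1).symm (zetaRoot (N.r i.1) i.2 * u ^ N.k i.1)

theorem mem_idx {S : Finset X} {i : Σ _ : X, ℕ} : i ∈ N.idx S ↔ i.1 ∈ S ∧ i.2 < N.r i.1 := by
  simp [idx]

variable {N} {i : Σ _ : X, ℕ} {u : ℂ}

theorem mem_target_of_norm_lt (hi : i.1 ∈ N.P) (hu : ‖u‖ < N.ρ) :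
    zetaRoot (N.r i.1) i.2 * u ^ N.k i.1 ∈ (N.ζ i.1).target := by
  rw [N.target _ hi, mem_ball_zero_iff, norm_mul, norm_zetaRoot (N.std _ hi).order_pos, one_mul, norm_pow]
  exact pow_lt_pow_left₀ hu (norm_nonneg u) (N.k_pos hi).ne'

theorem arc_mem_source (hi : i.1 ∈ N.P) (hu : ‖u‖ < N.ρ) : N.arc i u ∈ (N.ζ i.1).source :=
  (N.ζ i.1).map_target (mem_target_of_norm_lt hi hu)

theorem ζ_arc (hi : i.1 ∈ N.P) (hu : ‖u‖ < N.ρ) :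
    N.ζ i.1 (N.arc i u) = zetaRoot (N.r i.1) i.2 * u ^ N.k i.1 :=
  (N.ζ i.1).right_inv (mem_target_of_norm_lt hi hu)

theorem arc_zero (hi : i.1 ∈ N.P) : N.arc i 0 = i.1 := by
  rw [arc, zero_pow (N.k_pos hi).ne', mul_zero, (N.std _ hi).symm_zero]

theorem x_arc (hi : i.1 ∈ N.P) (hu : ‖u‖ < N.ρ) : C.x (N.arc i u) = sphereCoord b (u ^ N.m) := by
  rw [(N.std _ hi).x_eq (arc_mem_source hi hu), ζ_arc hi hu, N.x_center hi, mul_pow,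
    zetaRoot_pow (N.std _ hi).order_pos, one_mul, ← pow_mul, N.k_mul _ hi]

theorem arc_ne (hi : i.1 ∈ N.P) (hu : ‖u‖ < N.ρ) (h0 : u ≠ 0) : N.arc i u ≠ i.1 := by
  intro h
  have := ζ_arc hi hu
  rw [h, (N.std _ hi).map_center] at this
  exact mul_ne_zero (zetaRoot_ne_zero _ _) (pow_ne_zero _ h0) this.symm

theorem arc_notMem_Ram (hi : i.1 ∈ N.P) (hu : ‖u‖ < N.ρ) (h0 : u ≠ 0) : N.arc i u ∉ C.Ram :=
  (N.std _ hi).notMem_Ram (arc_mem_source hi hu) (arc_ne hi hu h0)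

theorem arc_injOn (hu : ‖u‖ < N.ρ) (h0 : u ≠ 0) : InjOn (fun i => N.arc i u) (N.idx N.P) := by
  rintro ⟨p, j⟩ hi ⟨p', j'⟩ hi' h
  rw [Finset.mem_coe, mem_idx] at hi hi'
  have h1 : N.arc ⟨p, j⟩ u ∈ (N.ζ p).source := arc_mem_source hi.1 hu
  have h2 : N.arc ⟨p', j'⟩ u ∈ (N.ζ p').source := arc_mem_source hi'.1 hu
  have hpp : p = p' := by
    by_contra hne
    exact (N.disj hi.1 hi'.1 hne).le_bot ⟨h1, by simp only at h; rw [h]; exact h2⟩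
  subst hpp
  have h3 := congrArg (N.ζ p) h
  rw [ζ_arc (i := ⟨p, j⟩) hi.1 hu, ζ_arc (i := ⟨p, j'⟩) hi'.1 hu] at h3
  have h4 := zetaRoot_injOn (N.std p hi.1).order_pos (Finset.mem_coe.2 (Finset.mem_range.2 hi.2))
    (Finset.mem_coe.2 (Finset.mem_range.2 hi'.2)) (mul_right_cancel₀ (pow_ne_zero _ h0) h3)
  exact congrArg (Sigma.mk p) h4

/-- The points of a fibre near `S` are the values of the arcs. -/
theorem fiber_inter_eq {S : Finset X} (hS : S ⊆ N.P) (hu : ‖u‖ < N.ρ) :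
    C.x ⁻¹' {sphereCoord b (u ^ N.m)} ∩ ⋃ p ∈ S, (N.ζ p).source = (fun i => N.arc i u) '' N.idx S := by
  ext z
  constructor
  · rintro ⟨hz, hz'⟩
    obtain ⟨p, hp, hzp⟩ := mem_iUnion₂.1 hz'
    have hpP := hS hp
    rw [mem_preimage, mem_singleton_iff, (N.std p hpP).x_eq hzp, N.x_center hpP] at hz
    have h1 := sphereCoord_injective b hz
    rw [← N.k_mul p hpP, pow_mul] at h1
    obtain ⟨j, hj, e⟩ := exists_zetaRoot_mul (N.std p hpP).order_pos h1
    refine ⟨⟨p, j⟩, Finset.mem_coe.2 (N.mem_idx.2 ⟨hp, Finset.mem_range.1 hj⟩), ?_⟩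
    simp only [arc]
    rw [← e, (N.ζ p).left_inv hzp]
  · rintro ⟨i, hi, rfl⟩
    rw [Finset.mem_coe, mem_idx] at hi
    exact ⟨x_arc (hS hi.1) hu, mem_biUnion hi.1 (arc_mem_source (hS hi.1) hu)⟩

theorem fiber_inter_A_eq (hu : ‖u‖ < N.ρ) :
    C.x ⁻¹' {sphereCoord b (u ^ N.m)} ∩ A = C.x ⁻¹' {sphereCoord b (u ^ N.m)} ∩ ⋃ p ∈ N.P, (N.ζ p).source := by
  ext z
  constructor
  · rintro ⟨hz, hzA⟩
    obtain ⟨p, hp, h⟩ := N.exhaust z hzA (u ^ N.m) (by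
      rw [norm_pow]; exact pow_lt_pow_left₀ hu (norm_nonneg u) N.m_pos.ne') hz
    exact ⟨hz, mem_biUnion hp h⟩
  · rintro ⟨hz, hz'⟩
    obtain ⟨p, hp, hzp⟩ := mem_iUnion₂.1 hz'
    exact ⟨hz, N.subset p hp hzp⟩

theorem eventually_norm_lt (N : FibreNhd C A b) : ∀ᶠ u in 𝓝[≠] (0 : ℂ), ‖u‖ < N.ρ ∧ u ≠ 0 := by
  filter_upwards [self_mem_nhdsWithin, mem_nhdsWithin_of_mem_nhds (ball_mem_nhds (0 : ℂ) N.ρ_pos)] with u h h'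
  exact ⟨by simpa using h', h⟩

theorem continuousAt_arc (hi : i.1 ∈ N.P) : ContinuousAt (N.arc i) 0 := by
  refine ContinuousAt.comp (g := (N.ζ i.1).symm) (f := fun u => zetaRoot (N.r i.1) i.2 * u ^ N.k i.1) ?_ (by fun_prop)
  refine (N.ζ i.1).continuousAt_symm (mem_target_of_norm_lt hi ?_)
  rw [norm_zero]
  exact N.ρ_pos

theorem analyticAt_chart_arc (hi : i.1 ∈ N.P) :
    AnalyticAt ℂ (fun u => chartAt ℂ (N.arc i 0) (N.arc i u)) 0 := by
  have h0 : zetaRoot (N.r i.1) i.2 * (0 : ℂ) ^ N.k i.1 = 0 := by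
    rw [zero_pow (N.k_pos hi).ne', mul_zero]
  have h1 := analyticAt_transition (N.std _ hi).mem_atlas (chart_mem_atlas (X := X) (N.arc i 0))
    (N.std _ hi).zero_mem_target (by rw [(N.std _ hi).symm_zero, arc_zero hi]; exact mem_chart_source ℂ _)
  exact AnalyticAt.comp_of_eq (f := fun u : ℂ => zetaRoot (N.r i.1) i.2 * u ^ N.k i.1) h1 (by fun_prop) h0

end FibreNhd

end Fibres

/-! ### Meromorphy of `𝒲'` along the points of a fibre -/

section Reindex

open Classical in
/-- The image of a partition under an embedding. -/
noncomputable def mapPartition {ι X : Type*} (e : ι ↪ X) {J : Finset ι} (P : Finpartition J) :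
    Finpartition (J.map e) :=
  Finpartition.ofExistsUnique (P.parts.map (Finset.mapEmbedding e).toEmbedding)
    (by
      intro L hL
      obtain ⟨L', hL', rfl⟩ := Finset.mem_map.1 hL
      exact Finset.map_subset_map.2 (P.le hL'))
    (by
      intro a ha
      obtain ⟨i, hi, rfl⟩ := Finset.mem_map.1 ha
      obtain ⟨L, ⟨hL, hiL⟩, huniq⟩ := P.existsUnique_mem hi
      refine ⟨L.map e, ⟨Finset.mem_map_of_mem _ hL, Finset.mem_map_of_mem _ hiL⟩, ?_⟩
      rintro L' ⟨hL', hiL'⟩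
      obtain ⟨L'', hL'', rfl⟩ := Finset.mem_map.1 hL'
      rw [huniq L'' ⟨hL'', (Finset.mem_map' e).1 hiL'⟩]
      rfl)
    (by
      intro h
      obtain ⟨L, hL, h0⟩ := Finset.mem_map.1 h
      have : L = ∅ := Finset.map_eq_empty.1 h0
      exact P.ne_empty hL this)

open Classical in
theorem mapPartition_bijective {ι X : Type*} (e : ι ↪ X) (J : Finset ι) :
    Function.Bijective (mapPartition e : Finpartition J → Finpartition (J.map e)) := by
  constructor
  · intro P P' h
    have h1 : P.parts.map (Finset.mapEmbedding e).toEmbedding = P'.parts.map (Finset.mapEmbedding e).toEmbedding :=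
      congrArg Finpartition.parts h
    exact Finpartition.ext (Finset.map_injective _ h1)
  · intro Q
    have hmap : ∀ L ∈ Q.parts, (L.preimage e e.injective.injOn).map e = L := by
      intro L hL
      ext a
      simp only [Finset.mem_map, Finset.mem_preimage]
      constructor
      · rintro ⟨i, hi, rfl⟩; exact hi
      · intro ha
        obtain ⟨i, hi, rfl⟩ := Finset.mem_map.1 (Q.le hL ha)
        exact ⟨i, ha, rfl⟩
    let P : Finpartition J := Finpartition.ofExistsUnique
      (Q.parts.image fun L => L.preimage e e.injective.injOn)
      (by
        intro L hL i hi
        obtain ⟨L', hL', rfl⟩ := Finset.mem_image.1 hL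
        exact (Finset.mem_map' e).1 (Q.le hL' (Finset.mem_preimage.1 hi)))
      (by
        intro i hi
        obtain ⟨L, ⟨hL, hiL⟩, huniq⟩ := Q.existsUnique_mem (Finset.mem_map_of_mem e hi)
        refine ⟨L.preimage e e.injective.injOn, ⟨Finset.mem_image_of_mem _ hL, Finset.mem_preimage.2 hiL⟩, ?_⟩
        rintro L' ⟨hL', hiL'⟩
        obtain ⟨L'', hL'', rfl⟩ := Finset.mem_image.1 hL'
        rw [huniq L'' ⟨hL'', Finset.mem_preimage.1 hiL'⟩])
      (by
        intro h
        obtain ⟨L, hL, h0⟩ := Finset.mem_image.1 h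
        have h1 := hmap L hL
        rw [h0, Finset.map_empty] at h1
        exact Q.ne_empty hL h1.symm)
    refine ⟨P, Finpartition.ext ?_⟩
    change (Q.parts.image _).map _ = Q.parts
    ext L
    simp only [Finset.mem_map, Finset.mem_image]
    constructor
    · rintro ⟨_, ⟨L', hL', rfl⟩, rfl⟩
      change (L'.preimage e e.injective.injOn).map e ∈ Q.parts
      rwa [hmap L' hL']
    · intro hL
      exact ⟨_, ⟨L, hL, rfl⟩, hmap L hL⟩

variable {X : Type*} [TopologicalSpace X] [ChartedSpace ℂ X] {C : SpectralCurve X}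

open Classical in
/-- The correlator sum `𝒲'` at the points of an indexed family. -/
theorem Wprime_map (ω : Correlators C) (g : ℕ) {ι : Type*} (J : Finset ι) (e : ι ↪ X) {n : ℕ} (w : Fin n → X) :
    ω.Wprime g (J.map e) w = ∑ P : Finpartition J, ∑ M : Fin n → P.parts, ∑ h : P.parts → Fin (g + 1),
      if J.card + ∑ L, (h L : ℕ) = g + P.parts.card ∧
          ∀ L, ¬ ((h L : ℕ) = 0 ∧ L.1.card = 1 ∧ ∀ k, M k ≠ L)
      then ∏ L, ω.corr (h L) (L.1.val.map e + (Finset.univ.filter fun k => M k = L).val.map w)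
      else 0 := by
  unfold Correlators.Wprime
  rw [← (mapPartition_bijective e J).sum_comp]
  refine Finset.sum_congr rfl fun P _ => ?_
  let E : P.parts ≃ (mapPartition e P).parts := Equiv.ofBijective
    (fun L => ⟨L.1.map e, Finset.mem_map_of_mem (Finset.mapEmbedding e).toEmbedding L.2⟩) (by
      constructor
      · intro L L' h
        exact Subtype.ext (Finset.map_injective e (congrArg Subtype.val h))
      · rintro ⟨L, hL⟩
        obtain ⟨L', hL', h⟩ := Finset.mem_map.1 hL
        exact ⟨⟨L', hL'⟩, Subtype.ext h⟩)
  have hE : ∀ L, (E L).1 = L.1.map e := fun L => rfl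
  rw [← Equiv.sum_comp (Equiv.arrowCongr (Equiv.refl (Fin n)) E)]
  refine Finset.sum_congr rfl fun M _ => ?_
  rw [← Equiv.sum_comp (Equiv.arrowCongr E (Equiv.refl (Fin (g + 1))))]
  refine Finset.sum_congr rfl fun h _ => ?_
  have hh : ∀ L, (Equiv.arrowCongr E (Equiv.refl (Fin (g + 1)))) h (E L) = h L := fun L => by
    simp [Equiv.arrowCongr]
  have hM : ∀ k, (Equiv.arrowCongr (Equiv.refl (Fin n)) E) M k = E (M k) := fun k => by
    simp [Equiv.arrowCongr]
  have hcard : (mapPartition e P).parts.card = P.parts.card := Finset.card_map _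
  rw [← Equiv.sum_comp E, ← Equiv.prod_comp E, Finset.card_map, hcard]
  refine if_congr (and_congr (by simp only [hh]) ?_) (Finset.prod_congr rfl fun L _ => ?_) rfl
  · rw [E.surjective.forall]
    refine forall_congr' fun L => ?_
    simp only [hh, hM, hE, Finset.card_map, ne_eq, E.injective.eq_iff]
  · simp only [hh, hM, hE, E.injective.eq_iff, Finset.map_val]

end Reindex

section Arcs

variable {X : Type*} [TopologicalSpace X] [ChartedSpace ℂ X]

/-- `c` is a holomorphic map near `0` that avoids `R` except possibly at `0`. -/
structure IsArc (R : Set X) (c : ℂ → X) : Prop where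
  continuousAt : ContinuousAt c 0
  analyticAt : AnalyticAt ℂ (fun u => chartAt ℂ (c 0) (c u)) 0
  notMem : ∀ᶠ u in 𝓝[≠] 0, c u ∉ R

/-- The Jacobian of the chart at `c 0` along the arc `c`. -/
noncomputable def arcJac (c : ℂ → X) (u : ℂ) : ℂ := jac (chartAt ℂ (c 0)) (chartAt ℂ (c 0) (c u))

variable {R : Set X} {c : ℂ → X}

theorem isArc_const {z : X} (hz : z ∉ R) : IsArc R fun _ => z :=
  ⟨continuousAt_const, analyticAt_const, Eventually.of_forall fun _ => hz⟩

theorem arcJac_const (z : X) (u : ℂ) : arcJac (fun _ => z) u = 1 := jac_chartAt_self z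

theorem IsArc.eventually_mem_source (h : IsArc R c) : ∀ᶠ u in 𝓝 0, c u ∈ (chartAt ℂ (c 0)).source :=
  h.continuousAt.eventually ((chartAt ℂ (c 0)).open_source.mem_nhds (mem_chart_source ℂ _))

theorem IsArc.eventually_coeff (h : IsArc R c) (φ : X → ℂ) :
    ∀ᶠ u in 𝓝 0, coeff (chartAt ℂ (c 0)) φ (chartAt ℂ (c 0) (c u)) = φ (c u) * arcJac c u := by
  filter_upwards [h.eventually_mem_source] with u hu
  rw [coeff, (chartAt ℂ (c 0)).left_inv hu, arcJac]

theorem IsArc.meromorphicAt (h : IsArc R c) {φ : X → ℂ}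
    (hφ : MeromorphicAt (coeff (chartAt ℂ (c 0)) φ) (chartAt ℂ (c 0) (c 0))) :
    MeromorphicAt (fun u => φ (c u) * arcJac c u) 0 :=
  (hφ.comp_analyticAt (g := fun u => chartAt ℂ (c 0) (c u)) h.analyticAt).congr
    ((h.eventually_coeff φ).filter_mono nhdsWithin_le_nhds)

variable [IsManifold 𝓘(ℂ) ⊤ X]

theorem IsArc.eventually_arcJac_ne_zero (h : IsArc R c) : ∀ᶠ u in 𝓝 0, arcJac c u ≠ 0 := by
  filter_upwards [h.eventually_mem_source] with u hu
  exact jac_ne_zero (chart_mem_atlas _) ((chartAt ℂ (c 0)).map_source hu)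

/-- Pulled back along a tuple of arcs, a multidifferential with poles in `R` is meromorphic in the common
parameter: an arc through a point of `R` meets `R` at isolated times only, so the denominators do not
vanish identically. -/
theorem meromorphicAt_along_arcs {N : ℕ} {φ : (Fin N → X) → ℂ} (hφ : IsMeromorphicWithPolesIn R φ)
    {c : Fin N → ℂ → X} (hc : ∀ i, IsArc R (c i)) :
    MeromorphicAt (fun u => φ (fun i => c i u) * ∏ i, arcJac (c i) u) 0 := by
  classical
  obtain ⟨K, G, hG, he⟩ := hφ fun i => c i 0
  set t : ℂ → Fin N → ℂ := fun u i => chartAt ℂ (c i 0) (c i u)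
  have ht : AnalyticAt ℂ t 0 := analyticAt_pi_iff.2 fun i => (hc i).analyticAt
  set Dn : ℂ → ℂ := fun u => ∏ i, if c i 0 ∈ R then (t u i - chartAt ℂ (c i 0) (c i 0)) ^ K else 1
  have hDn : AnalyticAt ℂ Dn 0 := by
    refine Finset.analyticAt_fun_prod _ fun i _ => ?_
    split_ifs
    · exact (((hc i).analyticAt).sub analyticAt_const).pow K
    · exact analyticAt_const
  have hGt : AnalyticAt ℂ (fun u => G (t u)) 0 := AnalyticAt.comp_of_eq hG ht rfl
  refine (hGt.meromorphicAt.fun_div hDn.meromorphicAt).congr ?_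
  have hsrc : ∀ᶠ u in 𝓝 0, ∀ i, c i u ∈ (chartAt ℂ (c i 0)).source :=
    eventually_all.2 fun i => (hc i).eventually_mem_source
  have hR : ∀ᶠ u in 𝓝[≠] 0, ∀ i, c i u ∉ R := eventually_all.2 fun i => (hc i).notMem
  filter_upwards [hsrc.filter_mono nhdsWithin_le_nhds, hR,
    (ht.continuousAt.eventually he).filter_mono nhdsWithin_le_nhds] with u h1 h2 h3
  have hinv : ∀ i, (chartAt ℂ (c i 0)).symm (t u i) = c i u := fun i => (chartAt ℂ (c i 0)).left_inv (h1 i)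
  simp only [hinv] at h3
  have h4 := h3 h2
  have hne : Dn u ≠ 0 := by
    refine Finset.prod_ne_zero_iff.2 fun i _ => ?_
    split_ifs with hi
    · refine pow_ne_zero _ (sub_ne_zero.2 fun h => h2 i ?_)
      rw [(chartAt ℂ (c i 0)).injOn (h1 i) (mem_chart_source ℂ _) h]
      exact hi
    · exact one_ne_zero
  rw [← h4]
  exact mul_div_cancel_right₀ _ hne

/-- The pole of `ω02` on the diagonal causes no trouble for two arcs that are distinct off `0`. -/
theorem meromorphicAt_ω02_along_arcs (C : SpectralCurve X) {c c' : ℂ → X} (hc : IsArc R c) (hc' : IsArc R c')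
    (hne : ∀ᶠ u in 𝓝[≠] 0, c u ≠ c' u) :
    MeromorphicAt (fun u => C.ω02 (c u) (c' u) * (arcJac c u * arcJac c' u)) 0 := by
  have ht : AnalyticAt ℂ (fun u => (chartAt ℂ (c 0) (c u), chartAt ℂ (c' 0) (c' u))) 0 :=
    hc.analyticAt.prod hc'.analyticAt
  have hev : ∀ᶠ u in 𝓝[≠] 0, coeff₂ (chartAt ℂ (c 0)) (chartAt ℂ (c' 0)) C.ω02
      (chartAt ℂ (c 0) (c u), chartAt ℂ (c' 0) (c' u)) = C.ω02 (c u) (c' u) * (arcJac c u * arcJac c' u) := by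
    filter_upwards [hc.eventually_mem_source.filter_mono nhdsWithin_le_nhds,
      hc'.eventually_mem_source.filter_mono nhdsWithin_le_nhds] with u h1 h2
    rw [coeff₂, (chartAt ℂ (c 0)).left_inv h1, (chartAt ℂ (c' 0)).left_inv h2, arcJac, arcJac]
  refine MeromorphicAt.congr ?_ hev
  by_cases h0 : c 0 = c' 0
  · obtain ⟨G, hG, he⟩ := C.ω02_fundamental.diagonal (c 0)
    rw [← h0] at ht ⊢
    have hGt : AnalyticAt ℂ (fun u => G (chartAt ℂ (c 0) (c u), chartAt ℂ (c 0) (c' u))) 0 :=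
      AnalyticAt.comp_of_eq hG ht (by rw [h0])
    have hc'an := hc'.analyticAt
    rw [← h0] at hc'an
    have h1 : MeromorphicAt (fun u => 1 / (chartAt ℂ (c 0) (c u) - chartAt ℂ (c 0) (c' u)) ^ 2) 0 :=
      (MeromorphicAt.const 1 _).fun_div ((hc.analyticAt.sub hc'an).pow 2).meromorphicAt
    refine (h1.fun_add hGt.meromorphicAt).congr ?_
    have hlim : ContinuousAt (fun u => (chartAt ℂ (c 0) (c u), chartAt ℂ (c 0) (c' u))) 0 := ht.continuousAt
    have he' : ∀ᶠ t in 𝓝 (chartAt ℂ (c 0) (c 0), chartAt ℂ (c 0) (c' 0)), t.1 ≠ t.2 →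
      coeff₂ (chartAt ℂ (c 0)) (chartAt ℂ (c 0)) C.ω02 t = 1 / (t.1 - t.2) ^ 2 + G t := by rwa [← h0]
    have hsrc' := hc'.eventually_mem_source
    rw [← h0] at hsrc'
    filter_upwards [(hlim.eventually he').filter_mono nhdsWithin_le_nhds, hne,
      hc.eventually_mem_source.filter_mono nhdsWithin_le_nhds, hsrc'.filter_mono nhdsWithin_le_nhds]
      with u h1 h2 h3 h4
    exact (h1 fun h => h2 ((chartAt ℂ (c 0)).injOn h3 h4 h)).symm
  · exact (AnalyticAt.comp_of_eq (C.ω02_fundamental.off_diagonal _ _ h0) ht rfl).meromorphicAt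

theorem pts_eq_coe {n : ℕ} (w : Fin n → X) : pts w = (List.ofFn w : Multiset X) := by
  simp [pts, List.ofFn_eq_map, Fin.univ_val_map]

variable {C : SpectralCurve X}

/-- A stable correlator, or `ω02`, is meromorphic along arcs. -/
theorem meromorphicAt_corr_along_arcs (ω : Correlators C) {g : ℕ} {m : Multiset (ℂ → X)}
    (hm : ∀ c ∈ m, IsArc C.Ram c)
    (h : 0 < m.card ∧ 2 < 2 * g + m.card ∨ g = 0 ∧ ∃ c c', m = {c, c'} ∧ ∀ᶠ u in 𝓝[≠] 0, c u ≠ c' u) :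
    MeromorphicAt (fun u => ω.corr g (m.map fun c => c u) * (m.map fun c => arcJac c u).prod) 0 := by
  rcases h with ⟨h0, h⟩ | ⟨rfl, c, c', rfl, hne⟩
  · induction m using Quotient.inductionOn with
    | h l =>
      have h1 := meromorphicAt_along_arcs (ω.poles g l.length h0 h) (c := l.get) fun i => hm _ (List.get_mem l i)
      refine h1.congr (Eventually.of_forall fun u => ?_)
      simp only [Multiset.quot_mk_to_coe, Multiset.map_coe, Multiset.prod_coe, pts_eq_coe]
      have hof : List.ofFn (fun i => l.get i u) = l.map fun c => c u := by
        conv_rhs => rw [← List.ofFn_get l, List.map_ofFn]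
        rfl
      have hof' : List.ofFn (fun i => arcJac (l.get i) u) = l.map fun c => arcJac c u := by
        conv_rhs => rw [← List.ofFn_get l, List.map_ofFn]
        rfl
      rw [hof, ← List.prod_ofFn, hof']
  · have := meromorphicAt_ω02_along_arcs C (hm c (by simp)) (hm c' (by simp)) hne
    simpa [← ω.corr_02] using this

/-- `dx` is meromorphic along arcs, at poles of `x` too, as standard coordinates show. -/
theorem IsArc.meromorphicAt_dx (hstd : HasStandardCoordinates C) {c : ℂ → X} (h : IsArc C.Ram c) :
    MeromorphicAt (fun u => C.dx (c u) * arcJac c u) 0 := by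
  refine h.meromorphicAt ?_
  obtain ⟨r, ζ, hζ⟩ := hstd (c 0)
  refine meromorphicAt_coeff_of (chart_mem_atlas _) hζ.mem_atlas (mem_chart_source ℂ _) hζ.mem_source ?_
  rw [hζ.map_center]
  exact hζ.meromorphicAt_coeff_dx

theorem IsArc.meromorphicAt_y (hstd : HasStandardCoordinates C) {c : ℂ → X} (h : IsArc C.Ram c) :
    MeromorphicAt (fun u => C.y (c u)) 0 := by
  refine ((h.meromorphicAt (C.ω01_meromorphic (c 0))).fun_div (h.meromorphicAt_dx hstd)).congr ?_
  filter_upwards [h.eventually_arcJac_ne_zero.filter_mono nhdsWithin_le_nhds] with u hu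
  rw [mul_div_mul_right _ _ hu, SpectralCurve.y]

open Classical in
/-- `𝒲'` is meromorphic along distinct arcs: it is a finite sum of products of correlators, each of which
is either stable, so that its poles are in `Ram`, or an `ω02` off the diagonal, since factors `ω01` are
left out. -/
theorem meromorphicAt_Wprime_univ (hstd : HasStandardCoordinates C) (ω : Correlators C) (g : ℕ) {ι : Type*}
    [Fintype ι] {c : ι → ℂ → X} (hc : ∀ i, IsArc C.Ram (c i))
    (hinj : ∀ᶠ u in 𝓝[≠] 0, Function.Injective fun i => c i u) {n : ℕ} {w : Fin n → X}
    (hw : ∀ k, w k ∉ C.Ram) (hcw : ∀ i k, ∀ᶠ u in 𝓝[≠] 0, c i u ≠ w k) :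
    MeromorphicAt (fun u => ω.Wprime g (Finset.univ.image fun i => c i u) w / ∏ i, C.dx (c i u)) 0 := by
  set J : Finset ι := Finset.univ
  have key : MeromorphicAt (fun u => ∑ P : Finpartition J, ∑ M : Fin n → P.parts, ∑ h : P.parts → Fin (g + 1),
      if J.card + ∑ L, (h L : ℕ) = g + P.parts.card ∧
          ∀ L, ¬ ((h L : ℕ) = 0 ∧ L.1.card = 1 ∧ ∀ k, M k ≠ L)
      then ∏ L, (ω.corr (h L) (L.1.val.map (fun i => c i u) + (Finset.univ.filter fun k => M k = L).val.map w) /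
        ∏ i ∈ L.1, C.dx (c i u))
      else 0) 0 := by
    refine MeromorphicAt.fun_sum (fun P _ => ?_)
    refine MeromorphicAt.fun_sum (fun M _ => ?_)
    refine MeromorphicAt.fun_sum (fun h _ => ?_)
    split_ifs with hcond
    swap
    · exact MeromorphicAt.const 0 0
    refine MeromorphicAt.fun_prod fun L _ => ?_
    set K := Finset.univ.filter fun k => M k = L
    set m : Multiset (ℂ → X) := L.1.val.map c + K.val.map fun k _ => w k
    have hm : ∀ c' ∈ m, IsArc C.Ram c' := by
      intro c' hc'
      rcases Multiset.mem_add.1 hc' with h' | h'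
      · obtain ⟨i, -, rfl⟩ := Multiset.mem_map.1 h'; exact hc i
      · obtain ⟨k, -, rfl⟩ := Multiset.mem_map.1 h'; exact isArc_const (hw k)
    have hcard : m.card = L.1.card + K.card := by simp [m]
    have hL : 0 < L.1.card := Finset.card_pos.2 (P.nonempty_of_mem_parts L.2)
    have hcases : 0 < m.card ∧ 2 < 2 * (h L : ℕ) + m.card ∨
        (h L : ℕ) = 0 ∧ ∃ c₁ c₂, m = {c₁, c₂} ∧ ∀ᶠ u in 𝓝[≠] 0, c₁ u ≠ c₂ u := by
      by_cases h2 : 2 < 2 * (h L : ℕ) + m.card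
      · exact Or.inl ⟨by omega, h2⟩
      · right
        have h0 : (h L : ℕ) = 0 := by omega
        refine ⟨h0, ?_⟩
        rcases (show L.1.card = 1 ∧ K.card = 0 ∨ L.1.card = 1 ∧ K.card = 1 ∨ L.1.card = 2 ∧ K.card = 0 by omega)
          with ⟨h1, h3⟩ | ⟨h1, h3⟩ | ⟨h1, h3⟩
        · exfalso
          refine hcond.2 L ⟨h0, h1, fun k hk => ?_⟩
          exact Finset.notMem_empty k (Finset.card_eq_zero.1 h3 ▸ Finset.mem_filter.2 ⟨Finset.mem_univ k, hk⟩)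
        · obtain ⟨i, hi⟩ := Finset.card_eq_one.1 h1
          obtain ⟨k, hk⟩ := Finset.card_eq_one.1 h3
          refine ⟨c i, fun _ => w k, ?_, hcw i k⟩
          simp [m, hi, hk]
        · obtain ⟨i, j, hij, hi⟩ := Finset.card_eq_two.1 h1
          refine ⟨c i, c j, ?_, ?_⟩
          · have : L.1.val = {i, j} := by
              rw [hi, Finset.insert_val_of_notMem (by simpa using hij)]
              rfl
            simp [m, Finset.card_eq_zero.1 h3, this]
          · filter_upwards [hinj] with u hu h
            exact hij (hu h)
    have h1 := meromorphicAt_corr_along_arcs ω hm hcases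
    have h2 : MeromorphicAt (fun u => ∏ i ∈ L.1, (C.dx (c i u) * arcJac (c i) u)) 0 :=
      MeromorphicAt.fun_prod fun i _ => (hc i).meromorphicAt_dx hstd
    refine (h1.fun_div h2).congr ?_
    have h3 : ∀ᶠ u in 𝓝 0, ∀ i, arcJac (c i) u ≠ 0 := eventually_all.2 fun i => (hc i).eventually_arcJac_ne_zero
    filter_upwards [h3.filter_mono nhdsWithin_le_nhds] with u hu
    have e1 : (m.map fun c => c u) = L.1.val.map (fun i => c i u) + K.val.map w := by
      simp [m, Multiset.map_map]
    have e2 : (m.map fun c => arcJac c u).prod = ∏ i ∈ L.1, arcJac (c i) u := by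
      simp [m, Multiset.map_map, arcJac_const]
    rw [e1, e2, Finset.prod_mul_distrib, mul_div_mul_right]
    exact Finset.prod_ne_zero_iff.2 fun i _ => hu i
  refine key.congr ?_
  filter_upwards [hinj] with u hu
  have e1 : (Finset.univ.image fun i => c i u) = J.map ⟨fun i => c i u, hu⟩ := by
    rw [Finset.map_eq_image]; rfl
  rw [e1, Wprime_map, Finset.sum_div]
  refine Finset.sum_congr rfl fun P _ => ?_
  rw [Finset.sum_div]
  refine Finset.sum_congr rfl fun M _ => ?_
  rw [Finset.sum_div]
  refine Finset.sum_congr rfl fun h _ => ?_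
  split_ifs
  swap
  · rw [zero_div]
  have e2 : ∏ i, C.dx (c i u) = ∏ L : P.parts, ∏ i ∈ L.1, C.dx (c i u) := by
    rw [Finset.prod_coe_sort P.parts fun L => ∏ i ∈ L, C.dx (c i u)]
    have h1 := Finset.prod_biUnion (s := P.parts) (t := id) (f := fun i => C.dx (c i u)) P.disjoint
    rw [P.biUnion_parts] at h1
    exact h1
  rw [e2, ← Finset.prod_div_distrib]
  rfl

open Classical in
/-- `𝒲'`, divided by the differentials `dx`, is meromorphic along a finite family of arcs. -/
theorem meromorphicAt_Wprime (hstd : HasStandardCoordinates C) (ω : Correlators C) (g : ℕ) {ι : Type*}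
    {J : Finset ι} {c : ι → ℂ → X} (hc : ∀ i ∈ J, IsArc C.Ram (c i))
    (hinj : ∀ᶠ u in 𝓝[≠] 0, InjOn (fun i => c i u) J) {n : ℕ} {w : Fin n → X}
    (hw : ∀ k, w k ∉ C.Ram) (hcw : ∀ i ∈ J, ∀ k, ∀ᶠ u in 𝓝[≠] 0, c i u ≠ w k) :
    MeromorphicAt (fun u => ω.Wprime g (J.image fun i => c i u) w / ∏ i ∈ J, C.dx (c i u)) 0 := by
  have h := meromorphicAt_Wprime_univ hstd ω g (ι := J) (c := fun i => c i) (fun i => hc i i.2)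
    (hinj.mono fun u hu i j hij => Subtype.ext (hu i.2 j.2 hij)) hw fun i k => hcw i i.2 k
  refine h.congr (Eventually.of_forall fun u => ?_)
  simp only
  rw [Finset.prod_coe_sort J fun i => C.dx (c i u)]
  congr 2
  ext a
  simp

end Arcs

/-! ### The recursion integrand without its primitive -/

section Qform

variable {X : Type*} [TopologicalSpace X] [ChartedSpace ℂ X] {C : SpectralCurve X}

open Classical in
/-- The recursion integrand is `α(w₀; z)` times this `1`-form in `z`. -/
noncomputable def Qform (ω : Correlators C) (S : Set X) (g : ℕ) {n : ℕ} (w : Fin n → X) (z : X) : ℂ :=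
  ∑ᶠ Z ∈ {Z : Finset X | Z.Nonempty ∧ (Z : Set X) ⊆ (C.fiber z ∩ S) \ {z}},
    -(Upsilon C Z z)⁻¹ * (ω.Wprime g (insert z Z) w * ∏ z' ∈ Z, (C.dx z / C.dx z'))

/-- The primitive enters the recursion integrand linearly. -/
theorem integrand_eq (ω : Correlators C) (α : X → X → ℂ) (S : Set X) (g : ℕ) {n : ℕ} (w₀ : X) (w : Fin n → X)
    (z : X) : integrand ω α S g w₀ w z = α w₀ z * Qform ω S g w z := by
  unfold integrand Qform
  rw [← smul_eq_mul, smul_finsum]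
  refine finsum_congr fun Z => ?_
  rw [smul_finsum]
  refine finsum_congr fun hZ => ?_
  rw [kernel, smul_eq_mul]
  ring

theorem Qform_congr (ω : Correlators C) {S S' : Set X} (g : ℕ) {n : ℕ} (w : Fin n → X) {z : X}
    (h : C.fiber z ∩ S = C.fiber z ∩ S') : Qform ω S g w z = Qform ω S' g w z := by
  unfold Qform
  rw [h]

open Classical in
/-- The recursion form as a sum over the subsets `A = {z} ∪ Z` of the fibre, in terms of quotients by `dx`.
Apart from the factor `dx`, only the last factor depends on which point of `A` is `z`. -/
theorem Qform_eq_sum (ω : Correlators C) {S : Set X} (g : ℕ) {n : ℕ} (w : Fin n → X) {z : X} {T : Finset X}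
    (hT : C.fiber z ∩ S = T) (hz : z ∈ T) (hdx : ∀ z' ∈ T, C.dx z' ≠ 0) :
    Qform ω S g w z = -C.dx z * ∑ A ∈ T.powerset.filter (fun A => z ∈ A ∧ 2 ≤ A.card),
      ω.Wprime g A w / (∏ a ∈ A, C.dx a) * (∏ a ∈ A.erase z, (C.y a - C.y z))⁻¹ := by
  have hset : {Z : Finset X | Z.Nonempty ∧ (Z : Set X) ⊆ (C.fiber z ∩ S) \ {z}} =
      (((T.erase z).powerset.erase ∅ : Finset (Finset X)) : Set (Finset X)) := by
    ext Z
    rw [hT]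
    simp only [mem_ofPred_eq, Finset.coe_erase, Finset.mem_coe, Finset.mem_powerset, Set.mem_sdiff,
      mem_singleton_iff, Finset.nonempty_iff_ne_empty]
    rw [← Finset.coe_erase, Finset.coe_subset]
    tauto
  unfold Qform
  rw [hset, finsum_mem_coe_finset, Finset.mul_sum]
  refine Finset.sum_bij' (fun Z _ => insert z Z) (fun A _ => A.erase z) ?_ ?_ ?_ ?_ ?_
  · intro Z hZ
    simp only [Finset.mem_erase, Finset.mem_powerset] at hZ
    have hzZ : z ∉ Z := fun h => by simpa using hZ.2 h
    simp only [Finset.mem_filter, Finset.mem_powerset]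
    refine ⟨Finset.insert_subset hz (hZ.2.trans (Finset.erase_subset _ _)), Finset.mem_insert_self _ _, ?_⟩
    rw [Finset.card_insert_of_notMem hzZ]
    have := Finset.card_pos.2 (Finset.nonempty_iff_ne_empty.2 hZ.1)
    omega
  · intro A hA
    simp only [Finset.mem_filter, Finset.mem_powerset] at hA
    simp only [Finset.mem_erase, Finset.mem_powerset]
    refine ⟨?_, Finset.erase_subset_erase _ hA.1⟩
    rw [← Finset.nonempty_iff_ne_empty, ← Finset.card_pos, Finset.card_erase_of_mem hA.2.1]
    omega
  · intro Z hZ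
    simp only [Finset.mem_erase, Finset.mem_powerset] at hZ
    exact Finset.erase_insert fun h => by simpa using hZ.2 h
  · intro A hA
    simp only [Finset.mem_filter, Finset.mem_powerset] at hA
    exact Finset.insert_erase hA.2.1
  · intro Z hZ
    simp only [Finset.mem_erase, Finset.mem_powerset] at hZ
    have hzZ : z ∉ Z := fun h => by simpa using hZ.2 h
    rw [Finset.erase_insert hzZ, Finset.prod_insert hzZ, Upsilon, Finset.prod_mul_distrib, Finset.prod_div_distrib,
      Finset.prod_const]
    have h1 : C.dx z ≠ 0 := hdx z hz
    have h2 : ∏ a ∈ Z, C.dx a ≠ 0 := Finset.prod_ne_zero_iff.2 fun a ha =>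
      hdx a (Finset.erase_subset _ _ (hZ.2 ha))
    by_cases h3 : ∏ a ∈ Z, (C.y a - C.y z) = 0
    · simp [h3]
    · field_simp

open Classical in
/-- The sum of `Qform / dx` over a finite fibre on which `y` is injective vanishes, by the Lagrange
interpolation identity. -/
theorem sum_Qform_div_dx (ω : Correlators C) {S : Set X} (g : ℕ) {n : ℕ} (w : Fin n → X) {T : Finset X}
    (hT : ∀ z ∈ T, C.fiber z ∩ S = T) (hdx : ∀ z ∈ T, C.dx z ≠ 0) (hy : InjOn C.y T) :
    ∑ z ∈ T, Qform ω S g w z / C.dx z = 0 := by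
  have h1 : ∀ z ∈ T, Qform ω S g w z / C.dx z = -∑ A ∈ T.powerset.filter (fun A => z ∈ A ∧ 2 ≤ A.card),
      ω.Wprime g A w / (∏ a ∈ A, C.dx a) * (∏ a ∈ A.erase z, (C.y a - C.y z))⁻¹ := by
    intro z hz
    rw [Qform_eq_sum ω g w (hT z hz) hz hdx, neg_mul, neg_div, mul_div_cancel_left₀ _ (hdx z hz)]
  rw [Finset.sum_congr rfl h1, Finset.sum_neg_distrib, neg_eq_zero,
    Finset.sum_comm' (s' := fun A => A) (t' := T.powerset.filter fun A => 2 ≤ A.card)]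
  · refine Finset.sum_eq_zero fun A hA => ?_
    simp only [Finset.mem_filter, Finset.mem_powerset] at hA
    rw [← Finset.mul_sum, sum_prod_inv_sub_eq_zero (hy.mono (Finset.coe_subset.2 hA.1)) hA.2, mul_zero]
  · intro z A
    simp only [Finset.mem_filter, Finset.mem_powerset]
    constructor
    · rintro ⟨hz, hA, hzA, hc⟩; exact ⟨hzA, hA, hc⟩
    · rintro ⟨hzA, hA, hc⟩; exact ⟨hA hzA, hA, hzA, hc⟩

variable [T2Space X] [IsManifold 𝓘(ℂ) ⊤ X] {A : Set X} {b : OnePoint ℂ} {N : FibreNhd C A b}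

namespace FibreNhd

theorem isArc {i : Σ _ : X, ℕ} (hi : i.1 ∈ N.P) : IsArc C.Ram (N.arc i) := by
  refine ⟨continuousAt_arc hi, analyticAt_chart_arc hi, ?_⟩
  filter_upwards [N.eventually_norm_lt] with u hu using arc_notMem_Ram hi hu.1 hu.2

theorem dx_arc_ne_zero {i : Σ _ : X, ℕ} (hi : i.1 ∈ N.P) {u : ℂ} (hu : ‖u‖ < N.ρ) (h0 : u ≠ 0) :
    C.dx (N.arc i u) ≠ 0 :=
  (N.std _ hi).dx_ne_zero (arc_mem_source hi hu) (arc_ne hi hu h0)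

open Classical in
theorem fiber_arc_inter {S : Finset X} (hS : S ⊆ N.P) {i : Σ _ : X, ℕ} (hi : i.1 ∈ N.P) {u : ℂ}
    (hu : ‖u‖ < N.ρ) : C.fiber (N.arc i u) ∩ ⋃ p ∈ S, (N.ζ p).source =
      ((N.idx S).image fun i => N.arc i u : Finset X) := by
  rw [SpectralCurve.fiber, x_arc hi hu, fiber_inter_eq hS hu, Finset.coe_image]

theorem fiber_arc_inter_A {i : Σ _ : X, ℕ} (hi : i.1 ∈ N.P) {u : ℂ} (hu : ‖u‖ < N.ρ) :
    C.fiber (N.arc i u) ∩ A = C.fiber (N.arc i u) ∩ ⋃ p ∈ N.P, (N.ζ p).source := by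
  rw [SpectralCurve.fiber, x_arc hi hu, fiber_inter_A_eq hu]

theorem arc_zero_index {p : X} (u : ℂ) : N.arc ⟨p, 0⟩ u = (N.ζ p).symm (u ^ N.k p) := by
  simp only [arc, zetaRoot_zero, one_mul]

open Classical in
/-- The recursion form is meromorphic. The points of the fibre of `z` are branches of roots of the standard
coordinate, so the form is pulled back by a power `u ↦ u ^ k` after which they all become arcs. -/
theorem meromorphicAt_coeff_Qform (hstd : HasStandardCoordinates C) (ω : Correlators C) {S : Finset X}
    (hS : S ⊆ N.P) (g : ℕ) {n : ℕ} {w : Fin n → X} (hw : ∀ k, w k ∉ C.Ram ∧ w k ∉ N.P) {p : X} (hp : p ∈ S) :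
    MeromorphicAt (coeff (N.ζ p) (Qform ω (⋃ p ∈ S, (N.ζ p).source) g w)) 0 := by
  have hpP := hS hp
  refine meromorphicAt_of_comp_pow (N.k_pos hpP) ?_
  set i₀ : Σ _ : X, ℕ := ⟨p, 0⟩
  have hi₀ : i₀ ∈ N.idx S := N.mem_idx.2 ⟨hp, (N.std p hpP).order_pos⟩
  have hP : ∀ i ∈ N.idx S, i.1 ∈ N.P := fun i hi => hS (N.mem_idx.1 hi).1
  have hmem : ∀ {J : Finset (Σ _ : X, ℕ)}, J ∈ (N.idx S).powerset.filter (fun J => i₀ ∈ J ∧ 2 ≤ J.card) →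
      J ⊆ N.idx S := fun {J} hJ => Finset.mem_powerset.1 (Finset.mem_filter.1 hJ).1
  have hinj : ∀ {u : ℂ}, ‖u‖ < N.ρ → u ≠ 0 → InjOn (fun i => N.arc i u) (N.idx S) := fun hu h0 =>
    (arc_injOn hu h0).mono (Finset.coe_subset.2 (Finset.sigma_mono hS fun _ => Finset.Subset.refl _))
  have hdx : MeromorphicAt (fun u : ℂ => coeff (N.ζ p) C.dx (u ^ N.k p)) 0 :=
    MeromorphicAt.comp_analyticAt (f := coeff (N.ζ p) C.dx) (g := fun u : ℂ => u ^ N.k p) (x := 0)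
      (by rw [zero_pow (N.k_pos hpP).ne']; exact (N.std p hpP).meromorphicAt_coeff_dx) (by fun_prop)
  have hsum : MeromorphicAt (fun u => ∑ J ∈ (N.idx S).powerset.filter (fun J => i₀ ∈ J ∧ 2 ≤ J.card),
      ω.Wprime g (J.image fun i => N.arc i u) w / (∏ i ∈ J, C.dx (N.arc i u)) *
        (∏ i ∈ J.erase i₀, (C.y (N.arc i u) - C.y (N.arc i₀ u)))⁻¹) 0 := by
    refine MeromorphicAt.fun_sum (fun J hJ => MeromorphicAt.fun_mul ?_ ?_)
    · refine meromorphicAt_Wprime hstd ω g (fun i hi => isArc (hP i (hmem hJ hi))) ?_ (fun k => (hw k).1) ?_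
      · filter_upwards [N.eventually_norm_lt] with u hu
        exact (hinj hu.1 hu.2).mono (Finset.coe_subset.2 (hmem hJ))
      · intro i hi k
        have hiP := hP i (hmem hJ hi)
        have hne : N.arc i 0 ≠ w k := by
          rw [arc_zero hiP]
          rintro h
          exact (hw k).2 (h ▸ hiP)
        exact ((continuousAt_arc hiP).eventually_ne hne).filter_mono nhdsWithin_le_nhds
    · refine MeromorphicAt.fun_inv (MeromorphicAt.fun_prod fun i hi => ?_)
      exact ((isArc (hP i (hmem hJ (Finset.erase_subset _ _ hi)))).meromorphicAt_y hstd).fun_sub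
        ((isArc (hP i₀ hi₀)).meromorphicAt_y hstd)
  refine (hdx.fun_neg.fun_mul hsum).congr ?_
  filter_upwards [N.eventually_norm_lt] with u hu
  have hT := fiber_arc_inter hS (hP i₀ hi₀) hu.1
  have hi := hinj hu.1 hu.2
  have e1 := Qform_eq_sum ω g w hT (Finset.mem_image_of_mem _ hi₀) (by
    intro z' hz'
    obtain ⟨i, hi, rfl⟩ := Finset.mem_image.1 hz'
    exact dx_arc_ne_zero (hP i hi) hu.1 hu.2)
  have e2 : coeff (N.ζ p) (Qform ω (⋃ p ∈ S, (N.ζ p).source) g w) (u ^ N.k p) =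
      Qform ω (⋃ p ∈ S, (N.ζ p).source) g w (N.arc i₀ u) * jac (N.ζ p) (u ^ N.k p) := by
    rw [coeff, arc_zero_index]
  have e3 : coeff (N.ζ p) C.dx (u ^ N.k p) = C.dx (N.arc i₀ u) * jac (N.ζ p) (u ^ N.k p) := by
    rw [coeff, arc_zero_index]
  rw [e2, e1, e3]
  have e4 : ∑ B ∈ ((N.idx S).image fun i => N.arc i u).powerset.filter (fun B => N.arc i₀ u ∈ B ∧ 2 ≤ B.card),
      ω.Wprime g B w / (∏ a ∈ B, C.dx a) * (∏ a ∈ B.erase (N.arc i₀ u), (C.y a - C.y (N.arc i₀ u)))⁻¹ =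
      ∑ J ∈ (N.idx S).powerset.filter (fun J => i₀ ∈ J ∧ 2 ≤ J.card),
      ω.Wprime g (J.image fun i => N.arc i u) w / (∏ i ∈ J, C.dx (N.arc i u)) *
        (∏ i ∈ J.erase i₀, (C.y (N.arc i u) - C.y (N.arc i₀ u)))⁻¹ := by
    symm
    refine Finset.sum_nbij (fun J => J.image fun i => N.arc i u) ?_ ?_ ?_ ?_
    · intro J hJ
      have hJ' := Finset.mem_filter.1 hJ
      refine Finset.mem_filter.2 ⟨Finset.mem_powerset.2 (Finset.image_subset_image (hmem hJ)),
        Finset.mem_image_of_mem _ hJ'.2.1, ?_⟩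
      rw [Finset.card_image_of_injOn (hi.mono (Finset.coe_subset.2 (hmem hJ)))]
      exact hJ'.2.2
    · intro J hJ J' hJ' h
      have h1 := hmem (Finset.mem_coe.1 hJ)
      have h2 := hmem (Finset.mem_coe.1 hJ')
      have h3 := congrArg (fun B : Finset X => (B : Set X)) h
      simp only [Finset.coe_image] at h3
      exact Finset.coe_injective ((hi.image_eq_image_iff (Finset.coe_subset.2 h1) (Finset.coe_subset.2 h2)).1 h3)
    · intro B hB
      have hB' := Finset.mem_filter.1 (Finset.mem_coe.1 hB)
      obtain ⟨J, hJ, rfl⟩ := Finset.subset_image_iff.1 (Finset.mem_powerset.1 hB'.1)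
      refine ⟨J, Finset.mem_coe.2 (Finset.mem_filter.2 ⟨Finset.mem_powerset.2 (Finset.coe_subset.1 hJ), ?_, ?_⟩), rfl⟩
      · obtain ⟨j, hj, e⟩ := Finset.mem_image.1 hB'.2.1
        rwa [← hi (hJ hj) (Finset.mem_coe.2 hi₀) e]
      · have := hB'.2.2
        rwa [Finset.card_image_of_injOn (hi.mono hJ)] at this
    · intro J hJ
      have hJi := hi.mono (Finset.coe_subset.2 (hmem hJ))
      have hJ' := Finset.mem_filter.1 hJ
      rw [Finset.prod_image hJi]
      have e5 : (J.image fun i => N.arc i u).erase (N.arc i₀ u) = (J.erase i₀).image fun i => N.arc i u := by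
        ext a
        simp only [Finset.mem_erase, Finset.mem_image]
        constructor
        · rintro ⟨ha, i, hiJ, rfl⟩
          exact ⟨i, ⟨fun h => ha (by rw [h]), hiJ⟩, rfl⟩
        · rintro ⟨i, ⟨hne, hiJ⟩, rfl⟩
          exact ⟨fun h => hne (hJi hiJ hJ'.2.1 h), i, hiJ, rfl⟩
      rw [e5, Finset.prod_image (hJi.mono (Finset.coe_subset.2 (Finset.erase_subset _ _)))]
  rw [e4]
  ring

/-- The residue at `p` of the local form `Qform` vanishes. -/
theorem res_coeff_Qform_source (hstd : HasStandardCoordinates C) (ω : Correlators C)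
    (g : ℕ) {n : ℕ} {w : Fin n → X} (hw : ∀ k, w k ∉ C.Ram ∧ w k ∉ N.P) {p : X} (hp : p ∈ N.P)
    (hy : ∀ᶠ z in 𝓝[≠] p, ∀ z' ∈ (C.fiber z ∩ (N.ζ p).source) \ {z}, C.y z' ≠ C.y z) :
    MeromorphicAt (coeff (N.ζ p) (Qform ω (N.ζ p).source g w)) 0 ∧
      res (coeff (N.ζ p) (Qform ω (N.ζ p).source g w)) 0 = 0 := by
  classical
  have hU : (⋃ p' ∈ ({p} : Finset X), (N.ζ p').source) = (N.ζ p).source := by simp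
  have hS : ({p} : Finset X) ⊆ N.P := Finset.singleton_subset_iff.2 hp
  have hmer := meromorphicAt_coeff_Qform hstd ω hS g hw (Finset.mem_singleton_self p)
  rw [hU] at hmer
  refine ⟨hmer, res_eq_zero_of_trace_eq_zero (N.std p hp).order_pos hmer ?_⟩
  refine eventually_of_eventually_pow (N.k_pos hp) ?_
  have hy' : ∀ᶠ u in 𝓝[≠] (0 : ℂ), ∀ j ∈ Finset.range (N.r p),
      ∀ z' ∈ (C.fiber (N.arc ⟨p, j⟩ u) ∩ (N.ζ p).source) \ {N.arc ⟨p, j⟩ u}, C.y z' ≠ C.y (N.arc ⟨p, j⟩ u) := by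
    rw [Finset.eventually_all]
    intro j _
    have h1 : Tendsto (N.arc ⟨p, j⟩) (𝓝[≠] 0) (𝓝[≠] p) := by
      refine tendsto_nhdsWithin_iff.2 ⟨?_, ?_⟩
      · have := (continuousAt_arc (N := N) (i := ⟨p, j⟩) hp).tendsto
        rw [arc_zero hp] at this
        exact this.mono_left nhdsWithin_le_nhds
      · filter_upwards [N.eventually_norm_lt] with u hu using arc_ne (i := ⟨p, j⟩) hp hu.1 hu.2
    exact h1.eventually hy
  filter_upwards [N.eventually_norm_lt, hy'] with u hu hyu
  have hsrc : ∀ j, zetaRoot (N.r p) j * u ^ N.k p ∈ (N.ζ p).target := fun j =>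
    mem_target_of_norm_lt (i := ⟨p, j⟩) hp hu.1
  set T : Finset X := (N.idx {p}).image fun i => N.arc i u
  have hTi : ∀ z ∈ T, ∃ j ∈ Finset.range (N.r p), N.arc ⟨p, j⟩ u = z := by
    intro z hz
    obtain ⟨⟨q, j⟩, hi, rfl⟩ := Finset.mem_image.1 hz
    have hi' := N.mem_idx.1 hi
    obtain rfl : q = p := Finset.mem_singleton.1 hi'.1
    exact ⟨j, Finset.mem_range.2 hi'.2, rfl⟩
  have hT : ∀ z ∈ T, C.fiber z ∩ (N.ζ p).source = T := by
    intro z hz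
    obtain ⟨j, hj, rfl⟩ := hTi z hz
    have := fiber_arc_inter hS (i := ⟨p, j⟩) hp hu.1
    rwa [hU] at this
  have hsum := sum_Qform_div_dx ω (S := (N.ζ p).source) g w hT (fun z hz => by
    obtain ⟨j, hj, rfl⟩ := hTi z hz
    exact dx_arc_ne_zero (i := ⟨p, j⟩) hp hu.1 hu.2) (by
    intro z hz z' hz' h
    by_contra hne
    obtain ⟨j, hj, rfl⟩ := hTi z hz
    refine hyu j hj z' ⟨?_, fun h => hne h.symm⟩ h.symm
    rw [hT _ hz]
    exact hz')
  have hsub : (N.idx {p} : Set (Σ _ : X, ℕ)) ⊆ N.idx N.P :=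
    Finset.coe_subset.2 (Finset.sigma_mono hS fun _ => Finset.Subset.refl _)
  rw [Finset.sum_image ((arc_injOn hu.1 hu.2).mono hsub), idx, Finset.sum_sigma, Finset.sum_singleton] at hsum
  have hterm : ∀ j ∈ Finset.range (N.r p), coeff (N.ζ p) (Qform ω (N.ζ p).source g w) (zetaRoot (N.r p) j * u ^ N.k p) /
      (N.r p * (zetaRoot (N.r p) j * u ^ N.k p) ^ (N.r p - 1)) =
      sphereDeriv b ((u ^ N.k p) ^ N.r p) *
        (Qform ω (N.ζ p).source g w (N.arc ⟨p, j⟩ u) / C.dx (N.arc ⟨p, j⟩ u)) := by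
    intro j _
    have h0 : zetaRoot (N.r p) j * u ^ N.k p ≠ 0 := mul_ne_zero (zetaRoot_ne_zero _ _) (pow_ne_zero _ hu.2)
    have h1 := (N.std p hp).coeff_dx (hsrc j) h0
    rw [N.x_center hp, mul_pow, zetaRoot_pow (N.std p hp).order_pos, one_mul, coeff] at h1
    have h2 := dx_arc_ne_zero (i := ⟨p, j⟩) hp hu.1 hu.2
    have h3 : jac (N.ζ p) (zetaRoot (N.r p) j * u ^ N.k p) ≠ 0 := jac_ne_zero (N.std p hp).mem_atlas (hsrc j)
    have h4 : sphereDeriv b ((u ^ N.k p) ^ N.r p) ≠ 0 :=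
      sphereDeriv_ne_zero _ (pow_ne_zero _ (pow_ne_zero _ hu.2))
    have h5 : (N.r p * (zetaRoot (N.r p) j * u ^ N.k p) ^ (N.r p - 1) : ℂ) ≠ 0 :=
      mul_ne_zero (by exact_mod_cast (N.std p hp).order_pos.ne') (pow_ne_zero _ h0)
    change C.dx (N.arc ⟨p, j⟩ u) * _ = _ at h1
    change Qform ω (N.ζ p).source g w (N.arc ⟨p, j⟩ u) * jac (N.ζ p) _ / _ = _
    rw [← mul_div_assoc, div_eq_div_iff h5 h2]
    linear_combination (Qform ω (N.ζ p).source g w (N.arc ⟨p, j⟩ u)) * h1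
  rw [Finset.sum_congr rfl hterm, ← Finset.mul_sum, hsum, mul_zero]

end FibreNhd

end Qform

/-! ### Residues of the recursion integrand -/

section Residues

variable {X : Type*} [TopologicalSpace X] [ChartedSpace ℂ X]

theorem coeff_mul (e : OpenPartialHomeomorph X ℂ) (f φ : X → ℂ) (t : ℂ) :
    coeff e (fun z => f z * φ z) t = f (e.symm t) * coeff e φ t := by
  unfold coeff
  ring

theorem coeff_sub (e : OpenPartialHomeomorph X ℂ) (φ ψ : X → ℂ) (t : ℂ) :
    coeff e (fun z => φ z - ψ z) t = coeff e φ t - coeff e ψ t := by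
  unfold coeff
  ring

theorem coeff_congr {φ ψ : X → ℂ} {p : X} (h : ∀ᶠ z in 𝓝[≠] p, φ z = ψ z) :
    coeff (chartAt ℂ p) φ =ᶠ[𝓝[≠] (chartAt ℂ p p)] coeff (chartAt ℂ p) ψ := by
  filter_upwards [(eventually_nhdsNE_iff_chart _ (mem_chart_source ℂ p)).1 h] with t ht
  rw [coeff, coeff, ht]

theorem residueAt_congr {φ ψ : X → ℂ} {p : X} (h : ∀ᶠ z in 𝓝[≠] p, φ z = ψ z) :
    residueAt φ p = residueAt ψ p := res_congr (coeff_congr h)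

/-- The `1`-form `φ` is meromorphic at `p`. -/
def MerAt (φ : X → ℂ) (p : X) : Prop := MeromorphicAt (coeff (chartAt ℂ p) φ) (chartAt ℂ p p)

/-- The `1`-form `φ` is holomorphic at `p` up to its value at `p`. -/
def RemovableAt (φ : X → ℂ) (p : X) : Prop :=
  ∃ g : ℂ → ℂ, AnalyticAt ℂ g (chartAt ℂ p p) ∧ coeff (chartAt ℂ p) φ =ᶠ[𝓝[≠] (chartAt ℂ p p)] g

theorem MerAt.congr {φ ψ : X → ℂ} {p : X} (hφ : MerAt φ p) (h : ∀ᶠ z in 𝓝[≠] p, φ z = ψ z) : MerAt ψ p :=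
  MeromorphicAt.congr hφ (coeff_congr h)

theorem RemovableAt.congr {φ ψ : X → ℂ} {p : X} (hφ : RemovableAt φ p) (h : ∀ᶠ z in 𝓝[≠] p, φ z = ψ z) :
    RemovableAt ψ p := by
  obtain ⟨g, hg, e⟩ := hφ
  exact ⟨g, hg, (coeff_congr h).symm.trans e⟩

theorem RemovableAt.residueAt_eq_zero {φ : X → ℂ} {p : X} (h : RemovableAt φ p) : residueAt φ p = 0 := by
  obtain ⟨g, hg, e⟩ := h
  rw [residueAt, res_congr e, res_of_analyticAt hg]

theorem removableAt_zero (p : X) : RemovableAt (fun _ : X => (0 : ℂ)) p :=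
  ⟨fun _ => 0, analyticAt_const, Eventually.of_forall fun t => by simp [coeff]⟩

theorem MerAt.sub {φ ψ : X → ℂ} {p : X} (h : MerAt φ p) (h' : MerAt ψ p) : MerAt (fun z => φ z - ψ z) p := by
  refine (MeromorphicAt.fun_sub h h').congr (Eventually.of_forall fun t => ?_)
  rw [coeff_sub]

theorem residueAt_sub {φ ψ : X → ℂ} {p : X} (h : MerAt φ p) (h' : MerAt ψ p) :
    residueAt (fun z => φ z - ψ z) p = residueAt φ p - residueAt ψ p := by
  rw [residueAt, residueAt, residueAt, ← res_sub h h']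
  exact res_congr (Eventually.of_forall fun t => coeff_sub _ _ _ _)

theorem MerAt.mul {f φ : X → ℂ} {p : X} (hf : MeromorphicAt (fun t => f ((chartAt ℂ p).symm t)) (chartAt ℂ p p))
    (h : MerAt φ p) : MerAt (fun z => f z * φ z) p := by
  refine (MeromorphicAt.fun_mul hf h).congr (Eventually.of_forall fun t => ?_)
  rw [coeff_mul]

theorem eventually_nhdsNE_of_codiscrete {P : X → Prop} (h : ∀ᶠ z in codiscrete X, P z) (p : X) :
    ∀ᶠ z in 𝓝[≠] p, P z := by
  have := mem_codiscrete.1 h p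
  rw [disjoint_principal_right, compl_compl] at this
  exact this

variable [IsManifold 𝓘(ℂ) ⊤ X] {C : SpectralCurve X}

theorem IsStandardCoordinate.merAt {p : X} {r : ℕ} {ζ : OpenPartialHomeomorph X ℂ}
    (h : IsStandardCoordinate C p r ζ) {φ : X → ℂ} (hφ : MeromorphicAt (coeff ζ φ) 0) : MerAt φ p :=
  meromorphicAt_coeff_of (chart_mem_atlas p) h.mem_atlas (mem_chart_source ℂ p) h.mem_source
    (by rwa [h.map_center])

theorem merAt_ω02 (C : SpectralCurve X) (w₀ p : X) : MerAt (C.ω02 w₀) p := by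
  rcases eq_or_ne w₀ p with rfl | h
  · obtain ⟨G, hG, hd⟩ := C.ω02_fundamental.diagonal w₀
    set e := chartAt ℂ w₀
    have h2 : AnalyticAt ℂ (fun s : ℂ => (e w₀, s)) (e w₀) := by fun_prop
    have h3 := AnalyticAt.comp_of_eq hG h2 rfl
    have h4 : MeromorphicAt (fun s : ℂ => 1 / (e w₀ - s) ^ 2) (e w₀) :=
      (MeromorphicAt.const 1 _).fun_div (AnalyticAt.meromorphicAt (by fun_prop))
    refine (h4.fun_add h3.meromorphicAt).congr ?_
    have h5 := (h2.continuousAt.eventually hd).filter_mono (nhdsWithin_le_nhds (s := {e w₀}ᶜ))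
    filter_upwards [h5, self_mem_nhdsWithin] with s hs hs'
    rw [← coeff₂_chartAt_self, hs (Ne.symm hs')]
    rfl
  · exact (analyticAt_coeff_ω02 C h).meromorphicAt

theorem exists_primitive_of_residueAt_eq_zero {φ : X → ℂ} {p : X} (h : MerAt φ p) (h0 : residueAt φ p = 0) :
    ∃ Ψ : ℂ → ℂ, MeromorphicAt Ψ (chartAt ℂ p p) ∧
      ∀ᶠ t in 𝓝[≠] (chartAt ℂ p p), HasDerivAt Ψ (coeff (chartAt ℂ p) φ t) t := by
  obtain ⟨Ψ, hΨ, hd⟩ := MeromorphicAt.exists_primitive h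
  refine ⟨Ψ, hΨ, ?_⟩
  rw [residueAt] at h0
  simpa [h0] using hd

/-- Integration by parts: only `ω02`, and not its primitive, matters for the residue of the product with
an exact form. -/
theorem residueAt_primitive_mul [T2Space X] {U : Set X} {α : X → X → ℂ} (hα : IsPrimitive C U α) {p : X}
    (hU : U ∈ 𝓝 p) {φ : X → ℂ} (hφ : MerAt φ p) {Ψ : ℂ → ℂ} (hΨ : MeromorphicAt Ψ (chartAt ℂ p p))
    (hd : ∀ᶠ t in 𝓝[≠] (chartAt ℂ p p), HasDerivAt Ψ (coeff (chartAt ℂ p) φ t) t) (w₀ : X) :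
    residueAt (fun z => α w₀ z * φ z) p =
      -res (fun s => coeff (chartAt ℂ p) (C.ω02 w₀) s * Ψ s) (chartAt ℂ p p) := by
  set e := chartAt ℂ p
  have hp : p ∈ e.source := mem_chart_source ℂ p
  have hder : ∀ᶠ s in 𝓝[≠] (e p), HasDerivAt (fun s => α w₀ (e.symm s)) (coeff e (C.ω02 w₀) s) s := by
    have h1 : ∀ᶠ z in 𝓝[≠] p, z ∈ U ∧ z ≠ w₀ := by
      refine Filter.Eventually.and (mem_nhdsWithin_of_mem_nhds hU) ?_
      rcases eq_or_ne p w₀ with rfl | h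
      · exact self_mem_nhdsWithin
      · exact (isOpen_ne.eventually_mem h).filter_mono nhdsWithin_le_nhds
    filter_upwards [(eventually_nhdsNE_iff_chart e hp).1 h1,
      (e.open_target.eventually_mem (e.map_source hp)).filter_mono nhdsWithin_le_nhds] with s hs hst
    exact (hasPrimAt_iff (chart_mem_atlas p) hst).1 (hα.deriv_right w₀ _ hs.1 hs.2)
  rw [residueAt, res_congr (Eventually.of_forall fun t => coeff_mul e (α w₀) φ t)]
  exact res_mul_eq_neg_res_mul_of_hasDerivAt (hα.meromorphic_right w₀ p (mem_of_mem_nhds hU))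
    (merAt_ω02 C w₀ p) hΨ hφ hder hd

/-- The residue at `p` of `ω02(w₀, ·) Ψ`, in a coordinate of `w₀`. -/
theorem jac_mul_res_ω02 (C : SpectralCurve X) (e : OpenPartialHomeomorph X ℂ) {p : X} {Ψ : ℂ → ℂ}
    (hΨ : MeromorphicAt Ψ (chartAt ℂ p p)) (t : ℂ) :
    jac e t * res (fun s => coeff (chartAt ℂ p) (C.ω02 (e.symm t)) s * Ψ s) (chartAt ℂ p p) =
      res (fun s => coeff₂ e (chartAt ℂ p) C.ω02 (t, s) * Ψ s) (chartAt ℂ p p) := by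
  rw [← res_const_mul _ (MeromorphicAt.fun_mul (merAt_ω02 C _ p) hΨ)]
  refine res_congr (Eventually.of_forall fun s => ?_)
  simp only [coeff₂_eq_mul, mul_assoc]

/-- The residue at `p` of `ω02(w₀, ·) Ψ` is a continuous `1`-form in `w₀ ≠ p`. -/
theorem continuousAt_jac_mul_res_ω02 (C : SpectralCurve X) {a p : X} (hap : a ≠ p) {Ψ : ℂ → ℂ}
    (hΨ : MeromorphicAt Ψ (chartAt ℂ p p)) :
    ContinuousAt (fun t => jac (chartAt ℂ a) t *
      res (fun s => coeff (chartAt ℂ p) (C.ω02 ((chartAt ℂ a).symm t)) s * Ψ s) (chartAt ℂ p p)) (chartAt ℂ a a) := by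
  simp only [jac_mul_res_ω02 C (chartAt ℂ a) hΨ]
  exact continuousAt_res_mul (C.ω02_fundamental.off_diagonal a p hap) hΨ

/-- If the residues of the products of `ω02` with primitives of the forms `φ p` cancel, then the forms
`φ p` are holomorphic: near `w₀ = p` the term at `p` is the principal part of `φ p`, and the other terms
are bounded. -/
theorem removableAt_of_sum_res_eq_zero [T2Space X] {P : Finset X} {φ : X → X → ℂ} {Ψ : X → ℂ → ℂ}
    (hφ : ∀ p ∈ P, MerAt (φ p) p) (hΨ : ∀ p ∈ P, MeromorphicAt (Ψ p) (chartAt ℂ p p))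
    (hd : ∀ p ∈ P, ∀ᶠ t in 𝓝[≠] (chartAt ℂ p p), HasDerivAt (Ψ p) (coeff (chartAt ℂ p) (φ p) t) t)
    (h : ∀ᶠ w₀ in codiscrete X,
      ∑ p ∈ P, res (fun s => coeff (chartAt ℂ p) (C.ω02 w₀) s * Ψ p s) (chartAt ℂ p p) = 0) :
    ∀ p ∈ P, RemovableAt (φ p) p := by
  classical
  intro p hp
  set e := chartAt ℂ p
  set c := e p
  have hps : p ∈ e.source := mem_chart_source ℂ p
  obtain ⟨G, hG, hGd⟩ := C.ω02_fundamental.diagonal p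
  set B₁ : ℂ → ℂ := fun t => ∑ p' ∈ P.erase p, jac e t *
    res (fun s => coeff (chartAt ℂ p') (C.ω02 (e.symm t)) s * Ψ p' s) (chartAt ℂ p' p')
  set B₂ : ℂ → ℂ := fun t => res (fun s => G (t, s) * Ψ p s) c
  have hB₁ : ContinuousAt B₁ c := by
    refine tendsto_finsetSum _ fun p' hp' => ?_
    have hp'' := Finset.mem_erase.1 hp'
    exact continuousAt_jac_mul_res_ω02 C (Ne.symm hp''.1) (hΨ p' hp''.2)
  have hB₂ : ContinuousAt B₂ c := continuousAt_res_mul hG (hΨ p hp)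
  refine exists_analyticAt_of_res_div_sub (hφ p hp) (hB₁.add hB₂) ?_
  have h1 := (eventually_nhdsNE_iff_chart e hps).1 (eventually_nhdsNE_of_codiscrete h p)
  have h2 : ∀ᶠ t in 𝓝 c, ∀ᶠ s in 𝓝 c, t ≠ s → coeff₂ e e C.ω02 (t, s) = 1 / (t - s) ^ 2 + G (t, s) :=
    Eventually.curry_nhds hGd
  have h3 : ∀ᶠ t in 𝓝 c, ∀ᶠ s in 𝓝 c, AnalyticAt ℂ G (t, s) := Eventually.curry_nhds hG.eventually_analyticAt
  filter_upwards [h1, h2.filter_mono nhdsWithin_le_nhds, h3.filter_mono nhdsWithin_le_nhds, self_mem_nhdsWithin]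
    with t h1 h2 h3 htc
  have htc' : t - c ≠ 0 := sub_ne_zero.2 htc
  have hA : AnalyticAt ℂ (fun s => (t - s)⁻¹) c := (analyticAt_const.sub analyticAt_id).inv htc'
  have hb : AnalyticAt ℂ (fun s => 1 / (t - s) ^ 2) c := by
    simp only [one_div]
    exact ((analyticAt_const.sub analyticAt_id).pow 2).inv (pow_ne_zero _ htc')
  have hGt : AnalyticAt ℂ (fun s => G (t, s)) c :=
    AnalyticAt.comp_of_eq h3.self_of_nhds (by fun_prop : AnalyticAt ℂ (fun s : ℂ => (t, s)) c) rfl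
  have hne : ∀ᶠ s in 𝓝 c, t ≠ s := (isOpen_ne.eventually_mem (Ne.symm htc)).mono fun s hs => Ne.symm hs
  have hparts := res_mul_eq_neg_res_mul_of_hasDerivAt hA.meromorphicAt hb.meromorphicAt (hΨ p hp) (hφ p hp) (by
    filter_upwards [hne.filter_mono nhdsWithin_le_nhds] with s hs
    refine (((hasDerivAt_id s).const_sub t).inv (sub_ne_zero.2 hs)).congr_deriv ?_
    simp) (hd p hp)
  have e1 : res (fun s => coeff₂ e e C.ω02 (t, s) * Ψ p s) c =
      res (fun s => 1 / (t - s) ^ 2 * Ψ p s) c + B₂ t := by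
    rw [← res_add (hb.meromorphicAt.fun_mul (hΨ p hp)) (hGt.meromorphicAt.fun_mul (hΨ p hp))]
    refine res_congr ?_
    filter_upwards [h2.filter_mono nhdsWithin_le_nhds, hne.filter_mono nhdsWithin_le_nhds] with s h4 h5
    rw [h4 h5]
    ring
  have e2 := congrArg (jac e t * ·) h1
  simp only [mul_zero, Finset.mul_sum] at e2
  rw [← Finset.add_sum_erase _ _ hp] at e2
  change jac e t * res (fun s => coeff e (C.ω02 (e.symm t)) s * Ψ p s) c + B₁ t = 0 at e2
  have e3 : jac e t * res (fun s => coeff e (C.ω02 (e.symm t)) s * Ψ p s) c =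
    res (fun s => coeff₂ e e C.ω02 (t, s) * Ψ p s) c := jac_mul_res_ω02 C e (hΨ p hp) t
  rw [e3, e1] at e2
  have e4 : res (fun s => coeff e (φ p) s * (t - s)⁻¹) c = res (fun s => (t - s)⁻¹ * coeff e (φ p) s) c :=
    res_congr (Eventually.of_forall fun s => mul_comm _ _)
  rw [e4, hparts, Pi.add_apply]
  linear_combination -e2

theorem IsPrimitive.mono {U V : Set X} {α : X → X → ℂ} (h : IsPrimitive C U α) (hVU : V ⊆ U) : IsPrimitive C V α :=
  ⟨fun z hz => h.1 z (hVU hz), fun w₀ z hz => h.2 w₀ z (hVU hz), fun w₀ z hz => h.3 w₀ z (hVU hz)⟩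

/-- A primitive of `ω02` may be changed by a meromorphic `1`-form in `w₀`. -/
theorem IsPrimitive.add {U : Set X} {α : X → X → ℂ} (h : IsPrimitive C U α) {φ : X → ℂ}
    (hφ : IsMeromorphicOneForm φ) : IsPrimitive C U fun w₀ z => α w₀ z + φ w₀ := by
  refine ⟨fun z hz p => ?_, fun w₀ z hz => (h.2 w₀ z hz).fun_add (MeromorphicAt.const _ _),
    fun w₀ z hz hne => (h.3 w₀ z hz hne).add_const _⟩
  refine (MeromorphicAt.fun_add (h.1 z hz p) (hφ p)).congr (Eventually.of_forall fun t => ?_)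
  simp only [coeff]
  ring

/-- A primitive of `ω02` is holomorphic in `z ≠ w₀`. -/
theorem IsPrimitive.removableAt_mul {U : Set X} {α : X → X → ℂ} (h : IsPrimitive C U α) (hU : IsOpen U)
    [T2Space X] {w₀ p : X} (hp : p ∈ U) (hne : p ≠ w₀) {φ : X → ℂ} (hφ : RemovableAt φ p) :
    RemovableAt (fun z => α w₀ z * φ z) p := by
  obtain ⟨g, hg, e⟩ := hφ
  have hps := mem_chart_source ℂ p
  have han : AnalyticAt ℂ (fun t => α w₀ ((chartAt ℂ p).symm t)) (chartAt ℂ p p) := by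
    rw [Complex.analyticAt_iff_eventually_differentiableAt]
    have h1 : ∀ᶠ z in 𝓝 p, z ∈ U ∧ z ≠ w₀ := (hU.eventually_mem hp).and (isOpen_ne.eventually_mem hne)
    filter_upwards [(eventually_nhds_iff_chart _ hps).1 h1,
      (chartAt ℂ p).open_target.eventually_mem (mem_chart_target ℂ p)] with s hs hst
    exact ((hasPrimAt_iff (chart_mem_atlas p) hst).1 (h.deriv_right w₀ _ hs.1 hs.2)).differentiableAt
  refine ⟨_, han.fun_mul hg, ?_⟩
  filter_upwards [e] with t ht
  rw [coeff_mul, ht]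

end Residues

/-! ### Consequences of globalisability -/

section Recursion

variable {X : Type*} [TopologicalSpace X] [ChartedSpace ℂ X] [T2Space X] [IsManifold 𝓘(ℂ) ⊤ X]
  {C : SpectralCurve X}

theorem residueAt_const_mul {φ : X → ℂ} {p : X} (h : MerAt φ p) (c : ℂ) :
    residueAt (fun z => c * φ z) p = c * residueAt φ p := by
  rw [residueAt, residueAt, ← res_const_mul c h]
  exact res_congr (Eventually.of_forall fun t => coeff_mul _ (fun _ => c) _ _)

theorem eventually_ω01_ne_zero (C : SpectralCurve X) (p : X) : ∀ᶠ z in 𝓝[≠] p, C.ω01 z ≠ 0 := by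
  have h := (meromorphicOrderAt_ne_top_iff_eventually_ne_zero (C.ω01_meromorphic p)).1 (C.ω01_ne_zero p)
  rw [eventually_nhdsNE_iff_chart _ (mem_chart_source ℂ p)]
  filter_upwards [h] with t ht
  exact left_ne_zero_of_mul ht

namespace FibreNhd

variable {A : Set X} {b : OnePoint ℂ} {N : FibreNhd C A b}

theorem eventually_nhdsNE {p : X} (hp : p ∈ N.P) {Q : X → Prop}
    (h : ∀ᶠ u in 𝓝[≠] (0 : ℂ), Q (N.arc ⟨p, 0⟩ u)) : ∀ᶠ z in 𝓝[≠] p, Q z := by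
  rw [(N.std p hp).eventually_iff]
  refine eventually_of_eventually_pow (N.k_pos hp) ?_
  simpa only [arc_zero_index] using h

/-- Near the centre of a fibre neighbourhood, all the points of the fibre in `A` lie in its members. -/
theorem eventually_Qform_eq (ω : Correlators C) (g : ℕ) {n : ℕ} (w : Fin n → X) {p : X} (hp : p ∈ N.P) :
    ∀ᶠ z in 𝓝[≠] p, Qform ω (⋃ p ∈ N.P, (N.ζ p).source) g w z = Qform ω A g w z := by
  refine eventually_nhdsNE hp ?_
  filter_upwards [N.eventually_norm_lt] with u hu
  exact Qform_congr ω g w (fiber_arc_inter_A (i := ⟨p, 0⟩) hp hu.1).symm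

theorem isStandardNhd {p : X} (hp : p ∈ N.P) : IsStandardNhd C p (N.ζ p).source :=
  ⟨_, _, N.std p hp, rfl⟩

theorem merAt_Qform (hstd : HasStandardCoordinates C) (ω : Correlators C) (g : ℕ) {n : ℕ} {w : Fin n → X}
    (hw : ∀ k, w k ∉ C.Ram ∧ w k ∉ N.P) {p : X} (hp : p ∈ N.P) : MerAt (Qform ω A g w) p :=
  ((N.std p hp).merAt (meromorphicAt_coeff_Qform hstd ω (Finset.Subset.refl _) g hw hp)).congr
    (eventually_Qform_eq ω g w hp)

/-- The local recursion form is meromorphic at the points of the fibre, without residue. -/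
theorem Qform_source (hstd : HasStandardCoordinates C) {ω : Correlators C} (hglob : GlobalisableOver ω N.P)
    (g : ℕ) {n : ℕ} {w : Fin n → X} (hw : ∀ k, w k ∉ C.Ram ∧ w k ∉ N.P) {p : X} (hp : p ∈ N.P) :
    MerAt (Qform ω (N.ζ p).source g w) p ∧ residueAt (Qform ω (N.ζ p).source g w) p = 0 := by
  have hy := (hglob (fun p => (N.ζ p).source) (fun p hp => isStandardNhd hp) N.disj).1 p hp
  have h := res_coeff_Qform_source hstd ω g hw hp (by
    filter_upwards [hy] with z hz z' hz'
    exact hz z' ⟨⟨hz'.1.1, mem_biUnion hp hz'.1.2⟩, hz'.2⟩)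
  exact ⟨(N.std p hp).merAt h.1, by rw [(N.std p hp).residueAt_eq h.1, h.2]⟩

/-- Globalisability means that the terms of the integrand that involve distant points of the fibre
are holomorphic. -/
theorem removableAt_Qform_sub (hstd : HasStandardCoordinates C) {ω : Correlators C}
    (hglob : GlobalisableOver ω N.P) {α : X → X → ℂ} (hα : IsPrimitive C A α) {g n : ℕ}
    (hgn : 2 < 2 * g + (1 + n)) {w : Fin n → X} (hw : ∀ k, w k ∉ C.Ram ∧ w k ∉ N.P) {p : X} (hp : p ∈ N.P) :
    RemovableAt (fun z => Qform ω A g w z - Qform ω (N.ζ p).source g w z) p := by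
  classical
  set U : X → Set X := fun p => (N.ζ p).source
  set Qg := Qform ω (⋃ p ∈ N.P, U p) g w
  set Ql : X → X → ℂ := fun p => Qform ω (U p) g w
  set Qd : X → X → ℂ := fun p z => Qg z - Ql p z
  have hQg : ∀ p ∈ N.P, MerAt Qg p := fun p hp =>
    (N.std p hp).merAt (meromorphicAt_coeff_Qform hstd ω (Finset.Subset.refl _) g hw hp)
  have hQl : ∀ p ∈ N.P, MerAt (Ql p) p := fun p hp => (Qform_source hstd hglob g hw hp).1
  have hQd : ∀ p ∈ N.P, MerAt (Qd p) p := fun p hp => (hQg p hp).sub (hQl p hp)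
  have key : ∀ β : X → X → X → ℂ, (∀ p ∈ N.P, IsPrimitive C (U p) (β p)) →
      ∀ᶠ w₀ in codiscrete X, ∑ p ∈ N.P, residueAt (fun z => β p w₀ z * Qd p z) p = 0 := by
    intro β hβ
    filter_upwards [(hglob U (fun p hp => isStandardNhd hp) N.disj).2 β hβ g n hgn w hw] with w₀ h
    have e : ∀ p ∈ N.P, residueAt (fun z => β p w₀ z * Qd p z) p =
        residueAt (integrand ω (β p) (⋃ p ∈ N.P, U p) g w₀ w) p - residueAt (integrand ω (β p) (U p) g w₀ w) p := by
      intro p hp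
      have hm := (hβ p hp).meromorphic_right w₀ p (N.std p hp).mem_source
      rw [funext fun z => integrand_eq ω (β p) (⋃ p ∈ N.P, U p) g w₀ w z,
        funext fun z => integrand_eq ω (β p) (U p) g w₀ w z, ← residueAt_sub ((hQg p hp).mul hm) ((hQl p hp).mul hm)]
      simp only [Qd, mul_sub, Qg, Ql]
    rw [Finset.sum_congr rfl e, Finset.sum_sub_distrib, h, sub_self]
  have hα' : ∀ p ∈ N.P, IsPrimitive C (U p) α := fun p hp => hα.mono (N.subset p hp)
  have h1 := key (fun _ => α) hα'
  -- changing the primitive at one point shows that the residues vanish one by one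
  have hres : ∀ p ∈ N.P, residueAt (Qd p) p = 0 := by
    intro p hp
    have := nhdsNE_neBot p
    have h2 := key (Function.update (fun _ => α) p fun w₀ z => α w₀ z + C.ω01 w₀) (by
      intro p' hp'
      rcases eq_or_ne p' p with rfl | hne
      · rw [Function.update_self]
        exact (hα' p' hp').add C.ω01_meromorphic
      · rw [Function.update_of_ne hne]
        exact hα' p' hp')
    obtain ⟨w₀, ⟨h3, h4⟩, h5⟩ := (((eventually_nhdsNE_of_codiscrete h1 p).and
      (eventually_nhdsNE_of_codiscrete h2 p)).and (eventually_ω01_ne_zero C p)).exists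
    have h6 := sub_eq_zero.2 (h4.trans h3.symm)
    rw [← Finset.sum_sub_distrib, Finset.sum_eq_single_of_mem p hp (by
      intro p' _ hne
      rw [Function.update_of_ne hne, sub_self]), Function.update_self] at h6
    have hm := (hα' p hp).meromorphic_right w₀ p (N.std p hp).mem_source
    have hm' : MerAt (fun z => (α w₀ z + C.ω01 w₀) * Qd p z) p :=
      MerAt.mul (f := fun z => α w₀ z + C.ω01 w₀) (hm.fun_add (MeromorphicAt.const _ _)) (hQd p hp)
    rw [← residueAt_sub hm' ((hQd p hp).mul hm)] at h6
    have e : (fun z => (α w₀ z + C.ω01 w₀) * Qd p z - α w₀ z * Qd p z) = fun z => C.ω01 w₀ * Qd p z := by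
      ext z; ring
    rw [e, residueAt_const_mul (hQd p hp)] at h6
    exact (mul_eq_zero.1 h6).resolve_left h5
  have hex : ∀ p, ∃ Ψ : ℂ → ℂ, p ∈ N.P → MeromorphicAt Ψ (chartAt ℂ p p) ∧
      ∀ᶠ t in 𝓝[≠] (chartAt ℂ p p), HasDerivAt Ψ (coeff (chartAt ℂ p) (Qd p) t) t := by
    intro p
    by_cases hp : p ∈ N.P
    · obtain ⟨Ψ, h⟩ := exists_primitive_of_residueAt_eq_zero (hQd p hp) (hres p hp)
      exact ⟨Ψ, fun _ => h⟩
    · exact ⟨0, fun h => absurd h hp⟩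
  choose Ψ hΨ using hex
  refine (removableAt_of_sum_res_eq_zero (C := C) hQd (fun p hp => (hΨ p hp).1) (fun p hp => (hΨ p hp).2) ?_ p hp).congr ?_
  · filter_upwards [h1] with w₀ h
    rw [← neg_eq_zero, ← Finset.sum_neg_distrib, ← h]
    refine Finset.sum_congr rfl fun p hp => ?_
    exact (residueAt_primitive_mul (hα' p hp) ((N.ζ p).open_source.mem_nhds (N.std p hp).mem_source)
      (hQd p hp) (hΨ p hp).1 (hΨ p hp).2 w₀).symm
  · filter_upwards [eventually_Qform_eq ω g w hp] with z hz
    simp only [Qd, Qg, Ql]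
    rw [hz]

end FibreNhd

/-- The points of the fibre of `z` in a standard neighbourhood of `p` tend to `p` with `z`. -/
theorem IsStandardCoordinate.eventually_fiber_subset {p : X} {r : ℕ} {ζ : OpenPartialHomeomorph X ℂ}
    (h : IsStandardCoordinate C p r ζ) {V : Set X} (hV : IsOpen V) (hp : p ∈ V) :
    ∀ᶠ z in 𝓝 p, C.fiber z ∩ ζ.source ⊆ V := by
  obtain ⟨ε, hε, hb⟩ := Metric.eventually_nhds_iff_ball.1
    (eventually_mem_target ζ h.zero_mem_target hV (by rwa [h.symm_zero]))
  have h1 : ∀ᶠ z in 𝓝 p, z ∈ ζ.source ∧ ζ z ∈ ball (0 : ℂ) ε :=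
    (ζ.open_source.eventually_mem h.mem_source).and ((ζ.continuousAt h.mem_source).eventually
      (by rw [h.map_center]; exact ball_mem_nhds 0 hε))
  filter_upwards [h1] with z hz z' hz'
  have h2 : C.x z' = C.x z := hz'.1
  rw [h.x_eq hz'.2, h.x_eq hz.1] at h2
  have h3 := congrArg norm (sphereCoord_injective _ h2)
  rw [norm_pow, norm_pow] at h3
  have h4 : ‖ζ z'‖ = ‖ζ z‖ := (pow_left_inj₀ (norm_nonneg _) (norm_nonneg _) h.order_pos.ne').1 h3
  have h5 := (hb (ζ z') (by
    have := hz.2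
    rw [mem_ball_zero_iff] at this ⊢
    rwa [h4])).2
  rwa [ζ.left_inv hz'.2] at h5

theorem eventually_fiber_inter_eq {p : X} {U U' : Set X} (hU : IsStandardNhd C p U) (hU' : IsStandardNhd C p U') :
    ∀ᶠ z in 𝓝 p, C.fiber z ∩ U = C.fiber z ∩ U' := by
  obtain ⟨r, ζ, h, rfl⟩ := hU
  obtain ⟨r', ζ', h', rfl⟩ := hU'
  filter_upwards [h.eventually_fiber_subset ζ'.open_source h'.mem_source,
    h'.eventually_fiber_subset ζ.open_source h.mem_source] with z h1 h2
  exact Subset.antisymm (fun z' hz' => ⟨hz'.1, h1 hz'⟩) fun z' hz' => ⟨hz'.1, h2 hz'⟩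

theorem IsStandardNhd.mem_nhds {p : X} {U : Set X} (hU : IsStandardNhd C p U) : U ∈ 𝓝 p := by
  obtain ⟨r, ζ, h, rfl⟩ := hU
  exact ζ.open_source.mem_nhds h.mem_source

/-- In a standard neighbourhood of an unramified point there is no local recursion term. -/
theorem Qform_eq_zero_of_notMem_Ram (ω : Correlators C) (g : ℕ) {n : ℕ} (w : Fin n → X) {p : X} {U : Set X}
    (hU : IsStandardNhd C p U) (hp : p ∉ C.Ram) : ∀ᶠ z in 𝓝 p, Qform ω U g w z = 0 := by
  obtain ⟨r, ζ, h, rfl⟩ := hU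
  have hr : r = 1 := by
    have h1 := h.order_pos
    by_contra h2
    exact hp ⟨r, ζ, by omega, h⟩
  filter_upwards [ζ.open_source.eventually_mem h.mem_source] with z hz
  unfold Qform
  refine finsum_mem_of_eqOn_zero fun Z hZ => ?_
  exfalso
  obtain ⟨z', hz'⟩ := hZ.1
  have h1 := hZ.2 hz'
  have h2 : C.x z' = C.x z := h1.1.1
  rw [h.x_eq h1.1.2, h.x_eq hz, hr, pow_one, pow_one] at h2
  exact h1.2 (ζ.injOn h1.1.2 hz (sphereCoord_injective _ h2))

/-- The residue of the recursion integrand over `A` at `p` is the local one, which is continuous in `w₀`. -/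
theorem FibreNhd.residueAt_integrand {A : Set X} {b : OnePoint ℂ} {N : FibreNhd C A b}
    (hstd : HasStandardCoordinates C) {ω : Correlators C} (hglob : GlobalisableOver ω N.P) (hA : IsOpen A)
    {α : X → X → ℂ} (hα : IsPrimitive C A α) {g n : ℕ} (hgn : 2 < 2 * g + (1 + n)) {w : Fin n → X}
    (hw : ∀ k, w k ∉ C.Ram ∧ w k ∉ N.P) {p : X} (hp : p ∈ N.P) {U : Set X} (hU : IsStandardNhd C p U)
    {α' : X → X → ℂ} (hα' : IsPrimitive C U α') :
    (∀ w₀, p ≠ w₀ → residueAt (integrand ω α A g w₀ w) p = residueAt (integrand ω α' U g w₀ w) p) ∧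
    ∀ a, a ≠ p → ContinuousAt (fun t => jac (chartAt ℂ a) t *
      residueAt (integrand ω α' U g ((chartAt ℂ a).symm t) w) p) (chartAt ℂ a a) := by
  have hpA : p ∈ A := N.subset p hp (N.std p hp).mem_source
  obtain ⟨hm, h0⟩ := Qform_source hstd hglob g hw hp
  obtain ⟨Ψ, hΨ, hd⟩ := exists_primitive_of_residueAt_eq_zero hm h0
  have e1 : ∀ w₀, residueAt (integrand ω α' U g w₀ w) p =
      -res (fun s => coeff (chartAt ℂ p) (C.ω02 w₀) s * Ψ s) (chartAt ℂ p p) := by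
    intro w₀
    rw [← residueAt_primitive_mul hα' hU.mem_nhds hm hΨ hd w₀]
    refine residueAt_congr (Eventually.filter_mono nhdsWithin_le_nhds ?_)
    filter_upwards [eventually_fiber_inter_eq hU (FibreNhd.isStandardNhd hp)] with z hz
    rw [integrand_eq, Qform_congr ω g w hz]
  constructor
  · intro w₀ hw₀
    have h1 : RemovableAt (fun z => α w₀ z * (Qform ω A g w z - Qform ω (N.ζ p).source g w z)) p :=
      hα.removableAt_mul hA hpA hw₀ (removableAt_Qform_sub hstd hglob hα hgn hw hp)
    have hmr := hα.meromorphic_right w₀ p hpA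
    have h2 := h1.residueAt_eq_zero
    simp only [mul_sub] at h2
    rw [residueAt_sub ((merAt_Qform hstd ω g hw hp).mul hmr) (hm.mul hmr), sub_eq_zero] at h2
    rw [funext fun z => integrand_eq ω α A g w₀ w z, h2, e1, residueAt_primitive_mul hα (hA.mem_nhds hpA) hm hΨ hd]
  · intro a ha
    simp only [e1, mul_neg]
    exact (continuousAt_jac_mul_res_ω02 C ha hΨ).neg

/-- At unramified points the integrand over `A` is holomorphic. -/
theorem FibreNhd.removableAt_integrand {A : Set X} {b : OnePoint ℂ} {N : FibreNhd C A b}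
    (hstd : HasStandardCoordinates C) {ω : Correlators C} (hglob : GlobalisableOver ω N.P) (hA : IsOpen A)
    {α : X → X → ℂ} (hα : IsPrimitive C A α) {g n : ℕ} (hgn : 2 < 2 * g + (1 + n)) {w : Fin n → X}
    (hw : ∀ k, w k ∉ C.Ram ∧ w k ∉ N.P) {p : X} (hp : p ∈ N.P) (hpR : p ∉ C.Ram) {w₀ : X} (hw₀ : p ≠ w₀) :
    RemovableAt (integrand ω α A g w₀ w) p := by
  have hpA : p ∈ A := N.subset p hp (N.std p hp).mem_source
  refine (hα.removableAt_mul hA hpA hw₀ (removableAt_Qform_sub hstd hglob hα hgn hw hp)).congr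
    (Eventually.filter_mono nhdsWithin_le_nhds ?_)
  filter_upwards [Qform_eq_zero_of_notMem_Ram ω g w (FibreNhd.isStandardNhd hp) hpR] with z hz
  rw [integrand_eq, hz, sub_zero]

theorem FibreNhd.merAt_integrand {A : Set X} {b : OnePoint ℂ} {N : FibreNhd C A b}
    (hstd : HasStandardCoordinates C) (ω : Correlators C) {α : X → X → ℂ} (hα : IsPrimitive C A α) (g : ℕ) {n : ℕ}
    {w : Fin n → X} (hw : ∀ k, w k ∉ C.Ram ∧ w k ∉ N.P) {p : X} (hp : p ∈ N.P) (w₀ : X) :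
    MerAt (integrand ω α A g w₀ w) p := by
  rw [funext fun z => integrand_eq ω α A g w₀ w z]
  exact (merAt_Qform hstd ω g hw hp).mul (hα.meromorphic_right w₀ p (N.subset p hp (N.std p hp).mem_source))

theorem pts_cons {n : ℕ} (z : X) (w : Fin n → X) : pts (Fin.cons z w : Fin (n + 1) → X) = z ::ₘ pts w := by
  simp only [pts_eq_coe, List.ofFn_succ, Fin.cons_zero, Fin.cons_succ]
  rfl

/-- Away from the ramification points the correlators are continuous in their first argument. -/
theorem continuousAt_corr (ω : Correlators C) (hfin : C.Ram.Finite) {g n : ℕ} (hgn : 2 < 2 * g + (1 + n))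
    {w : Fin n → X} (hw : ∀ k, w k ∉ C.Ram) {a : X} (ha : a ∉ C.Ram) :
    ContinuousAt (fun t => jac (chartAt ℂ a) t * ω.corr g ((chartAt ℂ a).symm t ::ₘ pts w)) (chartAt ℂ a a) := by
  classical
  set p : Fin (n + 1) → X := Fin.cons a w
  set e := chartAt ℂ a
  obtain ⟨K, G, hG, he⟩ := ω.poles g (n + 1) (Nat.succ_pos n) (by omega) p
  set T : ℂ → Fin (n + 1) → ℂ := fun t => Fin.cons t fun k => chartAt ℂ (w k) (w k)
  have hT : Continuous T := by
    refine continuous_pi fun i => ?_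
    induction i using Fin.cases with
    | zero => exact continuous_id
    | succ k => exact continuous_const
  have hT0 : T (e a) = fun i => chartAt ℂ (p i) (p i) := by
    funext i
    induction i using Fin.cases with
    | zero => rfl
    | succ k => rfl
  rw [← hT0] at hG he
  have hpR : ∀ i, p i ∉ C.Ram := fun i => by
    induction i using Fin.cases with
    | zero => exact ha
    | succ k => exact hw k
  have hsymm : ∀ t, (fun i => (chartAt ℂ (p i)).symm (T t i)) = (Fin.cons (e.symm t) w : Fin (n + 1) → X) := by
    intro t
    funext i
    induction i using Fin.cases with
    | zero => rfl
    | succ k => exact (chartAt ℂ (w k)).left_inv (mem_chart_source ℂ _)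
  refine (ContinuousAt.comp (f := T) hG.continuousAt hT.continuousAt).congr ?_
  have hR : ∀ᶠ t in 𝓝 (e a), e.symm t ∉ C.Ram := by
    refine (e.continuousAt_symm (mem_chart_target ℂ a)).preimage_mem_nhds (t := C.Ramᶜ) ?_
    rw [e.left_inv (mem_chart_source ℂ a)]
    exact hfin.isClosed.isOpen_compl.mem_nhds ha
  filter_upwards [hT.continuousAt.eventually he, hR] with t h1 h2
  have h3 := h1 (by
    intro i
    rw [congrFun (hsymm t) i]
    induction i using Fin.cases with
    | zero => exact h2
    | succ k => exact hw k)
  rw [hsymm t, pts_cons, Fin.prod_univ_succ, Finset.prod_congr rfl fun i _ => if_neg (hpR i)] at h3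
  have h4 : ∀ k : Fin n, jac (chartAt ℂ (p k.succ)) (T t k.succ) = 1 := fun k => jac_chartAt_self (w k)
  simp only [h4, Finset.prod_const_one, mul_one] at h3
  change G (T t) = _
  rw [← h3, mul_comm]
  rfl

/-- An equality of `1`-forms off a discrete set extends to the points where both are continuous. -/
theorem eq_of_eventually_codiscrete {φ ψ : X → ℂ} {a : X}
    (hφ : ContinuousAt (fun t => jac (chartAt ℂ a) t * φ ((chartAt ℂ a).symm t)) (chartAt ℂ a a))
    (hψ : ContinuousAt (fun t => jac (chartAt ℂ a) t * ψ ((chartAt ℂ a).symm t)) (chartAt ℂ a a))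
    (h : ∀ᶠ z in codiscrete X, φ z = ψ z) : φ a = ψ a := by
  have h1 := (eventually_nhdsNE_iff_chart _ (mem_chart_source ℂ a)).1 (eventually_nhdsNE_of_codiscrete h a)
  have h2 := (hφ.eventuallyEq_nhds_iff_eventuallyEq_nhdsNE hψ).1 (by
    filter_upwards [h1] with t ht
    rw [ht])
  have h3 := h2.eq_of_nhds
  simpa only [jac_chartAt_self, one_mul, (chartAt ℂ a).left_inv (mem_chart_source ℂ a)] using h3

end Recursion

/-! ### Topological recursion over the components of a disc collection -/

section Components

variable {X : Type*} [TopologicalSpace X] [ChartedSpace ℂ X] [T2Space X] [IsManifold 𝓘(ℂ) ⊤ X]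
  {C : SpectralCurve X}

theorem IsComponentOver.subset {D : Set (OnePoint ℂ)} {Dt : Set X} (h : IsComponentOver C D Dt) :
    Dt ⊆ C.x ⁻¹' D := by
  obtain ⟨p, -, rfl⟩ := h
  exact connectedComponentIn_subset _ _

theorem IsComponentOver.eq_connectedComponentIn {D : Set (OnePoint ℂ)} {Dt : Set X}
    (h : IsComponentOver C D Dt) {z : X} (hz : z ∈ Dt) : Dt = connectedComponentIn (C.x ⁻¹' D) z := by
  obtain ⟨p, -, rfl⟩ := h
  exact connectedComponentIn_eq hz

variable {k : ℕ} {D : Fin k → Set (OnePoint ℂ)}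

theorem IsAdapted.eq_of_mem (hD : IsAdapted C D) {b : OnePoint ℂ} {i j : Fin k} (hi : b ∈ D i) (hj : b ∈ D j) :
    i = j := by
  by_contra h
  exact (hD.disjoint h).le_bot ⟨subset_closure hi, subset_closure hj⟩

theorem IsAdapted.exists_plusComponent (hD : IsAdapted C D) {p : X} (hp : p ∈ C.Ram) :
    ∃ i, ∃ Dt ∈ plusComponents C (D i), p ∈ Dt := by
  obtain ⟨i, hi⟩ := mem_iUnion.1 (hD.covers_branch_points ⟨p, hp, rfl⟩)
  have h : p ∈ connectedComponentIn (C.x ⁻¹' D i) p := mem_connectedComponentIn hi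
  exact ⟨i, _, ⟨⟨p, hi, rfl⟩, p, h, hp⟩, h⟩

theorem IsAdapted.Ram_subset (hD : IsAdapted C D) : C.Ram ⊆ plusUnion C D := fun p hp => by
  obtain ⟨i, Dt, h, hpD⟩ := hD.exists_plusComponent hp
  exact mem_iUnion.2 ⟨i, Dt, h, hpD⟩

/-- The components over the discs of an adapted collection have fibre neighbourhoods, since `x` is proper
on them, and globalisability holds over each fibre. -/
theorem IsAdapted.exists_fibreNhd (hD : IsAdapted C D) (hstd : HasStandardCoordinates C) {ω : Correlators C}
    {i : Fin k} {Dt : Set X} (h : IsComponentOver C (D i) Dt) (hglob : GlobalisableOverOpen ω Dt)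
    {b : OnePoint ℂ} (hb : b ∈ D i) : ∃ N : FibreNhd C Dt b, GlobalisableOver ω N.P := by
  obtain ⟨h1, h2⟩ := hD.branched_covering i Dt h
  rw [← h1] at hb
  obtain ⟨p, hp, rfl⟩ := hb
  obtain ⟨P, hP, hg⟩ := hglob p hp
  obtain ⟨N, rfl, -⟩ := TopRec.exists_fibreNhd hstd (h.isOpen (hD.isOpen i)) (hD.isOpen i) h2 (h.subset hp) P
    (by rw [hP, SpectralCurve.fiber, inter_comm]) (fun _ => univ) fun _ _ => ⟨isOpen_univ, trivial⟩
  exact ⟨N, hg⟩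

theorem FibreNhd.mem_P {A : Set X} {b : OnePoint ℂ} (N : FibreNhd C A b) {p : X} : p ∈ N.P ↔ p ∈ A ∧ C.x p = b := by
  rw [← Finset.mem_coe, N.coe_P]
  rfl

theorem SatisfiesTR.hasStandardCoordinates {ω : Correlators C} (hω : SatisfiesTR ω) : HasStandardCoordinates C := by
  obtain ⟨U, α, h, -⟩ := hω
  intro p
  obtain ⟨r, ζ, hζ, -⟩ := (h p).1
  exact ⟨r, ζ, hζ⟩

/-- A sum over all ramification points, distributed over the components that contain them. -/
theorem IsAdapted.sum_plusComponents (hD : IsAdapted C D) (hfin : C.Ram.Finite) {f : Fin k → Set X → X → ℂ} {r : X → ℂ}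
    (hf : ∀ i, ∀ Dt ∈ plusComponents C (D i), ∀ p ∈ C.Ram, p ∈ Dt → f i Dt p = r p) :
    ∑ p ∈ hfin.toFinset, r p =
      ∑ i, ∑ᶠ Dt ∈ plusComponents C (D i), ∑ p ∈ (hfin.inter_of_right Dt).toFinset, f i Dt p := by
  classical
  have hT : ∀ i, plusComponents C (D i) =
      ((hfin.toFinset.filter fun p => C.x p ∈ D i).image fun p => connectedComponentIn (C.x ⁻¹' D i) p : Finset (Set X)) := by
    intro i
    ext Dt
    simp only [Finset.coe_image, Finset.coe_filter, Finite.mem_toFinset, mem_image]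
    constructor
    · rintro ⟨h, p, hp, hpR⟩
      exact ⟨p, ⟨hpR, h.subset hp⟩, (h.eq_connectedComponentIn hp).symm⟩
    · rintro ⟨p, ⟨hpR, hp⟩, rfl⟩
      exact ⟨⟨p, hp, rfl⟩, p, mem_connectedComponentIn hp, hpR⟩
  have hT' := fun i => finsum_mem_eq_finite_toFinset_sum (M := ℂ)
    (fun Dt => ∑ p ∈ (hfin.inter_of_right Dt).toFinset, f i Dt p)
    (show (plusComponents C (D i)).Finite from by rw [hT]; exact Finset.finite_toSet _)
  simp only [hT']
  have e : ∀ Dt : Set X, (hfin.inter_of_right Dt).toFinset = hfin.toFinset.filter fun p => p ∈ Dt := by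
    intro Dt
    ext p
    simp [and_comm]
  simp only [e, Finset.sum_filter]
  rw [Finset.sum_congr rfl fun i _ => Finset.sum_comm, Finset.sum_comm]
  refine Finset.sum_congr rfl fun p hp => ?_
  have hpR := hfin.mem_toFinset.1 hp
  obtain ⟨i, V, h1, h2⟩ := hD.exists_plusComponent hpR
  rw [Finset.sum_eq_single_of_mem i (Finset.mem_univ _), Finset.sum_eq_single_of_mem V, if_pos h2, hf i V h1 p hpR h2]
  · exact (Finite.mem_toFinset _).2 h1
  · intro Dt hDt hne
    rw [Finite.mem_toFinset] at hDt
    refine if_neg fun h => hne ?_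
    rw [hDt.1.eq_connectedComponentIn h, h1.1.eq_connectedComponentIn h2]
  · intro j _ hne
    refine Finset.sum_eq_zero fun Dt hDt => if_neg fun h => hne ?_
    rw [Finite.mem_toFinset] at hDt
    exact hD.eq_of_mem (hDt.1.subset h) (h1.1.subset h2)

/-- Topological recursion as an equality of values, with primitives over the components. -/
theorem corr_eq_sum_residueAt (hfin : C.Ram.Finite) {ω : Correlators C} (hω : SatisfiesTR ω) (hD : IsAdapted C D)
    (hglob : ∀ i, ∀ Dt ∈ plusComponents C (D i), GlobalisableOverOpen ω Dt) {α : Fin k → Set X → X → X → ℂ}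
    (hα : ∀ i, ∀ Dt ∈ plusComponents C (D i), IsPrimitive C Dt (α i Dt)) {g n : ℕ} (hgn : 2 < 2 * g + (1 + n))
    {w₀ : X} {w : Fin n → X} (hw₀ : w₀ ∉ plusUnion C D) (hw : ∀ l, w l ∉ plusUnion C D) :
    ω.corr g (w₀ ::ₘ pts w) = ∑ i, ∑ᶠ Dt ∈ plusComponents C (D i),
      ∑ p ∈ (hfin.inter_of_right Dt).toFinset, residueAt (integrand ω (α i Dt) Dt g w₀ w) p := by
  have hstd := hω.hasStandardCoordinates
  obtain ⟨U, β, hU, hTR⟩ := hω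
  have hwR : ∀ l, w l ∉ C.Ram := fun l h => hw l (hD.Ram_subset h)
  have key : ∀ i, ∀ Dt ∈ plusComponents C (D i), ∀ p ∈ C.Ram, p ∈ Dt →
      (∀ w₀, p ≠ w₀ → residueAt (integrand ω (α i Dt) Dt g w₀ w) p =
        residueAt (integrand ω (β p) (U p) g w₀ w) p) ∧
      ∀ a, a ≠ p → ContinuousAt (fun t => jac (chartAt ℂ a) t *
        residueAt (integrand ω (β p) (U p) g ((chartAt ℂ a).symm t) w) p) (chartAt ℂ a a) := by
    intro i Dt h p hp hpD
    obtain ⟨N, hN⟩ := hD.exists_fibreNhd hstd h.1 (hglob _ _ h) (h.1.subset hpD)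
    exact FibreNhd.residueAt_integrand (N := N) hstd hN (h.1.isOpen (hD.isOpen _)) (hα _ _ h) hgn
      (fun l => ⟨hwR l, fun h' => hw l (mem_iUnion.2 ⟨i, Dt, h, (N.mem_P.1 h').1⟩)⟩)
      (N.mem_P.2 ⟨hpD, rfl⟩) (hU p).1 (hU p).2
  have h0 : ∀ w₀, ∀ p ∉ C.Ram, residueAt (integrand ω (β p) (U p) g w₀ w) p = 0 := by
    intro w₀ p hp
    refine ((removableAt_zero p).congr ((Qform_eq_zero_of_notMem_Ram ω g w (hU p).1 hp).filter_mono
      nhdsWithin_le_nhds |>.mono fun z hz => ?_)).residueAt_eq_zero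
    rw [integrand_eq, hz, mul_zero]
  -- the recursion holds off a discrete set of `w₀`; both sides are continuous at `w₀ ∉ Ram`
  have hTR' : ∀ᶠ w₀ in codiscrete X, ω.corr g (w₀ ::ₘ pts w) =
      ∑ p ∈ hfin.toFinset, residueAt (integrand ω (β p) (U p) g w₀ w) p := by
    filter_upwards [hTR g n hgn w hwR] with w₀ h
    rw [h]
    refine finsum_eq_sum_of_support_subset _ fun p hp => ?_
    rw [Finite.coe_toFinset]
    by_contra h'
    exact hp (h0 w₀ p h')
  have hw₀R : w₀ ∉ C.Ram := fun h => hw₀ (hD.Ram_subset h)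
  have hne : ∀ p ∈ C.Ram, p ≠ w₀ := fun p hp h => hw₀R (h ▸ hp)
  rw [← hD.sum_plusComponents hfin (r := fun p => residueAt (integrand ω (β p) (U p) g w₀ w) p)
    fun i Dt h p hp hpD => (key i Dt h p hp hpD).1 w₀ (hne p hp)]
  refine eq_of_eventually_codiscrete (φ := fun w₀ => ω.corr g (w₀ ::ₘ pts w))
    (ψ := fun w₀ => ∑ p ∈ hfin.toFinset, residueAt (integrand ω (β p) (U p) g w₀ w) p)
    (continuousAt_corr ω hfin hgn hwR hw₀R) ?_ hTR'
  simp only [Finset.mul_sum]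
  refine tendsto_finsetSum _ fun p hp => ?_
  have hpR := hfin.mem_toFinset.1 hp
  obtain ⟨i, Dt, h, hpD⟩ := hD.exists_plusComponent hpR
  exact (key i Dt h p hpR hpD).2 w₀ (hne p hpR).symm

end Components

/-! ### The trace of a `1`-form -/

/-- In the coordinate `v = sphereCoord⁻¹` around its value, an injective holomorphic map to the sphere is
a local coordinate. -/
theorem HolomorphicAt.exists_sphereCoord_lift {φ : ℂ → OnePoint ℂ} {c : ℂ} (hφ : HolomorphicAt φ c) {U : Set ℂ}
    (hU : U ∈ 𝓝 c) (hinj : InjOn φ U) :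
    ∃ v : ℂ → ℂ, AnalyticAt ℂ v c ∧ v c = 0 ∧ deriv v c ≠ 0 ∧ (∀ᶠ u in 𝓝 c, φ u = sphereCoord (φ c) (v u)) ∧
      ∀ᶠ u in 𝓝[≠] c, v u ≠ 0 ∧ deriv (fun u => affine (φ u)) u = sphereDeriv (φ c) (v u) * deriv v u := by
  obtain ⟨v, hv, hv0, he⟩ : ∃ v : ℂ → ℂ, AnalyticAt ℂ v c ∧ v c = 0 ∧ ∀ᶠ u in 𝓝 c, φ u = sphereCoord (φ c) (v u) := by
    by_cases h : φ c = ∞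
    · refine ⟨fun u => (affine (φ u))⁻¹, hφ.2.2 h, by simp [h], ?_⟩
      have h1 : ∀ᶠ u in 𝓝 c, φ u ≠ ((0 : ℂ) : OnePoint ℂ) :=
        hφ.1.eventually_ne (by rw [h]; exact OnePoint.infty_ne_coe 0)
      filter_upwards [h1] with u hu
      rw [h]
      refine eq_sphereCoord_infty ?_
      by_cases h2 : φ u = ∞
      · exact Or.inr h2
      · refine Or.inl fun h3 => hu ?_
        rw [← coe_affine h2, h3]
    · refine ⟨fun u => affine (φ u) - affine (φ c), (hφ.2.1 h).fun_sub analyticAt_const, sub_self _, ?_⟩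
      filter_upwards [hφ.1.eventually_ne h] with u hu using eq_sphereCoord_of_finite h hu
  have hd : deriv v c ≠ 0 := by
    refine deriv_ne_zero_of_injOn hv (inter_mem hU he) fun u hu u' hu' h => hinj hu.1 hu'.1 ?_
    have h1 : φ u = sphereCoord (φ c) (v u) := hu.2
    have h2 : φ u' = sphereCoord (φ c) (v u') := hu'.2
    rw [h1, h2, h]
  refine ⟨v, hv, hv0, hd, he, ?_⟩
  have h1 := hv.differentiableAt.hasDerivAt.eventually_ne (c := (0 : ℂ)) hd
  filter_upwards [h1, he.eventually_nhds.filter_mono nhdsWithin_le_nhds,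
    hv.eventually_analyticAt.filter_mono nhdsWithin_le_nhds] with u hu1 hu2 hu3
  refine ⟨hu1, ?_⟩
  have h2 := HasDerivAt.comp (h := v) u (hasDerivAt_affine_sphereCoord (φ c) hu1) hu3.differentiableAt.hasDerivAt
  refine (h2.congr_of_eventuallyEq ?_).deriv
  filter_upwards [hu2] with u' hu'
  simp only [Function.comp, hu']

section Trace

variable {X : Type*} [TopologicalSpace X] [ChartedSpace ℂ X] [T2Space X] [IsManifold 𝓘(ℂ) ⊤ X]
  {C : SpectralCurve X} {η : X → ℂ}

/-- The primitive of a form with a removable singularity, in any coordinate. -/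
theorem RemovableAt.exists_locPrim {p : X} (h : RemovableAt η p) {e : OpenPartialHomeomorph X ℂ}
    (he : e ∈ IsManifold.maximalAtlas 𝓘(ℂ) ⊤ X) (hp : p ∈ e.source) :
    ∃ G g : ℂ → ℂ, AnalyticAt ℂ g (e p) ∧ AnalyticAt ℂ G (e p) ∧ (∀ᶠ t in 𝓝 (e p), HasDerivAt G (g t) t) ∧
      coeff e η =ᶠ[𝓝[≠] (e p)] g ∧ LocPrim η p fun z => G (e z) := by
  obtain ⟨g₀, hg₀, e₀⟩ := h
  set c := chartAt ℂ p
  have hc := chart_mem_atlas (X := X) p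
  have hpc : p ∈ c.source := mem_chart_source ℂ p
  have htr := analyticAt_transition he hc (e.map_source hp) (by rwa [e.left_inv hp])
  set g : ℂ → ℂ := fun t => g₀ (c (e.symm t)) * deriv (fun s => c (e.symm s)) t
  have hg : AnalyticAt ℂ g (e p) :=
    (AnalyticAt.comp_of_eq (f := fun t => c (e.symm t)) hg₀ htr (by rw [e.left_inv hp])).fun_mul htr.deriv
  have heq : coeff e η =ᶠ[𝓝[≠] (e p)] g := by
    have h1 : ∀ᶠ z in 𝓝[≠] p, coeff c η (c z) = g₀ (c z) := by
      rw [eventually_nhdsNE_iff_chart c hpc]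
      filter_upwards [e₀, (c.open_target.eventually_mem (c.map_source hpc)).filter_mono nhdsWithin_le_nhds]
        with t h1 h2
      rwa [c.right_inv h2]
    rw [eventually_nhdsNE_iff_chart e hp] at h1
    filter_upwards [h1, (coeff_eventuallyEq he hc η hp hpc).filter_mono nhdsWithin_le_nhds] with t h2 h3
    rw [h3, h2]
  obtain ⟨G, hG, hd⟩ := hg.exists_hasDerivAt
  refine ⟨G, g, hg, hG, hd, heq, ?_, ?_⟩
  · refine analyticAt_comp_symm_of hc he hpc hp (f := fun z => G (e z)) (hG.congr ?_)
    filter_upwards [e.open_target.eventually_mem (e.map_source hp)] with t ht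
    rw [e.right_inv ht]
  · rw [eventually_nhdsNE_iff_chart e hp]
    filter_upwards [hd.filter_mono nhdsWithin_le_nhds, heq,
      (e.open_target.eventually_mem (e.map_source hp)).filter_mono nhdsWithin_le_nhds] with t h1 h2 h3
    rw [hasPrimAt_iff he h3, h2]
    refine h1.congr_of_eventuallyEq ?_
    filter_upwards [e.open_target.eventually_mem h3] with s hs
    rw [e.right_inv hs]

variable (C η) in
/-- The trace of the form `η` from `S` to the sphere, as coefficient with respect to the affine coordinate. -/
noncomputable def fibreSum (S : Set X) (s : OnePoint ℂ) : ℂ := ∑ᶠ z ∈ S ∩ C.x ⁻¹' {s}, η z / C.dx z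

variable (C η) in
/-- The trace of `η` from the domain of `ζ`, in the coordinate of the sphere around `q`. -/
noncomputable def localTrace (ζ : OpenPartialHomeomorph X ℂ) (q : OnePoint ℂ) (w : ℂ) : ℂ :=
  sphereDeriv q w * fibreSum C η ζ.source (sphereCoord q w)

namespace IsStandardCoordinate

variable {p : X} {r : ℕ} {ζ : OpenPartialHomeomorph X ℂ}

theorem zetaRoot_mul_mem_target (h : IsStandardCoordinate C p r ζ) {s : ℂ} (hs : s ∈ ζ.target) (j : ℕ) :
    zetaRoot r j * s ∈ ζ.target := by
  obtain ⟨ρ, -, e⟩ := h.target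
  rw [e, mem_ball_zero_iff] at hs ⊢
  rwa [norm_mul, norm_zetaRoot h.order_pos, one_mul]

theorem source_inter_preimage (h : IsStandardCoordinate C p r ζ) {s : ℂ} (hs : s ∈ ζ.target) :
    ζ.source ∩ C.x ⁻¹' {sphereCoord (C.x p) (s ^ r)} = (fun j => ζ.symm (zetaRoot r j * s)) '' (Finset.range r) := by
  ext z
  constructor
  · rintro ⟨hz, hx⟩
    rw [mem_preimage, mem_singleton_iff, h.x_eq hz] at hx
    obtain ⟨j, hj, e⟩ := exists_zetaRoot_mul h.order_pos (sphereCoord_injective _ hx)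
    exact ⟨j, hj, by simp only [← e, ζ.left_inv hz]⟩
  · rintro ⟨j, hj, rfl⟩
    have hj' := h.zetaRoot_mul_mem_target hs j
    refine ⟨ζ.map_target hj', ?_⟩
    rw [mem_preimage, mem_singleton_iff, h.x_symm hj', mul_pow, zetaRoot_pow h.order_pos, one_mul]

/-- The local trace at `s ^ r` is a sum over the rotations of `s`, which make up the fibre near `p`. -/
theorem localTrace_pow (h : IsStandardCoordinate C p r ζ) (η : X → ℂ) {s : ℂ} (hs : s ∈ ζ.target) (h0 : s ≠ 0) :
    localTrace C η ζ (C.x p) (s ^ r) =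
      ∑ j ∈ Finset.range r, coeff ζ η (zetaRoot r j * s) / (r * (zetaRoot r j * s) ^ (r - 1)) := by
  have hinj : InjOn (fun j => ζ.symm (zetaRoot r j * s)) (Finset.range r) := by
    intro i hi j hj e
    exact zetaRoot_injOn h.order_pos hi hj (mul_right_cancel₀ h0
      (ζ.symm.injOn (h.zetaRoot_mul_mem_target hs i) (h.zetaRoot_mul_mem_target hs j) e))
  rw [localTrace, fibreSum, h.source_inter_preimage hs, finsum_mem_image hinj, finsum_mem_coe_finset, Finset.mul_sum]
  refine Finset.sum_congr rfl fun j _ => ?_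
  have hj := h.zetaRoot_mul_mem_target hs j
  have hj0 : zetaRoot r j * s ≠ 0 := mul_ne_zero (zetaRoot_ne_zero r j) h0
  have h1 := h.coeff_dx hj hj0
  have h2 := h.coeff_dx_ne_zero hj hj0
  have h3 := jac_ne_zero h.mem_atlas hj
  have hsd := sphereDeriv_ne_zero (C.x p) (pow_ne_zero r h0)
  rw [mul_pow (n := r), zetaRoot_pow h.order_pos, one_mul] at h1
  have h4 : η (ζ.symm (zetaRoot r j * s)) / C.dx (ζ.symm (zetaRoot r j * s)) =
      coeff ζ η (zetaRoot r j * s) / coeff ζ C.dx (zetaRoot r j * s) := by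
    rw [coeff, coeff, mul_div_mul_right _ _ h3]
  rw [h4, h1, ← mul_div_assoc, mul_div_mul_left _ _ hsd]

theorem eventually_localTrace_pow (h : IsStandardCoordinate C p r ζ) (η : X → ℂ) : ∀ᶠ s in 𝓝[≠] (0 : ℂ),
    localTrace C η ζ (C.x p) (s ^ r) =
      ∑ j ∈ Finset.range r, coeff ζ η (zetaRoot r j * s) / (r * (zetaRoot r j * s) ^ (r - 1)) := by
  filter_upwards [self_mem_nhdsWithin, (ζ.open_target.eventually_mem h.zero_mem_target).filter_mono nhdsWithin_le_nhds]
    with s h0 hs using h.localTrace_pow η hs h0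

/-- Taking the trace preserves residues, also at a ramification point. -/
theorem meromorphicAt_localTrace (h : IsStandardCoordinate C p r ζ) (hη : MerAt η p) :
    MeromorphicAt (localTrace C η ζ (C.x p)) 0 ∧ res (localTrace C η ζ (C.x p)) 0 = residueAt η p := by
  rw [h.residueAt_eq (h.meromorphicAt_coeff hη)]
  exact meromorphicAt_trace h.order_pos (h.meromorphicAt_coeff hη) (h.eventually_localTrace_pow η)

theorem localTrace_eventuallyEq (h : IsStandardCoordinate C p 1 ζ) (η : X → ℂ) :
    localTrace C η ζ (C.x p) =ᶠ[𝓝[≠] 0] coeff ζ η := by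
  filter_upwards [h.eventually_localTrace_pow η] with s hs
  simpa [zetaRoot_zero] using hs

theorem order_eq_one (h : IsStandardCoordinate C p r ζ) (hp : p ∉ C.Ram) : r = 1 := by
  have h1 := h.order_pos
  by_contra h2
  exact hp ⟨r, ζ, by omega, h⟩

end IsStandardCoordinate

namespace FibreNhd

variable {A : Set X} {b : OnePoint ℂ}

theorem inter_preimage_eq (N : FibreNhd C A b) {w : ℂ} (hw : ‖w‖ < N.ρ ^ N.m) :
    A ∩ C.x ⁻¹' {sphereCoord b w} = ⋃ p ∈ (N.P : Set X), (N.ζ p).source ∩ C.x ⁻¹' {sphereCoord b w} := by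
  ext z
  simp only [mem_iUnion]
  constructor
  · rintro ⟨hz, hx⟩
    obtain ⟨p, hp, hzp⟩ := N.exhaust z hz w hw hx
    exact ⟨p, hp, hzp, hx⟩
  · rintro ⟨p, hp, hzp, hx⟩
    exact ⟨N.subset p hp hzp, hx⟩

/-- The trace from `A` is the sum of the traces from the members of a fibre neighbourhood. -/
theorem fibreSum_eq (N : FibreNhd C A b) (η : X → ℂ) {w : ℂ} (hw : ‖w‖ < N.ρ ^ N.m) :
    fibreSum C η A (sphereCoord b w) = ∑ p ∈ N.P, fibreSum C η (N.ζ p).source (sphereCoord b w) := by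
  unfold fibreSum
  rw [N.inter_preimage_eq hw, finsum_mem_biUnion, finsum_mem_coe_finset]
  · intro p hp p' hp' hne
    exact (N.disj hp hp' hne).mono inter_subset_left inter_subset_left
  · exact N.P.finite_toSet
  · intro p hp
    obtain ⟨s, rfl⟩ := IsAlgClosed.exists_pow_nat_eq w (N.std p hp).order_pos
    have hs : s ∈ (N.ζ p).target := by
      rw [N.target p hp, mem_ball_zero_iff]
      rw [norm_pow, ← N.k_mul p hp, pow_mul] at hw
      exact lt_of_pow_lt_pow_left₀ _ (pow_nonneg N.ρ_pos.le _) hw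
    have h := (Finset.finite_toSet (Finset.range (N.r p))).image fun j => (N.ζ p).symm (zetaRoot (N.r p) j * s)
    rwa [← (N.std p hp).source_inter_preimage hs, N.x_center hp] at h

end FibreNhd

/-- The pullback by `φ` of the trace of `η` from `A` is meromorphic, its residue is the sum of the residues
of `η` along the fibre, and it is holomorphic if `η` is and the fibre is unramified. -/
theorem trace_comp {A : Set X} {φ : ℂ → OnePoint ℂ} {c : ℂ} (hφ : HolomorphicAt φ c) {U : Set ℂ} (hU : U ∈ 𝓝 c)
    (hinj : InjOn φ U) (N : FibreNhd C A (φ c)) (hη : ∀ p ∈ N.P, MerAt η p) :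
    MeromorphicAt (fun u => fibreSum C η A (φ u) * deriv (fun u => affine (φ u)) u) c ∧
    res (fun u => fibreSum C η A (φ u) * deriv (fun u => affine (φ u)) u) c = ∑ p ∈ N.P, residueAt η p := by
  obtain ⟨v, hv, hv0, hvd, he, hd⟩ := hφ.exists_sphereCoord_lift hU hinj
  have hlt : ∀ᶠ u in 𝓝 c, ‖v u‖ < N.ρ ^ N.m := by
    refine hv.continuousAt.norm.eventually (gt_mem_nhds ?_)
    simpa only [hv0, norm_zero] using pow_pos N.ρ_pos _
  have heq : (fun u => ∑ p ∈ N.P, localTrace C η (N.ζ p) (φ c) (v u) * deriv v u) =ᶠ[𝓝[≠] c]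
      fun u => fibreSum C η A (φ u) * deriv (fun u => affine (φ u)) u := by
    filter_upwards [he.filter_mono nhdsWithin_le_nhds, hd, hlt.filter_mono nhdsWithin_le_nhds] with u h1 h2 h3
    simp only [localTrace]
    rw [h2.2, h1, N.fibreSum_eq η h3, ← Finset.sum_mul, ← Finset.mul_sum]
    ring
  have hm : ∀ p ∈ N.P, MeromorphicAt (localTrace C η (N.ζ p) (φ c)) (v c) ∧
      res (localTrace C η (N.ζ p) (φ c)) (v c) = residueAt η p := by
    intro p hp
    have h := (N.std p hp).meromorphicAt_localTrace (hη p hp)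
    rwa [N.x_center hp, ← hv0] at h
  have hm' : ∀ p ∈ N.P, MeromorphicAt (fun u => localTrace C η (N.ζ p) (φ c) (v u) * deriv v u) c := fun p hp =>
    (MeromorphicAt.comp_analyticAt (f := localTrace C η (N.ζ p) (φ c)) (g := v) (hm p hp).1 hv).fun_mul
      hv.deriv.meromorphicAt
  refine ⟨(MeromorphicAt.fun_sum hm').congr heq, ?_⟩
  rw [← res_congr heq, res_sum _ hm']
  refine Finset.sum_congr rfl fun p hp => ?_
  rw [res_comp_mul_deriv_of_deriv_ne_zero (hm p hp).1 hv hvd, (hm p hp).2]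

/-- Over an unramified value, where `η` is holomorphic, the trace of `η` has a holomorphic primitive: the sum
of the local primitives of `η` at the points of the fibre. -/
theorem trace_comp_of_unramified {A : Set X} {φ : ℂ → OnePoint ℂ} {c : ℂ} (hφ : HolomorphicAt φ c) {U : Set ℂ}
    (hU : U ∈ 𝓝 c) (hinj : InjOn φ U) (N : FibreNhd C A (φ c)) (hη : ∀ p ∈ N.P, RemovableAt η p)
    (hR : ∀ p ∈ N.P, p ∉ C.Ram) :
    ∃ (f : X → X → ℂ) (h : X → ℂ → ℂ), (∀ p ∈ N.P, LocPrim η p (f p)) ∧ (∀ p ∈ N.P, AnalyticAt ℂ (h p) c) ∧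
      (∀ p ∈ N.P, ∀ᶠ u in 𝓝 c, ∀ z ∈ (N.ζ p).source, C.x z = φ u → f p z = h p u) ∧
      ∀ᶠ u in 𝓝[≠] c, ∑ p ∈ N.P, deriv (h p) u = fibreSum C η A (φ u) * deriv (fun u => affine (φ u)) u := by
  obtain ⟨v, hv, hv0, hvd, he, hd⟩ := hφ.exists_sphereCoord_lift hU hinj
  have hex : ∀ p, ∃ G g : ℂ → ℂ, p ∈ N.P → AnalyticAt ℂ g 0 ∧ AnalyticAt ℂ G 0 ∧ (∀ᶠ t in 𝓝 0, HasDerivAt G (g t) t) ∧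
      coeff (N.ζ p) η =ᶠ[𝓝[≠] 0] g ∧ LocPrim η p fun z => G (N.ζ p z) := by
    intro p
    by_cases hp : p ∈ N.P
    · obtain ⟨G, g, h⟩ := (hη p hp).exists_locPrim (N.std p hp).mem_atlas (N.std p hp).mem_source
      rw [(N.std p hp).map_center] at h
      exact ⟨G, g, fun _ => h⟩
    · exact ⟨0, 0, fun h => absurd h hp⟩
  choose G g hG using hex
  have hr : ∀ p ∈ N.P, N.r p = 1 := fun p hp => (N.std p hp).order_eq_one (hR p hp)
  refine ⟨fun p z => G p (N.ζ p z), fun p u => G p (v u), fun p hp => (hG p hp).2.2.2.2,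
    fun p hp => AnalyticAt.comp_of_eq (f := v) (hG p hp).2.1 hv hv0, ?_, ?_⟩
  · intro p hp
    filter_upwards [he] with u hu z hz hx
    rw [(N.std p hp).x_eq hz, N.x_center hp, hr p hp, pow_one, hu] at hx
    rw [sphereCoord_injective _ hx]
  · have hlt : ∀ᶠ u in 𝓝 c, ‖v u‖ < N.ρ ^ N.m := by
      refine hv.continuousAt.norm.eventually (gt_mem_nhds ?_)
      simpa only [hv0, norm_zero] using pow_pos N.ρ_pos _
    have hloc : ∀ᶠ u in 𝓝[≠] c, ∀ p ∈ N.P, deriv (fun u => G p (v u)) u =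
        localTrace C η (N.ζ p) (φ c) (v u) * deriv v u := by
      refine (N.P.eventually_all).2 fun p hp => ?_
      obtain ⟨-, -, h1, h2, -⟩ := hG p hp
      have hstd := N.std p hp
      rw [hr p hp] at hstd
      have h3 := (hstd.localTrace_eventuallyEq η).trans h2
      rw [N.x_center hp] at h3
      have h4 : ∀ᶠ u in 𝓝[≠] c, HasDerivAt (G p) (g p (v u)) (v u) ∧ localTrace C η (N.ζ p) (φ c) (v u) = g p (v u) :=
        eventually_nhdsNE_comp hv.continuousAt (by
          filter_upwards [hd] with u hu
          rw [hv0]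
          exact hu.1) (by
          rw [hv0]
          exact (h1.filter_mono nhdsWithin_le_nhds).and h3)
      filter_upwards [h4, hv.eventually_analyticAt.filter_mono nhdsWithin_le_nhds] with u h5 h6
      rw [h5.2]
      exact (HasDerivAt.comp (h := v) u h5.1 h6.differentiableAt.hasDerivAt).deriv
    filter_upwards [he.filter_mono nhdsWithin_le_nhds, hd, hlt.filter_mono nhdsWithin_le_nhds, hloc] with u h1 h2 h3 h4
    rw [Finset.sum_congr rfl h4]
    simp only [localTrace]
    rw [h2.2, h1, N.fibreSum_eq η h3, ← Finset.sum_mul, ← Finset.mul_sum]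
    ring

end Trace

/-! ### Lifts of circles -/

section Lifts

variable {X : Type*} [TopologicalSpace X] [ChartedSpace ℂ X] [T2Space X] [IsManifold 𝓘(ℂ) ⊤ X]
  {C : SpectralCurve X} {η : X → ℂ} {A : Set X}

/-- A fibre neighbourhood of an unramified fibre is a trivialisation of the covering. -/
theorem FibreNhd.inter_preimage_eq_image {b : OnePoint ℂ} (N : FibreNhd C A b) (hR : ∀ p ∈ N.P, p ∉ C.Ram) {w : ℂ}
    (hw : ‖w‖ < N.ρ ^ N.m) :
    A ∩ C.x ⁻¹' {sphereCoord b w} = (fun p => (N.ζ p).symm w) '' N.P ∧ InjOn (fun p => (N.ζ p).symm w) N.P := by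
  have hr : ∀ p ∈ N.P, N.r p = 1 := fun p hp => (N.std p hp).order_eq_one (hR p hp)
  have hwt : ∀ p ∈ N.P, w ∈ (N.ζ p).target := fun p hp => by
    rw [N.target p hp, mem_ball_zero_iff]
    have := N.k_mul p hp
    rw [hr p hp, mul_one] at this
    rwa [this]
  constructor
  · ext z
    constructor
    · rintro ⟨hz, hx⟩
      obtain ⟨p, hp, hzp⟩ := N.exhaust z hz w hw hx
      rw [mem_preimage, mem_singleton_iff, (N.std p hp).x_eq hzp, N.x_center hp, hr p hp, pow_one] at hx
      exact ⟨p, hp, by simp only [← sphereCoord_injective _ hx, (N.ζ p).left_inv hzp]⟩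
    · rintro ⟨p, hp, rfl⟩
      refine ⟨N.subset p hp ((N.ζ p).map_target (hwt p hp)), ?_⟩
      rw [mem_preimage, mem_singleton_iff, (N.std p hp).x_symm (hwt p hp), N.x_center hp, hr p hp, pow_one]
  · intro p hp p' hp' h
    by_contra hne
    refine (N.disj hp hp' hne).le_bot ⟨(N.ζ p).map_target (hwt p hp), ?_⟩
    simp only at h
    rw [h]
    exact (N.ζ p').map_target (hwt p' hp')

/-- The lifts of a curve which avoids the branch points: at each time they pass through each point of the
fibre exactly once. -/
theorem bijOn_lifts {φ : ℂ → OnePoint ℂ} {c : unitInterval → ℂ} (hc : Continuous c)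
    (hφ : ∀ t, HolomorphicAt φ (c t) ∧ ∃ U ∈ 𝓝 (c t), InjOn φ U) (hN : ∀ t, Nonempty (FibreNhd C A (φ (c t))))
    (hR : ∀ t, ∀ z ∈ A, C.x z = φ (c t) → z ∉ C.Ram) {F : Finset X} (hF : (F : Set X) = A ∩ C.x ⁻¹' {φ (c 0)})
    {lift : X → C(unitInterval, X)}
    (hlift : ∀ z ∈ F, lift z 0 = z ∧ ∀ t, lift z t ∈ A ∧ C.x (lift z t) = φ (c t)) (t : unitInterval) :
    BijOn (fun z => lift z t) F (A ∩ C.x ⁻¹' {φ (c t)}) := by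
  have N := fun t => (hN t).some
  have hNR : ∀ t, ∀ p ∈ (N t).P, p ∉ C.Ram := fun t p hp =>
    hR t p ((N t).mem_P.1 hp).1 ((N t).mem_P.1 hp).2
  have hmaps : ∀ t, MapsTo (fun z => lift z t) F (A ∩ C.x ⁻¹' {φ (c t)}) := fun t z hz => (hlift z hz).2 t
  -- lifts that meet once agree at all times, as the set of such times is open and closed
  have hinj : ∀ t, InjOn (fun z => lift z t) F := by
    intro t z hz z' hz' h
    by_contra hne
    have hclopen : IsClopen {s | lift z s = lift z' s} := by
      refine ⟨isClosed_eq (lift z).continuous (lift z').continuous, isOpen_iff_mem_nhds.2 fun s hs => ?_⟩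
      have hs : lift z s = lift z' s := hs
      have hp : lift z s ∈ (N s).P := (N s).mem_P.2 ((hlift z hz).2 s)
      have hp' := ((N s).std _ hp).mem_source
      have hr := ((N s).std _ hp).order_eq_one (hNR s _ hp)
      filter_upwards [(lift z).continuous.continuousAt.preimage_mem_nhds (((N s).ζ _).open_source.mem_nhds hp'),
        (lift z').continuous.continuousAt.preimage_mem_nhds (((N s).ζ (lift z s)).open_source.mem_nhds (by rwa [← hs]))]
        with s' h1 h2
      have h3 := ((hlift z hz).2 s').2.trans ((hlift z' hz').2 s').2.symm
      rw [((N s).std _ hp).x_eq h1, ((N s).std _ hp).x_eq h2, hr, pow_one, pow_one] at h3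
      exact ((N s).ζ _).injOn h1 h2 (sphereCoord_injective _ h3)
    have h0 : (0 : unitInterval) ∈ {s | lift z s = lift z' s} := by
      rw [hclopen.eq_univ ⟨t, h⟩]
      trivial
    exact hne ((hlift z hz).1.symm.trans (h0.trans (hlift z' hz').1))
  -- the cardinality of the fibre is constant, so injectivity gives surjectivity
  have hcard : IsLocallyConstant fun t => (A ∩ C.x ⁻¹' {φ (c t)}).ncard := by
    refine (IsLocallyConstant.iff_eventually_eq _).2 fun s => ?_
    obtain ⟨U, hU, hUi⟩ := (hφ s).2
    obtain ⟨v, hv, hv0, -, he, -⟩ := (hφ s).1.exists_sphereCoord_lift hU hUi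
    have hlt : ∀ᶠ u in 𝓝 (c s), ‖v u‖ < (N s).ρ ^ (N s).m := by
      refine hv.continuousAt.norm.eventually (gt_mem_nhds ?_)
      simpa only [hv0, norm_zero] using pow_pos (N s).ρ_pos _
    have key : ∀ w : ℂ, ‖w‖ < (N s).ρ ^ (N s).m →
        (A ∩ C.x ⁻¹' {sphereCoord (φ (c s)) w}).ncard = (N s).P.card := by
      intro w hw
      obtain ⟨h1, h2⟩ := (N s).inter_preimage_eq_image (hNR s) hw
      rw [h1, h2.ncard_image, ncard_coe_finset]
    filter_upwards [hc.continuousAt.eventually he, hc.continuousAt.eventually hlt] with s' h1 h2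
    rw [h1, key _ h2, ← (N s).coe_P, ncard_coe_finset]
  refine ⟨hmaps t, hinj t, ?_⟩
  have hfin : (A ∩ C.x ⁻¹' {φ (c t)}).Finite := by
    rw [← (N t).coe_P]
    exact Finset.finite_toSet _
  have hcard' : (A ∩ C.x ⁻¹' {φ (c t)}).ncard = (A ∩ C.x ⁻¹' {φ (c 0)}).ncard :=
    hcard.apply_eq_of_isPreconnected isPreconnected_univ trivial trivial
  refine (eq_of_subset_of_ncard_le (hmaps t).image_subset ?_ hfin).symm.subset
  rw [(hinj t).ncard_image, hcard', ← hF]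

/-- The integrals of `η` along the lifts of a circle in the disc sum up to the integral of the trace. -/
theorem sum_pathIntegral_lift {φ : ℂ → OnePoint ℂ} {ρ : ℝ} (hρ : 0 < ρ)
    (hφ : ∀ u ∈ sphere (0 : ℂ) ρ, HolomorphicAt φ u ∧ ∃ U ∈ 𝓝 u, InjOn φ U)
    (hN : ∀ u ∈ sphere (0 : ℂ) ρ, Nonempty (FibreNhd C A (φ u)))
    (hR : ∀ u ∈ sphere (0 : ℂ) ρ, ∀ z ∈ A, C.x z = φ u → z ∉ C.Ram) (hη : ∀ z ∈ A \ C.Ram, RemovableAt η z)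
    {F : Finset X} (hF : (F : Set X) = A ∩ C.x ⁻¹' {φ ρ}) {lift : X → C(unitInterval, X)}
    (hlift : ∀ z ∈ F, lift z 0 = z ∧ ∀ t : unitInterval, lift z t ∈ A ∧
      C.x (lift z t) = φ (ρ * Complex.exp (2 * Real.pi * Complex.I * (t : ℝ))))
    (hint : CircleIntegrable (fun u => fibreSum C η A (φ u) * deriv (fun u => affine (φ u)) u) 0 ρ) :
    ∑ z ∈ F, pathIntegral η (lift z) =
      ∮ u in C(0, ρ), fibreSum C η A (φ u) * deriv (fun u => affine (φ u)) u := by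
  classical
  set τ : ℂ → ℂ := fun u => fibreSum C η A (φ u) * deriv (fun u => affine (φ u)) u with hτ
  set c : unitInterval → ℂ := fun t => ρ * Complex.exp (2 * Real.pi * Complex.I * (t : ℝ)) with hcdef
  have hpi : 0 < 2 * Real.pi := by positivity
  have hc : Continuous c := by
    simp only [hcdef]
    fun_prop
  have hcmap : ∀ t : unitInterval, c t = circleMap 0 ρ (2 * Real.pi * t) := by
    intro t
    simp only [hcdef, circleMap, zero_add]
    push_cast
    ring_nf
  have hcs : ∀ t, c t ∈ sphere (0 : ℂ) ρ := fun t => by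
    rw [hcmap]
    exact circleMap_mem_sphere 0 hρ.le _
  have hc0 : c 0 = ρ := by simp [hcdef]
  have hbij := bijOn_lifts hc (fun t => hφ _ (hcs t)) (fun t => hN _ (hcs t)) (fun t => hR _ (hcs t))
    (by rw [hc0]; exact hF) hlift
  have hprim : ∀ z, ∃ P : unitInterval → ℂ, z ∈ F → PrimAlong η (lift z) P := by
    intro z
    by_cases hz : z ∈ F
    · obtain ⟨P, hP⟩ := exists_primAlong_path (V := A \ C.Ram) (η := η) (fun p hp => by
        obtain ⟨G, -, -, -, -, -, h⟩ := (hη p hp).exists_locPrim (chart_mem_atlas p) (mem_chart_source ℂ p)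
        exact ⟨_, h⟩) (lift z) (by
        rintro _ ⟨t, rfl⟩
        have := (hlift z hz).2 t
        exact ⟨this.1, hR _ (hcs t) _ this.1 this.2⟩)
      exact ⟨P, fun _ => hP⟩
    · exact ⟨0, fun h => absurd h hz⟩
  choose P hP using hprim
  set g : ℝ → unitInterval := fun θ => projIcc 0 1 zero_le_one (θ / (2 * Real.pi)) with hgdef
  have hg : Continuous g := continuous_projIcc.comp (by fun_prop)
  have hcg : ∀ θ ∈ Icc 0 (2 * Real.pi), c (g θ) = circleMap 0 ρ θ := by
    intro θ hθ
    have : ((g θ : unitInterval) : ℝ) = θ / (2 * Real.pi) := by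
      simp only [hgdef]
      rw [projIcc_of_mem zero_le_one ⟨div_nonneg hθ.1 hpi.le, (div_le_one hpi).2 hθ.2⟩]
    rw [hcmap, this, mul_div_cancel₀ _ hpi.ne']
  set Φ : ℝ → ℂ := fun θ => ∑ z ∈ F, P z (g θ) with hΦ
  -- near each time, the sum of the primitives along the lifts is a primitive of the trace
  have hloc : ∀ θ₀ ∈ Icc 0 (2 * Real.pi), ∃ h : ℂ → ℂ, AnalyticAt ℂ h (circleMap 0 ρ θ₀) ∧
      (∃ a, ∀ᶠ θ in 𝓝[Icc 0 (2 * Real.pi)] θ₀, Φ θ = h (circleMap 0 ρ θ) + a) ∧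
      ∀ᶠ u in 𝓝[≠] (circleMap 0 ρ θ₀), deriv h u = τ u := by
    intro θ₀ hθ₀
    have hu : circleMap 0 ρ θ₀ ∈ sphere (0 : ℂ) ρ := circleMap_mem_sphere 0 hρ.le _
    obtain ⟨hφu, U, hU, hinj⟩ := hφ _ hu
    obtain ⟨N⟩ := hN _ hu
    have hNR : ∀ p ∈ N.P, p ∉ C.Ram := fun p hp => hR _ hu p (N.mem_P.1 hp).1 (N.mem_P.1 hp).2
    obtain ⟨f, h, hf, hh, hfh, hd⟩ := trace_comp_of_unramified (η := η) hφu hU hinj N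
      (fun p hp => hη p ⟨(N.mem_P.1 hp).1, hNR p hp⟩) hNR
    have hb : BijOn (fun z => lift z (g θ₀)) F N.P := by
      have := hbij (g θ₀)
      rwa [hcg θ₀ hθ₀, ← N.coe_P] at this
    refine ⟨fun u => ∑ p ∈ N.P, h p u, Finset.analyticAt_fun_sum _ hh,
      ⟨∑ z ∈ F, (P z (g θ₀) - f (lift z (g θ₀)) (lift z (g θ₀))), ?_⟩, ?_⟩
    · have hz : ∀ᶠ θ in 𝓝[Icc 0 (2 * Real.pi)] θ₀, ∀ z ∈ F, P z (g θ) =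
          h (lift z (g θ₀)) (circleMap 0 ρ θ) + (P z (g θ₀) - f (lift z (g θ₀)) (lift z (g θ₀))) := by
        refine (F.eventually_all).2 fun z hz => ?_
        have hp : lift z (g θ₀) ∈ N.P := hb.mapsTo hz
        have hcl : ContinuousAt (fun θ => lift z (g θ)) θ₀ := ((lift z).continuous.comp hg).continuousAt
        obtain ⟨f', hf', e⟩ := ((hP z hz).comp hg) θ₀
        have e1 := hcl.eventually (hf'.sub_eventually_const (hf _ hp))
        have e2 := hcl.preimage_mem_nhds ((N.ζ _).open_source.mem_nhds (N.std _ hp).mem_source)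
        have e3 : ∀ᶠ θ in 𝓝 θ₀, _ := (continuous_circleMap 0 ρ).continuousAt.eventually (hfh _ hp)
        filter_upwards [e.filter_mono nhdsWithin_le_nhds, e1.filter_mono nhdsWithin_le_nhds,
          mem_nhdsWithin_of_mem_nhds e2, e3.filter_mono nhdsWithin_le_nhds, self_mem_nhdsWithin] with θ h1 h2 h3 h4 h5
        have h6 := h4 _ h3 (by
          rw [← hcg θ h5]
          exact ((hlift z hz).2 (g θ)).2)
        linear_combination h1 + h2 + h6
      filter_upwards [hz] with θ hθ
      simp only [hΦ]
      rw [Finset.sum_congr rfl hθ, Finset.sum_add_distrib]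
      congr 1
      exact Finset.sum_nbij (fun z => lift z (g θ₀)) (fun z hz => hb.mapsTo hz) hb.injOn hb.surjOn fun _ _ => rfl
    · have han : ∀ᶠ u in 𝓝 (circleMap 0 ρ θ₀), ∀ p ∈ N.P, AnalyticAt ℂ (h p) u :=
        (N.P.eventually_all).2 fun p hp => (hh p hp).eventually_analyticAt
      filter_upwards [hd, han.filter_mono nhdsWithin_le_nhds] with u h1 h2
      refine Eq.trans ?_ h1
      exact deriv_fun_sum fun p hp => (h2 p hp).differentiableAt
  have hcont : ContinuousOn Φ (Icc 0 (2 * Real.pi)) := by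
    intro θ₀ hθ₀
    obtain ⟨h, hh, ⟨a, e⟩, -⟩ := hloc θ₀ hθ₀
    have h1 : ContinuousAt (fun θ => h (circleMap 0 ρ θ) + a) θ₀ :=
      (ContinuousAt.comp (f := circleMap 0 ρ) hh.continuousAt (continuous_circleMap 0 ρ).continuousAt).add continuousAt_const
    exact h1.continuousWithinAt.congr_of_eventuallyEq e (e.self_of_nhdsWithin hθ₀)
  set B : Set ℝ := {θ | θ ∈ Ioo 0 (2 * Real.pi) ∧ ¬ HasDerivAt Φ (deriv (circleMap 0 ρ) θ • τ (circleMap 0 ρ θ)) θ}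
  have hB : B.Countable := by
    refine countable_of_eventually_notMem fun θ₀ ⟨hθ₀, _⟩ => ?_
    obtain ⟨h, hh, ⟨a, e⟩, hd⟩ := hloc θ₀ (Ioo_subset_Icc_self hθ₀)
    rw [nhdsWithin_eq_nhds.2 (Icc_mem_nhds hθ₀.1 hθ₀.2)] at e
    have hcd := hasDerivAt_circleMap 0 ρ θ₀
    have hne := hcd.eventually_ne (c := circleMap 0 ρ θ₀)
      (by rw [← deriv_circleMap 0 ρ θ₀]; exact deriv_circleMap_ne_zero hρ.ne')
    have h1 := (continuous_circleMap 0 ρ).continuousAt.eventually (eventually_nhdsWithin_iff.1 hd)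
    have h2 := (continuous_circleMap 0 ρ).continuousAt.eventually hh.eventually_analyticAt
    filter_upwards [hne, e.eventually_nhds.filter_mono nhdsWithin_le_nhds, h1.filter_mono nhdsWithin_le_nhds,
      h2.filter_mono nhdsWithin_le_nhds] with θ h3 h4 h5 h6 h7
    refine h7.2 ?_
    have h8 := HasDerivAt.scomp (g₁ := h) (h := circleMap 0 ρ) θ h6.differentiableAt.hasDerivAt
      (hasDerivAt_circleMap 0 ρ θ)
    rw [h5 h3, ← deriv_circleMap 0 ρ θ] at h8
    exact (h8.add_const a).congr_of_eventuallyEq h4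
  have hFTC := MeasureTheory.integral_eq_of_hasDerivAt_off_countable_of_le Φ
    (fun θ => deriv (circleMap 0 ρ) θ • τ (circleMap 0 ρ θ)) hpi.le hB hcont
    (fun θ hθ => by_contra fun h => hθ.2 ⟨hθ.1, h⟩) ((circleIntegrable_iff ρ).1 hint)
  rw [circleIntegral, hFTC]
  simp only [hΦ]
  rw [← Finset.sum_sub_distrib]
  refine Finset.sum_congr rfl fun z hz => ?_
  have h0 : g 0 = 0 := by simp [hgdef]
  have h1 : g (2 * Real.pi) = 1 := by simp [hgdef]
  rw [(hP z hz).pathIntegral_eq, h0, h1]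

end Lifts

/-! ### Contour integrals over the components -/

section Contours

variable {X : Type*} [TopologicalSpace X] [ChartedSpace ℂ X] [T2Space X] [IsManifold 𝓘(ℂ) ⊤ X]
  {C : SpectralCurve X} {η : X → ℂ} {A : Set X}

/-- The residue theorem on a branched covering `A` of a disc. -/
theorem IsBoundaryContour.integral_eq {D : Set (OnePoint ℂ)} {Γ : List (Loop X)} (hΓ : IsBoundaryContour C D A Γ)
    (hfin : C.Ram.Finite) (hN : ∀ b ∈ D, Nonempty (FibreNhd C A b)) (hmer : ∀ z ∈ A, MerAt η z)
    (hrem : ∀ z ∈ A \ C.Ram, RemovableAt η z) :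
    (∀ γ ∈ Γ, IntervalIntegrable (γ.pullback η) MeasureTheory.volume 0 1) ∧
      (Γ.map fun γ => γ.integral η).sum =
        2 * Real.pi * Complex.I * ∑ p ∈ (hfin.inter_of_right A).toFinset, residueAt η p := by
  classical
  obtain ⟨hΓA, φ, ρ, F, lift, hhol, hinj, himg, hρ0, hρ1, hbr, hF, hlift, hhom⟩ := hΓ
  have hprim : ∀ z ∈ A \ C.Ram, ∃ f, LocPrim η z f := fun z hz => by
    obtain ⟨G, -, -, -, -, -, h⟩ := (hrem z hz).exists_locPrim (chart_mem_atlas z) (mem_chart_source ℂ z)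
    exact ⟨_, h⟩
  refine ⟨fun γ hγ => (γ.integral_eq_pathIntegral hprim (hΓA γ hγ)).1, ?_⟩
  have h1 : (Γ.map fun γ => γ.integral η).sum = ∑ z ∈ F, pathIntegral η (lift z) := by
    have h := chainIntegral_eq_of_homologous hprim hhom
    rw [map_list_sum, map_sum, List.map_map] at h
    simp only [chainIntegral_single] at h
    rw [← h]
    refine congrArg List.sum (List.map_congr_left fun γ hγ => ?_)
    rw [(γ.integral_eq_pathIntegral hprim (hΓA γ hγ)).2, Function.comp, chainIntegral_single]
  -- `ψ` maps ramification points to the preimages by `φ` of their images; these are the poles of the trace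
  set R := (hfin.inter_of_right A).toFinset with hRdef
  have hmemR : ∀ {p}, p ∈ R ↔ p ∈ A ∧ p ∈ C.Ram := fun {p} => by
    rw [hRdef, Finite.mem_toFinset]
    rfl
  have hball : ∀ u ∈ closedBall (0 : ℂ) ρ, u ∈ ball (0 : ℂ) 1 := fun u hu => closedBall_subset_ball hρ1 hu
  have hψ : ∀ p, ∃ u, p ∈ R → u ∈ ball (0 : ℂ) ρ ∧ φ u = C.x p := by
    intro p
    by_cases hp : p ∈ R
    · obtain ⟨u, hu, e⟩ := hbr ⟨p, hmemR.1 hp, rfl⟩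
      exact ⟨u, fun _ => ⟨hu, e⟩⟩
    · exact ⟨0, fun h => absurd h hp⟩
  choose ψ hψ using hψ
  have hψ_eq : ∀ p ∈ R, ∀ u ∈ closedBall (0 : ℂ) ρ, C.x p = φ u → ψ p = u := fun p hp u hu e =>
    hinj (hball _ (ball_subset_closedBall (hψ p hp).1)) (hball u hu) ((hψ p hp).2.trans e)
  have hφ : ∀ u ∈ closedBall (0 : ℂ) ρ, HolomorphicAt φ u ∧ ∃ U ∈ 𝓝 u, InjOn φ U := fun u hu =>
    ⟨hhol u (hball u hu), _, isOpen_ball.mem_nhds (hball u hu), hinj⟩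
  have hN' : ∀ u ∈ closedBall (0 : ℂ) ρ, Nonempty (FibreNhd C A (φ u)) := fun u hu =>
    hN _ (himg ▸ mem_image_of_mem φ (hball u hu))
  have hdisj : ∀ u ∈ closedBall (0 : ℂ) ρ, u ∉ R.image ψ → ∀ z ∈ A, C.x z = φ u → z ∉ C.Ram := by
    intro u hu huS z hz hx hzR
    have hzR' := hmemR.2 ⟨hz, hzR⟩
    exact huS (Finset.mem_image.2 ⟨z, hzR', hψ_eq z hzR' u hu hx⟩)
  have hS : ∀ s ∈ R.image ψ, s ∈ ball (0 : ℂ) ρ := fun s hs => by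
    obtain ⟨p, hp, rfl⟩ := Finset.mem_image.1 hs
    exact (hψ p hp).1
  have htr : ∀ s ∈ R.image ψ, MeromorphicAt (fun u => fibreSum C η A (φ u) * deriv (fun u => affine (φ u)) u) s ∧
      res (fun u => fibreSum C η A (φ u) * deriv (fun u => affine (φ u)) u) s =
        ∑ p ∈ R.filter (fun p => ψ p = s), residueAt η p := by
    intro s hs
    have hs' := ball_subset_closedBall (hS s hs)
    obtain ⟨hφs, U, hU, hUi⟩ := hφ s hs'
    obtain ⟨N⟩ := hN' s hs'
    obtain ⟨h2, h3⟩ := trace_comp hφs hU hUi N fun p hp => hmer p (N.mem_P.1 hp).1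
    refine ⟨h2, h3.trans (Finset.sum_subset (fun p hp => ?_) fun p hp hp' => ?_).symm⟩
    · obtain ⟨hpR, rfl⟩ := Finset.mem_filter.1 hp
      exact N.mem_P.2 ⟨(hmemR.1 hpR).1, (hψ p hpR).2.symm⟩
    · have hpA := (N.mem_P.1 hp).1
      refine (hrem p ⟨hpA, fun hpR => hp' ?_⟩).residueAt_eq_zero
      have hpR' := hmemR.2 ⟨hpA, hpR⟩
      exact Finset.mem_filter.2 ⟨hpR', hψ_eq p hpR' s hs' (N.mem_P.1 hp).2⟩
  obtain ⟨hint, hval⟩ := circleIntegral_eq_sum_res hρ0 (R.image ψ) hS (fun s hs => (htr s hs).1) (by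
    intro u hu huS
    obtain ⟨hφu, U, hU, hUi⟩ := hφ u hu
    obtain ⟨N⟩ := hN' u hu
    have hNR : ∀ p ∈ N.P, p ∉ C.Ram := fun p hp => hdisj u hu huS p (N.mem_P.1 hp).1 (N.mem_P.1 hp).2
    obtain ⟨f, h, -, hh, -, hd⟩ := trace_comp_of_unramified (η := η) hφu hU hUi N
      (fun p hp => hrem p ⟨(N.mem_P.1 hp).1, hNR p hp⟩) hNR
    exact ⟨fun u => ∑ p ∈ N.P, deriv (h p) u, Finset.analyticAt_fun_sum _ fun p hp => (hh p hp).deriv,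
      hd.mono fun _ h => h.symm⟩)
  have hsph : ∀ u ∈ sphere (0 : ℂ) ρ, u ∉ R.image ψ := fun u hu h => by
    have h2 := mem_ball_zero_iff.1 (hS u h)
    exact h2.ne (mem_sphere_zero_iff_norm.1 hu)
  have h2 := sum_pathIntegral_lift (η := η) hρ0 (fun u hu => hφ u (sphere_subset_closedBall hu))
    (fun u hu => hN' u (sphere_subset_closedBall hu))
    (fun u hu => hdisj u (sphere_subset_closedBall hu) (hsph u hu)) hrem hF hlift hint
  rw [h1, h2, hval, Finset.sum_congr rfl fun s hs => (htr s hs).2]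
  rw [Finset.sum_fiberwise_of_maps_to fun p hp => Finset.mem_image_of_mem ψ hp]

end Contours

end TopRec

theorem mainTheorem7 {X : Type*} [TopologicalSpace X] [T2Space X] [ChartedSpace ℂ X]
    [IsManifold 𝓘(ℂ) ⊤ X] (C : TopRec.SpectralCurve X) (hC : C.LocallyAdmissible)
    (ω : TopRec.Correlators C) (hω : TopRec.SatisfiesTR ω)
    {k : ℕ} (D : Fin k → Set (OnePoint ℂ)) (hD : TopRec.IsAdapted C D)
    (hglob : ∀ i, ∀ Dt ∈ TopRec.plusComponents C (D i), TopRec.GlobalisableOverOpen ω Dt) :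
    ∃ α : Fin k → Set X → X → X → ℂ,
      (∀ i, ∀ Dt ∈ TopRec.plusComponents C (D i), TopRec.IsPrimitive C Dt (α i Dt)) ∧
      ∀ g n : ℕ, 2 < 2 * g + (1 + n) →
      ∀ (w₀ : X) (w : Fin n → X), w₀ ∉ TopRec.plusUnion C D →
      (∀ l, w l ∉ TopRec.plusUnion C D) →
      ∀ Γ : Fin k → Set X → List (TopRec.Loop X),
      (∀ i, ∀ Dt ∈ TopRec.plusComponents C (D i),
        TopRec.IsBoundaryContour C (D i) Dt (Γ i Dt)) →
      (∀ i, ∀ Dt ∈ TopRec.plusComponents C (D i), ∀ γ ∈ Γ i Dt,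
        IntervalIntegrable (γ.pullback (TopRec.integrand ω (α i Dt) Dt g w₀ w))
          MeasureTheory.volume 0 1) ∧
      ω.corr g (w₀ ::ₘ TopRec.pts w) =
        (2 * Real.pi * Complex.I)⁻¹ * ∑ i, ∑ᶠ Dt ∈ TopRec.plusComponents C (D i),
          ((Γ i Dt).map fun γ => γ.integral (TopRec.integrand ω (α i Dt) Dt g w₀ w)).sum := by
  have hstd := hω.hasStandardCoordinates
  have hfin : C.Ram.Finite := hC.1
  have hα : ∀ i, ∀ Dt, ∃ α, Dt ∈ TopRec.plusComponents C (D i) → TopRec.IsPrimitive C Dt α := by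
    intro i Dt
    by_cases h : Dt ∈ TopRec.plusComponents C (D i)
    · obtain ⟨α, hα⟩ := TopRec.exists_isPrimitive (C := C) (h.1.isOpen (hD.isOpen i)) (by
        obtain ⟨p, -, rfl⟩ := h.1
        exact isPreconnected_connectedComponentIn)
        fun γ hγ w₀ hw₀ => hD.periods i γ (hγ.trans h.1.subset) w₀ hw₀
      exact ⟨α, fun _ => hα⟩
    · exact ⟨fun _ _ => 0, fun h' => absurd h' h⟩
  choose α hα using hα
  refine ⟨α, hα, fun g n hgn w₀ w hw₀ hw Γ hΓ => ?_⟩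
  have hsub : ∀ i, ∀ Dt ∈ TopRec.plusComponents C (D i), Dt ⊆ TopRec.plusUnion C D := fun i Dt h z hz =>
    mem_iUnion.2 ⟨i, Dt, h, hz⟩
  have hne : ∀ {z}, z ∈ TopRec.plusUnion C D → z ≠ w₀ := fun hz h => hw₀ (h ▸ hz)
  -- near each point of a component, the integrand is meromorphic, and holomorphic if unramified
  have hloc : ∀ i, ∀ Dt ∈ TopRec.plusComponents C (D i), ∀ z ∈ Dt,
      TopRec.MerAt (TopRec.integrand ω (α i Dt) Dt g w₀ w) z ∧
      (z ∉ C.Ram → TopRec.RemovableAt (TopRec.integrand ω (α i Dt) Dt g w₀ w) z) := by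
    intro i Dt h z hz
    obtain ⟨N, hN⟩ := hD.exists_fibreNhd hstd h.1 (hglob i Dt h) (h.1.subset hz)
    have hwN : ∀ l, w l ∉ C.Ram ∧ w l ∉ N.P := fun l =>
      ⟨fun h' => hw l (hD.Ram_subset h'), fun h' => hw l (hsub i Dt h (N.mem_P.1 h').1)⟩
    have hzN : z ∈ N.P := N.mem_P.2 ⟨hz, rfl⟩
    exact ⟨TopRec.FibreNhd.merAt_integrand hstd ω (hα i Dt h) g hwN hzN w₀, fun hzR =>
      TopRec.FibreNhd.removableAt_integrand hstd hN (h.1.isOpen (hD.isOpen i)) (hα i Dt h) hgn hwN hzN hzR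
        (hne (hsub i Dt h hz))⟩
  have hcont := fun i Dt (h : Dt ∈ TopRec.plusComponents C (D i)) =>
    (hΓ i Dt h).integral_eq hfin (fun b hb => by
      obtain ⟨N, -⟩ := hD.exists_fibreNhd hstd h.1 (hglob i Dt h) hb
      exact ⟨N⟩) (fun z hz => (hloc i Dt h z hz).1) fun z hz => (hloc i Dt h z hz.1).2 hz.2
  refine ⟨fun i Dt h => (hcont i Dt h).1, ?_⟩
  rw [TopRec.corr_eq_sum_residueAt hfin hω hD hglob hα hgn hw₀ hw, Finset.mul_sum]
  refine Finset.sum_congr rfl fun i _ => ?_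
  rw [finsum_mem_congr rfl fun Dt h => (hcont i Dt h).2]
  have hmul : ∀ (c : ℂ) (f : Set X → ℂ) (s : Set (Set X)), c * ∑ᶠ V ∈ s, f V = ∑ᶠ V ∈ s, c * f V := fun c f s => by
    simp only [← smul_eq_mul c, smul_finsum]
  rw [← hmul, ← mul_assoc, inv_mul_cancel₀ Complex.two_pi_I_ne_zero, one_mul]
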